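/- **Theorem (existence and uniqueness of Young modules of type $C$).** Let $K$ be a field, $\delta\in K$ with $\delta\neq 0$, and $r\ge 0$. *The algebra.* Let $B=\mathcal B(C_r,\delta)$ be the Brauer algebra of type $C$: its basis consists of the perfect matchings of $2r$ top and $2r$ bottom vertices, each row labelled by $-r,\dots,-1,1,\dots,r$, that are invariant under $v\mapsto -v$; two diagrams are multiplied by concatenation, with a factor $\delta$ for each closed loop. Let $J_m$ be the two-sided ideal generated by the diagrams with at least $m$ horizontal edges in the top row. For $0\le l\le r$ let $e_l\in B$ be $\delta^{-l}$ times the diagram with horizontal edges $\{-i,i\}$, $1\le i\le l$, in both rows and with vertical edges joining $v$ to $v$ for $|v|>l$. *The groups.* Let $W_n$ be the hyperoctahedral group of permutations of $\{\pm1,\dots,\pm n\}$ commuting with $v\mapsto -v$, and $\mathcal W_n=KW_n$. The algebra $\mathcal W_{r-l}$ acts from the left on $e_lB$ and on $e_l(B/J_{l+1})$ through the diagrams of permutations of $\pm(l+1),\dots,\pm r$ that fix $\pm1,\dots,\pm l$. All modules are right modules. For a right $\mathcal W_{r-l}$-module $M$ put $$\operatorname{Ind}_l M=M\otimes_{\mathcal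 W_{r-l}}e_lB,\qquad \operatorname{ind}_l M=M\otimes_{\mathcal W_{r-l}}e_l(B/J_{l+1}).$$ *Modules of $\mathcal W_n$.* For a bipartition $\lambda=(\lambda^1,\lambda^2)$ of $n$, a $\lambda$-bitableau $t=(t^1,t^2)$ is a filling of the boxes of the two Young diagrams by elements of $\{\pm1,\dots,\pm n\}$ with distinct absolute values. Its row group consists of the elements of $W_n$ that permute the entries in each row and may in addition change signs of entries of $t^2$; its column group $C_t$ consists of those that permute the entries in each column and may in addition change signs of entries of $t^1$. The permutation module $M(\lambda)$ has as basis the bitabloids $\{t\}$, that is, the classes of bitableaux under their row groups. The Specht module $S(\lambda)\subseteq M(\lambda)$ is spanned by the elements $\{t\}\sum_{\sigma\in C_t}\operatorname{sgn}(\sigma)\,\sigma$, where $\operatorname{sgn}(\sigma)$ is $(-1)^{x}$ times the sign of the permutation $|\sigma|$ of $\{1,\dots,n\}$ induced by $\sigma$, and $x$ is the number of $i\in\{1,\dots,n\}$ with $\sigma(i)<0$. The Young module $Y(\lambda)$ is an indecomposable direct summand of $M(\lambda)$ that contains $S(\lambda)$. *Claim.* Let $0\le l\le r$, let $\lambda$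 be a bipartition of $r-l$, and put $M(l,\lambda)=\operatorname{Ind}_lM(\lambda)$. Then a Young module $Y(\lambda)$ as above exists, and for every choice of it the following hold. 1. The $B$-module $M(l,\lambda)$ has an indecomposable direct summand with a quotient isomorphic to $\operatorname{ind}_lY(\lambda)$, and any two such summands are isomorphic. 2. In every decomposition of $M(l,\lambda)$ as a finite direct sum of indecomposable submodules there is exactly one summand with a quotient isomorphic to $\operatorname{ind}_lY(\lambda)$. This summand, unique up to isomorphism, is called the Young module $Y(l,\lambda)$ of $B$. -/

import Mathlib

namespace TypeC

/-! ### Stacking set partitions -/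

section Stacking

open Relation

variable {V : Type*}

/-- Relation generated on the vertices of three rows (top, middle, bottom) when the two-row
graph `a` occupies the upper two rows and `b` the lower two rows. -/
def stackStep (a b : V ⊕ V → V ⊕ V → Prop) : V ⊕ (V ⊕ V) → V ⊕ (V ⊕ V) → Prop :=
  fun u v => Relation.Map a (Sum.map id Sum.inl) (Sum.map id Sum.inl) u v ∨
    Relation.Map b Sum.inr Sum.inr u v

/-- Connectivity in the three-row graph obtained by placing `a` on top of `b`. -/
def stack (a b : Setoid (V ⊕ V)) : Setoid (V ⊕ (V ⊕ V)) :=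
  EqvGen.setoid (stackStep a b)

/-- Inclusion of the outer two rows into three rows. -/
def outer : V ⊕ V → V ⊕ (V ⊕ V) := Sum.map id Sum.inr

/-- Connectivity between outer vertices in the three-row graph. -/
def compRel (a b : Setoid (V ⊕ V)) : Setoid (V ⊕ V) := (stack a b).comap outer

/-- The components of an equivalence relation that avoid the set `O`. -/
def Avoid {U : Type*} (s : Setoid U) (O : Set U) : Type _ :=
  {c : Quotient s // ∀ u ∈ O, Quotient.mk s u ≠ c}

/-- The number of components of the three-row graph lying entirely in the middle row
(the closed loops). -/
noncomputable def loops (a b : Setoid (V ⊕ V)) : ℕ :=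
  Nat.card (Avoid (stack a b) (Set.range outer))

section Elim

variable {U A T : Type*} {i : A → U} {j : T → U} (r : A → A → Prop) (q : T → T → Prop)

def bigSetoid (i : A → U) (j : T → U) (r : A → A → Prop) (q : T → T → Prop) : Setoid U :=
  EqvGen.setoid fun u v => Relation.Map r i i u v ∨ Relation.Map q j j u v

def smallSetoid (i : A → U) (j : T → U) (r : A → A → Prop) (q : T → T → Prop) : Setoid T :=
  EqvGen.setoid fun x y => (∃ x' y', i x' = j x ∧ i y' = j y ∧ EqvGen r x' y') ∨ q x y

theorem big_of_eqvGen {x y : A} (h : EqvGen r x y) : bigSetoid i j r q (i x) (i y) := by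
  induction h with
  | rel x y h => exact EqvGen.rel _ _ (Or.inl ⟨x, y, h, rfl, rfl⟩)
  | refl x => exact EqvGen.refl _
  | symm x y _ ih => exact EqvGen.symm _ _ ih
  | trans x y z _ _ h1 h2 => exact EqvGen.trans _ _ _ h1 h2

theorem big_of_small {x y : T} (h : smallSetoid i j r q x y) :
    bigSetoid i j r q (j x) (j y) := by
  induction h with
  | rel x y h =>
    rcases h with ⟨x', y', hx, hy, h⟩ | h
    · rw [← hx, ← hy]; exact big_of_eqvGen r q h
    · exact EqvGen.rel _ _ (Or.inr ⟨x, y, h, rfl, rfl⟩)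
  | refl x => exact EqvGen.refl _
  | symm x y _ ih => exact EqvGen.symm _ _ ih
  | trans x y z _ _ h1 h2 => exact EqvGen.trans _ _ _ h1 h2

/-- Induction principle for one endpoint. -/
theorem eqvGen_invariant {X : Type*} {r : X → X → Prop} {P : X → Prop}
    (h : ∀ x y, r x y → (P x ↔ P y)) {x y : X} (hxy : EqvGen r x y) : P x ↔ P y := by
  induction hxy with
  | rel x y hr => exact h x y hr
  | refl x => exact Iff.rfl
  | symm x y _ ih => exact ih.symm
  | trans x y z _ _ h1 h2 => exact h1.trans h2

theorem small_iff_big (hi : Function.Injective i) (hj : Function.Injective j) {x y : T} :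
    smallSetoid i j r q x y ↔ bigSetoid i j r q (j x) (j y) := by
  refine ⟨big_of_small r q, fun h => ?_⟩
  let P : U → Prop := fun u => ∃ z, smallSetoid i j r q x z ∧
    (u = j z ∨ ∃ z' u', i z' = j z ∧ i u' = u ∧ EqvGen r z' u')
  have key : ∀ u, P u → ∀ z, u = j z → smallSetoid i j r q x z := by
    rintro u ⟨w, hw, h | ⟨z', u', h1, h2, h3⟩⟩ z hz
    · have := hj (h.symm.trans hz); subst this; exact hw
    · exact EqvGen.trans _ _ _ hw (EqvGen.rel _ _ (Or.inl ⟨z', u', h1, h2.trans hz, h3⟩))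
  have inv1 : ∀ u v, r u v ∨ r v u → P (i u) → P (i v) := by
    rintro u v huv ⟨w, hw, h⟩
    have huv' : EqvGen r u v := huv.elim (EqvGen.rel _ _) fun h => EqvGen.symm _ _ (EqvGen.rel _ _ h)
    rcases h with h | ⟨z', u', h1, h2, h3⟩
    · exact ⟨w, hw, Or.inr ⟨u, v, h, rfl, huv'⟩⟩
    · obtain rfl := hi h2
      exact ⟨w, hw, Or.inr ⟨z', v, h1, rfl, h3.trans _ _ _ huv'⟩⟩
  have hP : P (j x) ↔ P (j y) := by
    refine eqvGen_invariant ?_ h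
    rintro u v (⟨u, v, h, rfl, rfl⟩ | ⟨u, v, h, rfl, rfl⟩)
    · exact ⟨inv1 u v (Or.inl h), inv1 v u (Or.inr h)⟩
    · constructor
      · intro hu
        exact ⟨v, (key _ hu u rfl).trans _ _ _ (EqvGen.rel _ _ (Or.inr h)), Or.inl rfl⟩
      · intro hu
        exact ⟨u, (key _ hu v rfl).trans _ _ _ (EqvGen.symm _ _ (EqvGen.rel _ _ (Or.inr h))),
          Or.inl rfl⟩
  exact key _ (hP.1 ⟨x, EqvGen.refl _, Or.inl rfl⟩) y rfl

/-- A component of `r` disjoint from the image of `T` stays a component of the whole graph. -/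
theorem closed_component (hi : Function.Injective i) {x : A}
    (hx : ∀ w ∈ i ⁻¹' Set.range j, ¬ EqvGen r w x) {u : U} (h : bigSetoid i j r q (i x) u) :
    ∃ x', i x' = u ∧ EqvGen r x x' := by
  let P : U → Prop := fun u => ∃ x', i x' = u ∧ EqvGen r x x'
  have inv1 : ∀ u v, r u v ∨ r v u → P (i u) → P (i v) := by
    rintro u v huv ⟨w, hw, h⟩
    have huv' : EqvGen r u v := huv.elim (EqvGen.rel _ _) fun h => EqvGen.symm _ _ (EqvGen.rel _ _ h)
    obtain rfl := hi hw
    exact ⟨v, rfl, h.trans _ _ _ huv'⟩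
  have no : ∀ t, ¬ P (j t) := by
    rintro t ⟨x', h1, h2⟩
    exact hx x' ⟨t, h1.symm⟩ (EqvGen.symm _ _ h2)
  have hP : P (i x) ↔ P u := by
    refine eqvGen_invariant ?_ h
    rintro u v (⟨u, v, h, rfl, rfl⟩ | ⟨u, v, h, rfl, rfl⟩)
    · exact ⟨inv1 u v (Or.inl h), inv1 v u (Or.inr h)⟩
    · exact iff_of_false (no u) (no v)
  exact hP.1 ⟨x, rfl, EqvGen.refl _⟩

theorem card_avoid [Finite A] [Finite T] (hi : Function.Injective i) (hj : Function.Injective j)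
    (cover : ∀ u, u ∈ Set.range i ∨ u ∈ Set.range j) (O : Set T) :
    Nat.card (Avoid (bigSetoid i j r q) (j '' O)) =
      Nat.card (Avoid (EqvGen.setoid r) (i ⁻¹' Set.range j)) +
      Nat.card (Avoid (smallSetoid i j r q) O) := by
  have : Finite (Avoid (EqvGen.setoid r) (i ⁻¹' Set.range j)) := Subtype.finite
  have : Finite (Avoid (smallSetoid i j r q) O) := Subtype.finite
  rw [← Nat.card_sum]
  symm
  have cc : ∀ x : A, (∀ w ∈ i ⁻¹' Set.range j,
      Quotient.mk (EqvGen.setoid r) w ≠ Quotient.mk (EqvGen.setoid r) x) →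
      ∀ w ∈ i ⁻¹' Set.range j, ¬ EqvGen r w x :=
    fun x h w hw h' => h w hw (Quotient.sound (s := EqvGen.setoid r) h')
  let f1 : Quotient (EqvGen.setoid r) → Quotient (bigSetoid i j r q) :=
    Quotient.map i fun _ _ h => big_of_eqvGen r q h
  let f2 : Quotient (smallSetoid i j r q) → Quotient (bigSetoid i j r q) :=
    Quotient.map j fun _ _ h => big_of_small r q h
  have h1 : ∀ c : Avoid (EqvGen.setoid r) (i ⁻¹' Set.range j), ∀ t : T,
      Quotient.mk (bigSetoid i j r q) (j t) ≠ f1 c.1 := by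
    rintro ⟨c, hc⟩ t h
    induction c using Quotient.inductionOn with | _ x
    have h := Quotient.exact (s := bigSetoid i j r q) h.symm
    obtain ⟨x', h1, h2⟩ := closed_component r q hi (cc x hc) h
    exact hc x' ⟨t, h1.symm⟩ (Quotient.sound (s := EqvGen.setoid r) (EqvGen.symm _ _ h2))
  have h2 : ∀ c : Avoid (smallSetoid i j r q) O, ∀ u ∈ j '' O,
      Quotient.mk (bigSetoid i j r q) u ≠ f2 c.1 := by
    rintro ⟨c, hc⟩ _ ⟨t, ht, rfl⟩ h
    induction c using Quotient.inductionOn with | _ x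
    have h := Quotient.exact (s := bigSetoid i j r q) h
    exact hc t ht (Quotient.sound (s := smallSetoid i j r q) ((small_iff_big r q hi hj).2 h))
  refine Nat.card_congr (Equiv.ofBijective (Sum.elim
    (fun c => ⟨f1 c.1, by rintro _ ⟨t, _, rfl⟩; exact h1 c t⟩) (fun c => ⟨f2 c.1, h2 c⟩)) ⟨?_, ?_⟩)
  · rintro (⟨c, hc⟩ | ⟨c, hc⟩) (⟨d, hd⟩ | ⟨d, hd⟩) h
    · induction c using Quotient.inductionOn with | _ x
      induction d using Quotient.inductionOn with | _ y
      have h := Quotient.exact (s := bigSetoid i j r q) (Subtype.ext_iff.1 h)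
      obtain ⟨x', h1, h2⟩ := closed_component r q hi (cc x hc) h
      obtain rfl := hi h1
      exact congrArg Sum.inl (Subtype.ext (Quotient.sound (s := EqvGen.setoid r) h2))
    · induction d using Quotient.inductionOn with | _ y
      exact absurd (Subtype.ext_iff.1 h).symm (h1 ⟨c, hc⟩ y)
    · induction c using Quotient.inductionOn with | _ y
      exact absurd (Subtype.ext_iff.1 h) (h1 ⟨d, hd⟩ y)
    · induction c using Quotient.inductionOn with | _ x
      induction d using Quotient.inductionOn with | _ y
      have h := Quotient.exact (s := bigSetoid i j r q) (Subtype.ext_iff.1 h)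
      exact congrArg Sum.inr (Subtype.ext (Quotient.sound (s := smallSetoid i j r q)
        ((small_iff_big r q hi hj).2 h)))
  · rintro ⟨c, hc⟩
    by_cases hT : ∃ t : T, Quotient.mk (bigSetoid i j r q) (j t) = c
    · obtain ⟨t, rfl⟩ := hT
      refine ⟨Sum.inr ⟨Quotient.mk _ t, fun u hu h => hc (j u) ⟨u, hu, rfl⟩ ?_⟩, rfl⟩
      exact Quotient.sound (s := bigSetoid i j r q) (big_of_small r q (Quotient.exact h))
    · induction c using Quotient.inductionOn with | _ u
      rcases cover u with ⟨x, rfl⟩ | ⟨t, rfl⟩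
      · refine ⟨Sum.inl ⟨Quotient.mk _ x, ?_⟩, rfl⟩
        rintro w ⟨t, ht⟩ h
        refine hT ⟨t, ?_⟩
        rw [ht]
        exact Quotient.sound (s := bigSetoid i j r q)
          (big_of_eqvGen r q (Quotient.exact (s := EqvGen.setoid r) h))
      · exact absurd ⟨t, rfl⟩ hT

end Elim

/-- Connectivity in the four-row graph. -/
def stack4 (a b c : Setoid (V ⊕ V)) : Setoid (V ⊕ (V ⊕ (V ⊕ V))) :=
  EqvGen.setoid fun u v =>
    Relation.Map a (Sum.map id Sum.inl) (Sum.map id Sum.inl) u v ∨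
    Relation.Map b (Sum.inr ∘ Sum.map id Sum.inl) (Sum.inr ∘ Sum.map id Sum.inl) u v ∨
    Relation.Map c (Sum.inr ∘ Sum.inr) (Sum.inr ∘ Sum.inr) u v

theorem relMap_or {X Y : Type*} (p q : X → X → Prop) (f : X → Y) (u v : Y) :
    Relation.Map (fun x y => p x y ∨ q x y) f f u v ↔
      Relation.Map p f f u v ∨ Relation.Map q f f u v := by
  simp only [Relation.Map]; grind

theorem relMap_map {X Y Z : Type*} (p : X → X → Prop) (f : X → Y) (g : Y → Z) :
    Relation.Map (Relation.Map p f f) g g = Relation.Map p (g ∘ f) (g ∘ f) :=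
  Relation.map_map ..

theorem stack4_left (a b c : Setoid (V ⊕ V)) :
    stack4 a b c = bigSetoid (Sum.map id (Sum.map id Sum.inl)) (Sum.map id Sum.inr)
      (stackStep a b) (Relation.Map c Sum.inr Sum.inr) := by
  have e1 : (Sum.map id (Sum.map id Sum.inl) ∘ Sum.map id Sum.inl :
      V ⊕ V → V ⊕ (V ⊕ (V ⊕ V))) = Sum.map id Sum.inl := by
    funext x; rcases x with x | x <;> rfl
  have e2 : (Sum.map id (Sum.map id Sum.inl) ∘ Sum.inr :
      V ⊕ V → V ⊕ (V ⊕ (V ⊕ V))) = Sum.inr ∘ Sum.map id Sum.inl := rfl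
  have e3 : (Sum.map id Sum.inr ∘ Sum.inr : V ⊕ V → V ⊕ (V ⊕ (V ⊕ V))) = Sum.inr ∘ Sum.inr := rfl
  unfold stack4 bigSetoid
  congr 1
  funext u v
  unfold stackStep
  rw [relMap_or, relMap_map, relMap_map, relMap_map, or_assoc, e1, e2, e3]

theorem stack4_right (a b c : Setoid (V ⊕ V)) :
    stack4 a b c = bigSetoid Sum.inr (Sum.map id (Sum.map id Sum.inr))
      (stackStep b c) (Relation.Map a (Sum.map id Sum.inl) (Sum.map id Sum.inl)) := by
  have e1 : (Sum.map id (Sum.map id Sum.inr) ∘ Sum.map id Sum.inl :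
      V ⊕ V → V ⊕ (V ⊕ (V ⊕ V))) = Sum.map id Sum.inl := by
    funext x; rcases x with x | x <;> rfl
  unfold stack4 bigSetoid
  congr 1
  funext u v
  unfold stackStep
  rw [relMap_or, relMap_map, relMap_map, relMap_map, e1]
  exact propext or_comm |>.trans (propext or_assoc) |>.trans
    (by rw [or_comm (b := Relation.Map a _ _ _ _)]; grind)

theorem small_left (a b c : Setoid (V ⊕ V)) :
    smallSetoid (Sum.map id (Sum.map id Sum.inl)) (Sum.map id Sum.inr : _ → V ⊕ (V ⊕ (V ⊕ V)))
      (stackStep a b) (Relation.Map c Sum.inr Sum.inr) = stack (compRel a b) c := by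
  unfold smallSetoid stack stackStep
  congr 1
  funext x y
  refine congrArg (· ∨ _) (propext ⟨?_, ?_⟩)
  · rintro ⟨x', y', hx, hy, h⟩
    rcases x with x | x | x <;> rcases x' with x' | x' | x' <;> simp at hx <;>
    rcases y with y | y | y <;> rcases y' with y' | y' | y' <;> simp at hy <;> subst hx hy
    · exact ⟨.inl _, .inl _, h, rfl, rfl⟩
    · exact ⟨.inl _, .inr _, h, rfl, rfl⟩
    · exact ⟨.inr _, .inl _, h, rfl, rfl⟩
    · exact ⟨.inr _, .inr _, h, rfl, rfl⟩
  · rintro ⟨x', y', h, rfl, rfl⟩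
    refine ⟨outer x', outer y', ?_, ?_, h⟩
    · rcases x' with x | x <;> rfl
    · rcases y' with x | x <;> rfl

theorem small_right (a b c : Setoid (V ⊕ V)) :
    smallSetoid Sum.inr (Sum.map id (Sum.map id Sum.inr) : _ → V ⊕ (V ⊕ (V ⊕ V)))
      (stackStep b c) (Relation.Map a (Sum.map id Sum.inl) (Sum.map id Sum.inl)) =
      stack a (compRel b c) := by
  unfold smallSetoid stack stackStep
  congr 1
  funext x y
  refine (propext or_comm).trans (congrArg (_ ∨ ·) (propext ⟨?_, ?_⟩))
  · rintro ⟨x', y', hx, hy, h⟩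
    rcases x with x | x | x <;> rcases x' with x' | x' | x' <;> simp at hx <;>
    rcases y with y | y | y <;> rcases y' with y' | y' | y' <;> simp at hy <;> subst hx hy
    · exact ⟨.inl _, .inl _, h, rfl, rfl⟩
    · exact ⟨.inl _, .inr _, h, rfl, rfl⟩
    · exact ⟨.inr _, .inl _, h, rfl, rfl⟩
    · exact ⟨.inr _, .inr _, h, rfl, rfl⟩
  · rintro ⟨x', y', h, rfl, rfl⟩
    refine ⟨outer x', outer y', ?_, ?_, h⟩
    · rcases x' with x | x <;> rfl
    · rcases y' with x | x <;> rfl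

theorem inj_l : Function.Injective (Sum.map id (Sum.map id Sum.inl) :
    V ⊕ (V ⊕ V) → V ⊕ (V ⊕ (V ⊕ V))) :=
  Function.injective_id.sumMap (Function.injective_id.sumMap Sum.inl_injective)

theorem inj_m : Function.Injective (Sum.map id Sum.inr :
    V ⊕ (V ⊕ V) → V ⊕ (V ⊕ (V ⊕ V))) :=
  Function.injective_id.sumMap Sum.inr_injective

theorem inj_r : Function.Injective (Sum.map id (Sum.map id Sum.inr) :
    V ⊕ (V ⊕ V) → V ⊕ (V ⊕ (V ⊕ V))) :=
  Function.injective_id.sumMap (Function.injective_id.sumMap Sum.inr_injective)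

theorem compRel_assoc (a b c : Setoid (V ⊕ V)) :
    compRel (compRel a b) c = compRel a (compRel b c) := by
  ext u v
  change stack (compRel a b) c (outer u) (outer v) ↔ stack a (compRel b c) (outer u) (outer v)
  rw [← small_left, ← small_right, small_iff_big _ _ inj_l inj_m,
    small_iff_big _ _ Sum.inr_injective inj_r, ← stack4_left, ← stack4_right]
  rcases u with u | u <;> rcases v with v | v <;> rfl

theorem loops_assoc [Finite V] (a b c : Setoid (V ⊕ V)) :
    loops a b + loops (compRel a b) c = loops b c + loops a (compRel b c) := by
  have hl := card_avoid (stackStep a b) (Relation.Map c Sum.inr Sum.inr)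
    (inj_l (V := V)) inj_m (by rintro (u | u | u | u) <;> simp) (Set.range outer)
  have hr := card_avoid (stackStep b c) (Relation.Map a (Sum.map id Sum.inl) (Sum.map id Sum.inl))
    (Sum.inr_injective (α := V)) (inj_r (V := V)) (by rintro (u | u | u | u) <;> simp)
    (Set.range outer)
  have e1 : (Sum.map id (Sum.map id Sum.inl) : V ⊕ (V ⊕ V) → V ⊕ (V ⊕ (V ⊕ V))) ⁻¹'
      Set.range (Sum.map id Sum.inr : V ⊕ (V ⊕ V) → V ⊕ (V ⊕ (V ⊕ V))) = Set.range outer := by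
    ext (u | u | u) <;> simp [outer]
  have e2 : (Sum.inr : V ⊕ (V ⊕ V) → V ⊕ (V ⊕ (V ⊕ V))) ⁻¹'
      Set.range (Sum.map id (Sum.map id Sum.inr) : V ⊕ (V ⊕ V) → V ⊕ (V ⊕ (V ⊕ V))) =
      Set.range outer := by
    ext (u | u | u) <;> simp [outer]
  have e3 : (Sum.map id Sum.inr : V ⊕ (V ⊕ V) → V ⊕ (V ⊕ (V ⊕ V))) '' Set.range outer =
      (Sum.map id (Sum.map id Sum.inr)) '' Set.range outer := by
    rw [← Set.range_comp, ← Set.range_comp]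
    congr 1
    funext u
    rcases u with u | u <;> rfl
  rw [small_left, ← stack4_left, e1] at hl
  rw [small_right, ← stack4_right, e2, ← e3] at hr
  exact hl.symm.trans hr

/-- Connectivity in the diagram of a permutation: the bottom vertex `v` is joined to the top
vertex `σ v`. -/
def permRel (σ : Equiv.Perm V) : Setoid (V ⊕ V) := Setoid.ker (Sum.elim id σ)

theorem permRel_iff (σ : Equiv.Perm V) (u v : V ⊕ V) :
    permRel σ u v ↔ Sum.elim id σ u = Sum.elim id σ v := Iff.rfl

theorem stack_permRel_left (σ : Equiv.Perm V) (a : Setoid (V ⊕ V)) :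
    stack (permRel σ) a = a.comap (Sum.elim (Sum.inl ∘ σ.symm) id) := by
  ext u v
  constructor
  · intro h
    induction h with
    | rel x y h =>
      rcases h with ⟨p, q, h, rfl, rfl⟩ | ⟨p, q, h, rfl, rfl⟩
      · rw [permRel_iff] at h
        rw [Setoid.comap_rel]
        have e : ∀ p : V ⊕ V, (Sum.elim (Sum.inl ∘ σ.symm) id (Sum.map id Sum.inl p) : V ⊕ V) =
            Sum.inl (σ.symm (Sum.elim id σ p)) := by
          rintro (p | p) <;> simp
        rw [e, e, h]
      · exact h
    | refl x => exact a.refl' _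
    | symm x y _ ih => exact a.symm' ih
    | trans x y z _ _ h1 h2 => exact a.trans' h1 h2
  · intro h
    have key : ∀ u, stack (permRel σ) a u (Sum.inr (Sum.elim (Sum.inl ∘ σ.symm) id u)) := by
      rintro (u | u)
      · exact EqvGen.rel _ _ (Or.inl ⟨.inl u, .inr (σ.symm u), by simp [permRel_iff], rfl, rfl⟩)
      · exact EqvGen.refl _
    exact (stack _ _).trans' (key u) ((stack _ _).trans'
      (EqvGen.rel _ _ (Or.inr ⟨_, _, h, rfl, rfl⟩)) ((stack _ _).symm' (key v)))

theorem stack_permRel_right (σ : Equiv.Perm V) (a : Setoid (V ⊕ V)) :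
    stack a (permRel σ) = a.comap (Sum.elim Sum.inl (Sum.elim Sum.inr (Sum.inr ∘ σ))) := by
  ext u v
  constructor
  · intro h
    induction h with
    | rel x y h =>
      rcases h with ⟨p, q, h, rfl, rfl⟩ | ⟨p, q, h, rfl, rfl⟩
      · rcases p with p | p <;> rcases q with q | q <;> exact h
      · rw [permRel_iff] at h
        rw [Setoid.comap_rel]
        have e : ∀ p : V ⊕ V, (Sum.elim Sum.inl (Sum.elim Sum.inr (Sum.inr ∘ σ))
            (Sum.inr p : V ⊕ (V ⊕ V)) : V ⊕ V) = Sum.inr (Sum.elim id σ p) := by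
          rintro (p | p) <;> simp
        rw [e, e, h]
    | refl x => exact a.refl' _
    | symm x y _ ih => exact a.symm' ih
    | trans x y z _ _ h1 h2 => exact a.trans' h1 h2
  · intro h
    have key : ∀ u, stack a (permRel σ) u
        (Sum.map id Sum.inl (Sum.elim Sum.inl (Sum.elim Sum.inr (Sum.inr ∘ σ)) u)) := by
      rintro (u | u | u)
      · exact EqvGen.refl _
      · exact EqvGen.refl _
      · exact EqvGen.rel _ _ (Or.inr ⟨.inr u, .inl (σ u), by simp [permRel_iff], rfl, rfl⟩)
    exact (stack _ _).trans' (key u) ((stack _ _).trans'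
      (EqvGen.rel _ _ (Or.inl ⟨_, _, h, rfl, rfl⟩)) ((stack _ _).symm' (key v)))

theorem compRel_permRel_left (σ : Equiv.Perm V) (a : Setoid (V ⊕ V)) :
    compRel (permRel σ) a = a.comap (Sum.map σ.symm id) := by
  ext u v
  rw [compRel, stack_permRel_left, Setoid.comap_rel, Setoid.comap_rel, Setoid.comap_rel]
  rcases u with u | u <;> rcases v with v | v <;> rfl

theorem compRel_permRel_right (σ : Equiv.Perm V) (a : Setoid (V ⊕ V)) :
    compRel a (permRel σ) = a.comap (Sum.map id σ) := by
  ext u v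
  rw [compRel, stack_permRel_right, Setoid.comap_rel, Setoid.comap_rel, Setoid.comap_rel]
  rcases u with u | u <;> rcases v with v | v <;> rfl

theorem loops_permRel_left (σ : Equiv.Perm V) (a : Setoid (V ⊕ V)) :
    loops (permRel σ) a = 0 := by
  have : IsEmpty (Avoid (stack (permRel σ) a) (Set.range outer)) := by
    refine ⟨fun ⟨c, hc⟩ => ?_⟩
    induction c using Quotient.inductionOn with | _ u
    rcases u with u | u | u
    · exact hc _ ⟨.inl u, rfl⟩ rfl
    · refine hc _ ⟨.inl (σ u), rfl⟩ (Quotient.sound ?_)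
      exact EqvGen.rel _ _ (Or.inl ⟨.inl (σ u), .inr u, by simp [permRel_iff], rfl, rfl⟩)
    · exact hc _ ⟨.inr u, rfl⟩ rfl
  exact Nat.card_of_isEmpty

theorem loops_permRel_right (σ : Equiv.Perm V) (a : Setoid (V ⊕ V)) :
    loops a (permRel σ) = 0 := by
  have : IsEmpty (Avoid (stack a (permRel σ)) (Set.range outer)) := by
    refine ⟨fun ⟨c, hc⟩ => ?_⟩
    induction c using Quotient.inductionOn with | _ u
    rcases u with u | u | u
    · exact hc _ ⟨.inl u, rfl⟩ rfl
    · refine hc _ ⟨.inr (σ.symm u), rfl⟩ (Quotient.sound ?_)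
      exact EqvGen.rel _ _ (Or.inr ⟨.inr (σ.symm u), .inl u, by simp [permRel_iff], rfl, rfl⟩)
    · exact hc _ ⟨.inr u, rfl⟩ rfl
  exact Nat.card_of_isEmpty

/-! ### Perfect matchings are closed under stacking -/

/-- Every vertex is joined to exactly one other vertex. -/
def IsMatching {U : Type*} (s : Setoid U) : Prop := ∀ u, ∃! v, v ≠ u ∧ s u v

theorem dihedral_path {U : Type*} [Finite U] (α β : Equiv.Perm U) (hα : ∀ u, α (α u) = u)
    (hβ : ∀ u, β (β u) = u) (hne : ∀ u, β u = u → α u ≠ u) (x : U) (hx : β x = x) :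
    ∃! y, y ≠ x ∧ (α y = y ∨ β y = y) ∧ EqvGen (fun u v => v = α u ∨ v = β u) x y := by
  set g : Equiv.Perm U := β * α with hg
  have hαg : ∀ u, α u = β (g u) := fun u => by simp [hg, hβ]
  have hβg : ∀ (k : ℤ) u, β ((g ^ k) u) = (g ^ (-k)) (β u) := by
    have hconj : β * g * β⁻¹ = g⁻¹ := by
      ext u
      have h1 : β⁻¹ = β := by
        ext u; rw [Equiv.Perm.inv_eq_iff_eq, hβ]
      have h2 : α⁻¹ = α := by
        ext u; rw [Equiv.Perm.inv_eq_iff_eq, hα]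
      simp [hg, h1, h2, hβ]
    intro k u
    have : β * g ^ k = g ^ (-k) * β := by
      rw [zpow_neg, ← inv_zpow, ← hconj, conj_zpow]; group
    exact congrArg (fun e : Equiv.Perm U => e u) this
  have hb : ∀ k : ℤ, β ((g ^ k) x) = (g ^ (-k)) x := fun k => by rw [hβg, hx]
  have ha : ∀ k : ℤ, α ((g ^ k) x) = (g ^ (-k - 1)) x := fun k => by
    rw [hαg, ← Equiv.Perm.mul_apply g, ← zpow_one_add, hb]; congr 2; ring
  have horb : ∀ y, EqvGen (fun u v => v = α u ∨ v = β u) x y ↔ ∃ k : ℤ, (g ^ k) x = y := by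
    intro y
    constructor
    · intro h
      have := eqvGen_invariant (P := fun y => ∃ k : ℤ, (g ^ k) x = y) ?_ h
      · exact this.1 ⟨0, rfl⟩
      · have st : ∀ u, (∃ k : ℤ, (g ^ k) x = u) →
            (∃ k : ℤ, (g ^ k) x = α u) ∧ (∃ k : ℤ, (g ^ k) x = β u) := by
          rintro _ ⟨k, rfl⟩
          exact ⟨⟨_, (ha k).symm⟩, ⟨_, (hb k).symm⟩⟩
        rintro u v (rfl | rfl)
        · exact ⟨fun h => (st u h).1, fun h => by simpa [hα] using (st _ h).1⟩
        · exact ⟨fun h => (st u h).2, fun h => by simpa [hβ] using (st _ h).2⟩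
    · rintro ⟨k, rfl⟩
      have st : ∀ u, EqvGen (fun u v => v = α u ∨ v = β u) u (g u) := fun u =>
        EqvGen.trans _ _ _ (EqvGen.rel u (α u) (Or.inl rfl)) (EqvGen.rel _ _ (Or.inr rfl))
      induction k with
      | zero => exact EqvGen.refl _
      | succ k ih =>
        refine EqvGen.trans _ _ _ ih ?_
        rw [add_comm, zpow_one_add, Equiv.Perm.mul_apply]
        exact st _
      | pred k ih =>
        refine EqvGen.trans _ _ _ ih (EqvGen.symm _ _ ?_)
        have := st ((g ^ (-(k : ℤ) - 1)) x)
        rwa [← Equiv.Perm.mul_apply, ← zpow_one_add, add_sub_cancel] at this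
  obtain ⟨m, hm0, hm⟩ : ∃ m : ℕ, 0 < m ∧ ∀ k : ℤ, (g ^ k) x = x ↔ (m : ℤ) ∣ k := by
    refine ⟨Function.minimalPeriod g x, ?_, ?_⟩
    · exact Function.minimalPeriod_pos_of_mem_periodicPts
        ((Function.Injective.mem_periodicPts g.injective) x)
    · intro k
      exact MulAction.zpow_smul_eq_iff_minimalPeriod_dvd (a := g) (b := x)
  have heq : ∀ k k' : ℤ, (g ^ k) x = (g ^ k') x ↔ (m : ℤ) ∣ k - k' := by
    intro k k'
    rw [← hm, sub_eq_neg_add, zpow_add, Equiv.Perm.mul_apply, zpow_neg, Equiv.Perm.inv_eq_iff_eq,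
      eq_comm]
  have hm1 : m ≠ 1 := by
    rintro rfl
    have := (hm (-0 - 1)).2 (by simp)
    rw [← ha 0] at this
    exact hne x hx (by simpa using this)
  have hfix : ∀ k : ℤ, (α ((g ^ k) x) = (g ^ k) x ∨ β ((g ^ k) x) = (g ^ k) x) ↔
      ((m : ℤ) ∣ 2 * k + 1 ∨ (m : ℤ) ∣ 2 * k) := by
    intro k
    rw [ha, hb, heq, heq, ← dvd_neg, ← dvd_neg (b := -k - k)]
    ring_nf
  rcases Nat.even_or_odd' m with ⟨h, hh | hh⟩
  · refine ⟨(g ^ (h : ℤ)) x, ⟨?_, (hfix h).2 (Or.inr (by rw [hh]; push_cast; rfl)),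
      (horb _).2 ⟨_, rfl⟩⟩, ?_⟩
    · rw [Ne, hm]
      intro hd
      have := Nat.le_of_dvd (by omega) (Int.natCast_dvd_natCast.1 hd)
      omega
    · rintro y ⟨hy1, hy2, hy3⟩
      obtain ⟨k, rfl⟩ := (horb y).1 hy3
      rw [hfix] at hy2
      rw [Ne, hm] at hy1
      rw [heq]
      rw [hh] at hy1 hy2 ⊢
      push_cast at hy1 hy2 ⊢
      rcases hy2 with ⟨c, hc⟩ | ⟨c, hc⟩
      · have : 2 * k + 1 = 2 * (h * c) := by rw [hc]; ring
        omega
      · have hk : k = h * c := by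
          have : 2 * k = 2 * (h * c) := by rw [hc]; ring
          omega
        rcases Int.even_or_odd' c with ⟨d, rfl | rfl⟩
        · exact absurd ⟨d, by rw [hk]; ring⟩ hy1
        · exact ⟨d, by rw [hk]; ring⟩
  · refine ⟨(g ^ (h : ℤ)) x, ⟨?_, (hfix h).2 (Or.inl (by rw [hh]; push_cast; rfl)),
      (horb _).2 ⟨_, rfl⟩⟩, ?_⟩
    · rw [Ne, hm]
      intro hd
      have := Nat.le_of_dvd (by omega) (Int.natCast_dvd_natCast.1 hd)
      omega
    · rintro y ⟨hy1, hy2, hy3⟩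
      obtain ⟨k, rfl⟩ := (horb y).1 hy3
      rw [hfix] at hy2
      rw [Ne, hm] at hy1
      rw [heq]
      have hcop : IsCoprime (m : ℤ) 2 := ⟨1, -h, by rw [hh]; push_cast; ring⟩
      rcases hy2 with hc | hc
      · refine hcop.dvd_of_dvd_mul_left (y := 2) ?_
        have : (m : ℤ) ∣ (2 * k + 1) - m := dvd_sub hc dvd_rfl
        have e : (2 : ℤ) * (k - h) = 2 * k + 1 - m := by rw [hh]; push_cast; ring
        rw [e]
        exact this
      · exact absurd (hcop.dvd_of_dvd_mul_left hc) hy1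

theorem IsMatching.exists_partner {U : Type*} {s : Setoid U} (h : IsMatching s) :
    ∃ f : U → U, (∀ u, f u ≠ u) ∧ (∀ u, f (f u) = u) ∧ ∀ u v, s u v ↔ v = u ∨ v = f u := by
  choose f hf hu using h
  have hs : ∀ u v, s u v ↔ v = u ∨ v = f u := by
    intro u v
    constructor
    · intro h
      by_cases hv : v = u
      · exact Or.inl hv
      · exact Or.inr (hu u v ⟨hv, h⟩)
    · rintro (rfl | rfl)
      · exact s.refl' _
      · exact (hf u).2
  exact ⟨f, fun u => (hf u).1, fun u => (hu (f u) u ⟨(hf u).1.symm, s.symm' (hf u).2⟩).symm, hs⟩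

theorem IsMatching.compRel [Finite V] {a b : Setoid (V ⊕ V)} (ha : IsMatching a)
    (hb : IsMatching b) : IsMatching (compRel a b) := by
  obtain ⟨f, f1, f2, f3⟩ := ha.exists_partner
  obtain ⟨k, k1, k2, k3⟩ := hb.exists_partner
  let α' : V ⊕ (V ⊕ V) → V ⊕ (V ⊕ V) := Sum.elim (fun x => Sum.map id Sum.inl (f (.inl x)))
    (Sum.elim (fun y => Sum.map id Sum.inl (f (.inr y))) (fun z => .inr (.inr z)))
  let β' : V ⊕ (V ⊕ V) → V ⊕ (V ⊕ V) := Sum.elim Sum.inl (fun y => Sum.inr (k y))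
  have hα'u : ∀ p : V ⊕ V, α' (Sum.map id Sum.inl p) = Sum.map id Sum.inl (f p) := by
    rintro (p | p) <;> rfl
  have hα' : Function.Involutive α' := by
    rintro (x | x | x)
    · exact (hα'u _).trans (by rw [f2]; rfl)
    · exact (hα'u _).trans (by rw [f2]; rfl)
    · rfl
  have hβ' : Function.Involutive β' := by
    rintro (x | x)
    · rfl
    · exact congrArg Sum.inr (k2 x)
  have hinj : Function.Injective (Sum.map id Sum.inl : V ⊕ V → V ⊕ (V ⊕ V)) :=
    Function.injective_id.sumMap Sum.inl_injective
  have fα : ∀ u, α' u = u ↔ ∃ z, u = .inr (.inr z) := by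
    rintro (x | x | x)
    · refine iff_of_false (fun h => f1 (.inl x) (hinj h)) (by simp)
    · refine iff_of_false (fun h => f1 (.inr x) (hinj h)) (by simp)
    · simp [α']
  have fβ : ∀ u, β' u = u ↔ ∃ z, u = .inl z := by
    rintro (x | x)
    · simp [β']
    · simp [β', k1]
  have hst : ∀ u v, stack a b u v ↔ EqvGen (fun u v => v = α' u ∨ v = β' u) u v := by
    intro u v
    constructor
    · intro h
      induction h with
      | rel x y h =>
        rcases h with ⟨p, q, h, rfl, rfl⟩ | ⟨p, q, h, rfl, rfl⟩
        · rcases (f3 _ _).1 h with rfl | rfl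
          · exact EqvGen.refl _
          · exact EqvGen.rel _ _ (Or.inl (hα'u p).symm)
        · rcases (k3 _ _).1 h with rfl | rfl
          · exact EqvGen.refl _
          · exact EqvGen.rel _ _ (Or.inr rfl)
      | refl x => exact EqvGen.refl _
      | symm x y _ ih => exact EqvGen.symm _ _ ih
      | trans x y z _ _ h1 h2 => exact EqvGen.trans _ _ _ h1 h2
    · intro h
      induction h with
      | rel x y h =>
        rcases h with rfl | rfl
        · rcases x with x | x | x
          · exact EqvGen.rel _ _ (Or.inl ⟨.inl x, _, (f3 _ _).2 (Or.inr rfl), rfl, rfl⟩)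
          · exact EqvGen.rel _ _ (Or.inl ⟨.inr x, _, (f3 _ _).2 (Or.inr rfl), rfl, rfl⟩)
          · exact EqvGen.refl _
        · rcases x with x | x
          · exact EqvGen.refl _
          · exact EqvGen.rel _ _ (Or.inr ⟨x, _, (k3 _ _).2 (Or.inr rfl), rfl, rfl⟩)
      | refl x => exact EqvGen.refl _
      | symm x y _ ih => exact EqvGen.symm _ _ ih
      | trans x y z _ _ h1 h2 => exact EqvGen.trans _ _ _ h1 h2
  have hout : ∀ u : V ⊕ (V ⊕ V), (α' u = u ∨ β' u = u) ↔ u ∈ Set.range outer := by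
    intro u
    rw [fα, fβ]
    rcases u with x | x | x <;> simp [outer]
  have oinj : Function.Injective (outer : V ⊕ V → _) :=
    Function.injective_id.sumMap Sum.inr_injective
  intro u
  have main : ∃! y, y ≠ outer u ∧ (α' y = y ∨ β' y = y) ∧
      EqvGen (fun u v => v = α' u ∨ v = β' u) (outer u) y := by
    rcases u with u | u
    · refine dihedral_path hα'.toPerm hβ'.toPerm hα' hβ' ?_ _ ((fβ _).2 ⟨u, rfl⟩)
      intro v h1 h2
      obtain ⟨z, rfl⟩ := (fβ _).1 h1
      obtain ⟨z, hz⟩ := (fα (.inl _)).1 h2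
      cases hz
    · have := dihedral_path hβ'.toPerm hα'.toPerm hβ' hα' ?_ (.inr (.inr u)) ((fα _).2 ⟨u, rfl⟩)
      · simpa only [or_comm, Function.Involutive.coe_toPerm, outer, Sum.map_inr] using this
      · intro v h1 h2
        obtain ⟨z, rfl⟩ := (fα _).1 h1
        obtain ⟨z, hz⟩ := (fβ (.inr (.inr _))).1 h2
        cases hz
  obtain ⟨y, ⟨hy1, hy2, hy3⟩, hy4⟩ := main
  obtain ⟨v, rfl⟩ := (hout _).1 hy2
  refine ⟨v, ⟨fun h => hy1 (by rw [h]), (hst _ _).2 hy3⟩, ?_⟩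
  rintro w ⟨hw1, hw2⟩
  exact oinj (hy4 _ ⟨fun h => hw1 (oinj h), (hout _).2 ⟨w, rfl⟩, (hst _ _).1 hw2⟩)

/-- Relabelling all vertices by a map preserving `a` and `b` preserves their composite. -/
theorem compRel_map {a b : Setoid (V ⊕ V)} (n : V → V)
    (ha : ∀ u v, a u v → a (Sum.map n n u) (Sum.map n n v))
    (hb : ∀ u v, b u v → b (Sum.map n n u) (Sum.map n n v)) {u v : V ⊕ V}
    (h : compRel a b u v) : compRel a b (Sum.map n n u) (Sum.map n n v) := by
  have key : ∀ x y, stack a b x y →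
      stack a b (Sum.map n (Sum.map n n) x) (Sum.map n (Sum.map n n) y) := by
    intro x y h
    induction h with
    | rel x y h =>
      rcases h with ⟨p, q, h, rfl, rfl⟩ | ⟨p, q, h, rfl, rfl⟩
      · refine EqvGen.rel _ _ (Or.inl ⟨_, _, ha _ _ h, ?_, ?_⟩)
        · rcases p with p | p <;> rfl
        · rcases q with p | p <;> rfl
      · exact EqvGen.rel _ _ (Or.inr ⟨_, _, hb _ _ h, rfl, rfl⟩)
    | refl x => exact EqvGen.refl _
    | symm x y _ ih => exact EqvGen.symm _ _ ih
    | trans x y z _ _ h1 h2 => exact EqvGen.trans _ _ _ h1 h2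
  have := key _ _ h
  change stack a b _ _
  convert this using 1
  · rcases u with u | u <;> rfl
  · rcases v with u | u <;> rfl

end Stacking

/-! ### Hyperoctahedral groups and Brauer diagrams of type C -/

/-- The set `{-n, …, -1, 1, …, n}`: the pair `(i, true)` is the element `i + 1` and `(i, false)`
is the element `-(i + 1)`, for `i = 0, …, n - 1`. -/
abbrev Vertex (n : ℕ) : Type := Fin n × Bool

/-- The reflection `v ↦ -v`. -/
def refl {n : ℕ} (v : Vertex n) : Vertex n := (v.1, !v.2)

@[simp] theorem refl_refl {n : ℕ} (v : Vertex n) : refl (refl v) = v := by simp [refl]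

theorem refl_injective {n : ℕ} : Function.Injective (refl (n := n)) :=
  Function.Involutive.injective refl_refl

/-- The hyperoctahedral group: the permutations `σ` of `{±1, …, ±n}` with `σ (-v) = -(σ v)`. -/
def Hyp (n : ℕ) : Subgroup (Equiv.Perm (Vertex n)) where
  carrier := {σ | ∀ v, σ (refl v) = refl (σ v)}
  mul_mem' := fun {σ τ} hσ hτ v => by simp [hτ v, hσ (τ v)]
  one_mem' := fun _ => rfl
  inv_mem' := fun {σ} hσ v => by
    rw [Equiv.Perm.inv_eq_iff_eq, hσ]; simp

theorem hyp_apply_refl {n : ℕ} (σ : Hyp n) (v : Vertex n) : σ.1 (refl v) = refl (σ.1 v) := σ.2 v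

/-- A Brauer diagram of type C: a partition of the `2r` top vertices (`Sum.inl`) and `2r` bottom
vertices (`Sum.inr`) into pairs (the edges), invariant under the reflection. -/
@[ext]
structure Diagram (r : ℕ) where
  rel : Setoid (Vertex r ⊕ Vertex r)
  matching : IsMatching rel
  symm : ∀ u v, rel u v → rel (Sum.map refl refl u) (Sum.map refl refl v)

namespace Diagram

variable {r : ℕ}

/-- Concatenation of diagrams (`a` above `b`), closed loops being discarded. -/
def comp (a b : Diagram r) : Diagram r where
  rel := compRel a.rel b.rel
  matching := a.matching.compRel b.matching
  symm := fun _ _ h => compRel_map refl a.symm b.symm h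

theorem permRel_matching {V : Type*} (σ : Equiv.Perm V) : IsMatching (permRel σ) := by
  rintro (u | u)
  · refine ⟨.inr (σ.symm u), ⟨by simp, by simp [permRel_iff]⟩, ?_⟩
    rintro (v | v) ⟨h1, h2⟩ <;> simp [permRel_iff] at h1 h2
    · exact absurd h2.symm h1
    · simp [h2]
  · refine ⟨.inl (σ u), ⟨by simp, by simp [permRel_iff]⟩, ?_⟩
    rintro (v | v) ⟨h1, h2⟩ <;> simp [permRel_iff] at h1 h2
    · simp [h2]
    · exact absurd h2.symm h1

/-- The diagram of an element of the hyperoctahedral group, without horizontal edges: the bottom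
vertex `v` is joined to the top vertex `σ v`. -/
def ofPerm (σ : Hyp r) : Diagram r where
  rel := permRel σ.1
  matching := permRel_matching σ.1
  symm := by
    rintro (u | u) (v | v) h <;> rw [permRel_iff] at h ⊢ <;> simp_all [hyp_apply_refl]

theorem comp_assoc (a b c : Diagram r) : (a.comp b).comp c = a.comp (b.comp c) :=
  Diagram.ext (compRel_assoc a.rel b.rel c.rel)

theorem one_comp (a : Diagram r) : (ofPerm 1).comp a = a := by
  refine Diagram.ext ((compRel_permRel_left 1 a.rel).trans ?_)
  ext u v
  rcases u with u | u <;> rcases v with v | v <;> rfl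

theorem comp_one (a : Diagram r) : a.comp (ofPerm 1) = a := by
  refine Diagram.ext ((compRel_permRel_right 1 a.rel).trans ?_)
  ext u v
  rcases u with u | u <;> rcases v with v | v <;> rfl

theorem ofPerm_mul (σ τ : Hyp r) : ofPerm (σ * τ) = (ofPerm σ).comp (ofPerm τ) := by
  refine Diagram.ext (Eq.trans ?_ (compRel_permRel_right τ.1 (permRel σ.1)).symm)
  ext u v
  rcases u with u | u <;> rcases v with v | v <;> rfl

/-- The number of horizontal edges in the top row (equal to that in the bottom row): half the
number of top vertices that are joined to another top vertex. -/
noncomputable def horizontal (d : Diagram r) : ℕ :=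
  {x : Vertex r | ∃ y, y ≠ x ∧ d.rel (.inl x) (.inl y)}.ncard / 2

/-- Auxiliary labelling of the vertices of `capCup l`: two vertices get the same label exactly when
they are joined. -/
def capLabel (l : ℕ) : Vertex r ⊕ Vertex r → (Bool × Fin r) ⊕ Vertex r :=
  Sum.elim (fun v => if v.1.1 < l then .inl (true, v.1) else .inr v)
    (fun v => if v.1.1 < l then .inl (false, v.1) else .inr v)

/-- The diagram with horizontal edges `{-i, i}` in both rows for `1 ≤ i ≤ l`, all other edges being
vertical and joining `v` with `v`. -/
def capCup (r l : ℕ) : Diagram r where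
  rel := Setoid.ker (capLabel l)
  matching := by
    have key : ∀ u v : Vertex r ⊕ Vertex r, Setoid.ker (capLabel l) u v ↔
      capLabel l u = capLabel l v := fun _ _ => Iff.rfl
    simp only [IsMatching, key]
    rintro (⟨i, s⟩ | ⟨i, s⟩) <;> by_cases h : i.1 < l
    · refine ⟨.inl (i, !s), by simp [capLabel, h], ?_⟩
      rintro (⟨k, t⟩ | ⟨k, t⟩) <;> by_cases h' : k.1 < l <;> cases s <;> cases t <;>
        simp [capLabel, h, h'] <;> grind
    · refine ⟨.inr (i, s), by simp [capLabel, h], ?_⟩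
      rintro (⟨k, t⟩ | ⟨k, t⟩) <;> by_cases h' : k.1 < l <;> cases s <;> cases t <;>
        simp [capLabel, h, h'] <;> grind
    · refine ⟨.inr (i, !s), by simp [capLabel, h], ?_⟩
      rintro (⟨k, t⟩ | ⟨k, t⟩) <;> by_cases h' : k.1 < l <;> cases s <;> cases t <;>
        simp [capLabel, h, h'] <;> grind
    · refine ⟨.inl (i, s), by simp [capLabel, h], ?_⟩
      rintro (⟨k, t⟩ | ⟨k, t⟩) <;> by_cases h' : k.1 < l <;> cases s <;> cases t <;>
        simp [capLabel, h, h'] <;> grind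
  symm := by
    have key : ∀ u v : Vertex r ⊕ Vertex r, Setoid.ker (capLabel l) u v ↔
      capLabel l u = capLabel l v := fun _ _ => Iff.rfl
    simp only [key]
    rintro (⟨i, s⟩ | ⟨i, s⟩) (⟨k, t⟩ | ⟨k, t⟩) <;> by_cases h : i.1 < l <;>
      by_cases h' : k.1 < l <;> simp [capLabel, h, h', refl]

end Diagram

/-! ### The Brauer algebra of type C -/

section Algebra

variable (r : ℕ) (K : Type*) [Field K] (δ : K)

/-- The Brauer algebra of type C with parameter `δ`: the vector space with basis the Brauer diagrams
of type C. -/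
def BrauerC (_δ : K) : Type _ := Diagram r →₀ K

namespace BrauerC

noncomputable instance : AddCommGroup (BrauerC r K δ) :=
  inferInstanceAs (AddCommGroup (Diagram r →₀ K))

noncomputable instance : Module K (BrauerC r K δ) :=
  inferInstanceAs (Module K (Diagram r →₀ K))

variable {r K}

/-- The basis of diagrams. -/
noncomputable def basis : Module.Basis (Diagram r) K (BrauerC r K δ) :=
  .ofRepr (LinearEquiv.refl K (Diagram r →₀ K))

/-- The basis element given by a diagram. -/
noncomputable def diag (d : Diagram r) : BrauerC r K δ := basis δ d

/-- The bilinear multiplication: concatenate, and multiply by `δ` for every closed loop. -/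
noncomputable def mulHom : BrauerC r K δ →ₗ[K] BrauerC r K δ →ₗ[K] BrauerC r K δ :=
  (basis δ).constr K fun a => (basis δ).constr K fun b =>
    δ ^ loops a.rel b.rel • diag δ (a.comp b)

theorem mulHom_diag (a b : Diagram r) :
    mulHom δ (diag δ a) (diag δ b) = δ ^ loops a.rel b.rel • diag δ (a.comp b) := by
  simp [mulHom, diag, Module.Basis.constr_basis]

theorem mulHom_assoc (x y z : BrauerC r K δ) :
    mulHom δ (mulHom δ x y) z = mulHom δ x (mulHom δ y z) := by
  have h : (mulHom δ).compr₂ (mulHom δ) =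
      (LinearMap.mul K (Module.End K (BrauerC r K δ))).compl₁₂ (mulHom δ) (mulHom δ) := by
    refine (basis δ).ext fun a => (basis δ).ext fun b => (basis δ).ext fun c => ?_
    change mulHom δ (mulHom δ (diag δ a) (diag δ b)) (diag δ c) =
      mulHom δ (diag δ a) (mulHom δ (diag δ b) (diag δ c))
    rw [mulHom_diag, mulHom_diag, map_smul, map_smul, LinearMap.smul_apply, mulHom_diag,
      mulHom_diag, smul_smul, smul_smul, ← pow_add, ← pow_add, Diagram.comp_assoc]
    congr 2
    exact loops_assoc a.rel b.rel c.rel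
  exact LinearMap.congr_fun (LinearMap.congr_fun₂ h x y) z

theorem one_mulHom (x : BrauerC r K δ) : mulHom δ (diag δ (.ofPerm 1)) x = x := by
  have h : mulHom δ (diag δ (.ofPerm (1 : Hyp r))) = LinearMap.id := by
    refine (basis δ).ext fun a => ?_
    change mulHom δ (diag δ (.ofPerm 1)) (diag δ a) = diag δ a
    rw [mulHom_diag, Diagram.one_comp]
    erw [loops_permRel_left, pow_zero, one_smul]
  exact LinearMap.congr_fun h x

theorem mulHom_one (x : BrauerC r K δ) : mulHom δ x (diag δ (.ofPerm 1)) = x := by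
  have h : (mulHom δ).flip (diag δ (.ofPerm (1 : Hyp r))) = LinearMap.id := by
    refine (basis δ).ext fun a => ?_
    change mulHom δ (diag δ a) (diag δ (.ofPerm 1)) = diag δ a
    rw [mulHom_diag, Diagram.comp_one]
    erw [loops_permRel_right, pow_zero, one_smul]
  exact LinearMap.congr_fun h x

noncomputable instance : Ring (BrauerC r K δ) :=
  { (inferInstance : AddCommGroup (BrauerC r K δ)) with
    mul := fun x y => mulHom δ x y
    one := diag δ (.ofPerm 1)
    mul_assoc := mulHom_assoc δ
    one_mul := one_mulHom δ
    mul_one := mulHom_one δ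
    left_distrib := fun x y z => map_add (mulHom δ x) y z
    right_distrib := fun x y z => LinearMap.map_add₂ (mulHom δ) x y z
    zero_mul := fun x => LinearMap.map_zero₂ (mulHom δ) x
    mul_zero := fun x => map_zero (mulHom δ x) }

noncomputable instance : Algebra K (BrauerC r K δ) :=
  Algebra.ofModule (fun c x y => LinearMap.map_smul₂ (mulHom δ) c x y)
    (fun c x y => map_smul (mulHom δ x) c y)

theorem one_def : (1 : BrauerC r K δ) = diag δ (.ofPerm 1) := rfl

theorem diag_mul_diag (a b : Diagram r) :
    diag δ a * diag δ b = δ ^ loops a.rel b.rel • diag δ (a.comp b) := mulHom_diag δ a b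

/-- The group algebra of the hyperoctahedral group inside the Brauer algebra. -/
noncomputable def ofGroup : Hyp r →* BrauerC r K δ where
  toFun σ := diag δ (.ofPerm σ)
  map_one' := rfl
  map_mul' σ τ := by
    rw [diag_mul_diag, Diagram.ofPerm_mul]
    erw [loops_permRel_left, pow_zero, one_smul]

/-- The idempotent `e_l = δ^{-l} · capCup l` (for `δ ≠ 0`). -/
noncomputable def e (r l : ℕ) : BrauerC r K δ := (δ ^ l)⁻¹ • diag δ (.capCup r l)

end BrauerC

/-- The inclusion `{±1, …, ±(r-l)} → {±1, …, ±r}`, `±i ↦ ±(l+i)`. -/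
def outerVertex (l : ℕ) : Vertex (r - l) ↪ Vertex r where
  toFun v := (⟨l + v.1.1, by omega⟩, v.2)
  inj' := by
    rintro ⟨⟨i, hi⟩, s⟩ ⟨⟨k, hk⟩, t⟩ h
    simp only [Prod.mk.injEq, Fin.mk.injEq] at h ⊢
    exact ⟨by omega, h.2⟩

theorem mem_range_outerVertex (l : ℕ) (v : Vertex r) :
    v ∈ Set.range (outerVertex r l) ↔ l ≤ v.1.1 := by
  constructor
  · rintro ⟨w, rfl⟩; exact Nat.le_add_right _ _
  · intro h
    refine ⟨(⟨v.1.1 - l, by omega⟩, v.2), Prod.ext (Fin.ext ?_) rfl⟩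
    change l + (v.1.1 - l) = v.1.1
    omega

theorem outerVertex_refl (l : ℕ) (v : Vertex (r - l)) :
    outerVertex r l (refl v) = refl (outerVertex r l v) := rfl

/-- The embedding of the hyperoctahedral group of rank `r - l` in that of rank `r`, permuting
`±(l+1), …, ±r` and fixing `±1, …, ±l`. -/
noncomputable def hypEmbedding (l : ℕ) : Hyp (r - l) →* Hyp r :=
  ((Equiv.Perm.viaEmbeddingHom (outerVertex r l)).comp (Hyp (r - l)).subtype).codRestrict (Hyp r) <| by
    intro σ v
    change σ.1.viaEmbedding (outerVertex r l) (refl v) =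
      refl (σ.1.viaEmbedding (outerVertex r l) v)
    by_cases hv : v ∈ Set.range (outerVertex r l)
    · obtain ⟨w, rfl⟩ := hv
      rw [← outerVertex_refl, Equiv.Perm.viaEmbedding_apply, Equiv.Perm.viaEmbedding_apply,
        hyp_apply_refl, outerVertex_refl]
    · have hv' : refl v ∉ Set.range (outerVertex r l) := by
        rw [mem_range_outerVertex] at hv ⊢; exact hv
      rw [Equiv.Perm.viaEmbedding_apply_of_notMem _ _ _ hv,
        Equiv.Perm.viaEmbedding_apply_of_notMem _ _ _ hv']

/-- The group algebra of the hyperoctahedral group of rank `n`. -/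
abbrev HypAlg (n : ℕ) : Type _ := MonoidAlgebra K (Hyp n)

/-- The algebra map from the group algebra of rank `r - l` to the Brauer algebra. -/
noncomputable def hat (l : ℕ) : HypAlg K (r - l) →ₐ[K] BrauerC r K δ :=
  MonoidAlgebra.lift K _ _ ((BrauerC.ofGroup δ).comp (hypEmbedding r l))

theorem capLabel_hyp (l : ℕ) (σ : Hyp (r - l)) (u v : Vertex r ⊕ Vertex r) :
    Diagram.capLabel l (Sum.map (hypEmbedding r l σ).1 (hypEmbedding r l σ).1 u) =
      Diagram.capLabel l (Sum.map (hypEmbedding r l σ).1 (hypEmbedding r l σ).1 v) ↔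
      Diagram.capLabel l u = Diagram.capLabel l v := by
  set τ := (hypEmbedding r l σ).1 with hτ
  have h1 : ∀ v : Vertex r, v.1.1 < l → τ v = v := fun v hv =>
    Equiv.Perm.viaEmbedding_apply_of_notMem _ _ _ (by rw [mem_range_outerVertex]; omega)
  have h2 : ∀ v : Vertex r, ¬ v.1.1 < l → ¬ (τ v).1.1 < l := by
    intro v hv
    obtain ⟨w, rfl⟩ := (mem_range_outerVertex r l v).2 (by omega)
    have : τ (outerVertex r l w) = outerVertex r l (σ.1 w) := Equiv.Perm.viaEmbedding_apply _ _ _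
    rw [this]
    have := (mem_range_outerVertex r l (outerVertex r l (σ.1 w))).1 ⟨_, rfl⟩
    omega
  rcases u with u | u <;> rcases v with v | v <;> by_cases hu : u.1.1 < l <;>
    by_cases hv : v.1.1 < l <;>
    simp only [Diagram.capLabel, Sum.map_inl, Sum.map_inr, Sum.elim_inl, Sum.elim_inr, hu, hv, h1,
      h2, if_true, if_false, reduceCtorEq, Sum.inr.injEq, EmbeddingLike.apply_eq_iff_eq,
      not_false_eq_true]

theorem ofGroup_mul_e (l : ℕ) (σ : Hyp (r - l)) :
    BrauerC.ofGroup δ (hypEmbedding r l σ) * BrauerC.e δ r l =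
      BrauerC.e δ r l * BrauerC.ofGroup δ (hypEmbedding r l σ) := by
  unfold BrauerC.e
  rw [mul_smul_comm, smul_mul_assoc]
  congr 1
  change BrauerC.diag δ (.ofPerm _) * _ = _ * BrauerC.diag δ (.ofPerm _)
  rw [BrauerC.diag_mul_diag, BrauerC.diag_mul_diag]
  have hl := loops_permRel_left (hypEmbedding r l σ).1 (Diagram.capCup r l).rel
  have hr := loops_permRel_right (hypEmbedding r l σ).1 (Diagram.capCup r l).rel
  erw [hl, hr]
  congr 2
  refine Diagram.ext ((compRel_permRel_left _ _).trans
    (Eq.trans ?_ (compRel_permRel_right _ _).symm))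
  ext u v
  change Diagram.capLabel l _ = Diagram.capLabel l _ ↔ Diagram.capLabel l _ = Diagram.capLabel l _
  rw [← capLabel_hyp r l σ]
  rcases u with u | u <;> rcases v with v | v <;> simp

theorem hat_mul_e (l : ℕ) (a : HypAlg K (r - l)) :
    hat r K δ l a * BrauerC.e δ r l = BrauerC.e δ r l * hat r K δ l a := by
  induction a using MonoidAlgebra.induction_on with
  | of σ => simpa [hat] using ofGroup_mul_e r K δ l σ
  | add a b ha hb => rw [map_add, add_mul, mul_add, ha, hb]
  | smul c a ha => rw [map_smul, smul_mul_assoc, mul_smul_comm, ha]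

end Algebra

/-! ### Tableaux, permutation modules, Specht modules and Young modules of hyperoctahedral groups -/

/-- A bipartition of `n`: a pair of partitions (given by their Young diagrams) of total size `n`. -/
structure BiPartition (n : ℕ) where
  fst : YoungDiagram
  snd : YoungDiagram
  card_add_card : fst.card + snd.card = n

section Tableaux

variable {n : ℕ}

/-- The boxes of a bipartition; those of the first component are `Sum.inl`, those of the second
component are `Sum.inr`. -/
abbrev BiPartition.Box (lam : BiPartition n) : Type := lam.fst.cells ⊕ lam.snd.cells

/-- The position (row, column) of a box inside its component. -/
def BiPartition.pos {lam : BiPartition n} : lam.Box → ℕ × ℕ := Sum.elim (fun b => b.1) (fun b => b.1)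

/-- A bitableau: a filling of the `n` boxes by elements of `{±1, …, ±n}` with distinct
absolute values. -/
@[ext]
structure BiTableau (lam : BiPartition n) where
  entry : lam.Box → Vertex n
  abs_injective : Function.Injective fun b => (entry b).1

theorem hypAbs_eq_iff (σ : Hyp n) (v w : Vertex n) : (σ.1 v).1 = (σ.1 w).1 ↔ v.1 = w.1 := by
  have key : ∀ v w : Vertex n, v.1 = w.1 ↔ v = w ∨ v = refl w := by
    rintro ⟨i, s⟩ ⟨k, t⟩
    cases s <;> cases t <;> simp [refl]
  rw [key, key, ← hyp_apply_refl, EmbeddingLike.apply_eq_iff_eq, EmbeddingLike.apply_eq_iff_eq]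

/-- The underlying permutation of absolute values. -/
noncomputable def hypAbs (σ : Hyp n) : Equiv.Perm (Fin n) :=
  Equiv.ofBijective (fun i => (σ.1 (i, true)).1)
    (Finite.injective_iff_bijective.1 fun _ _ h => (hypAbs_eq_iff σ _ _).1 h)

/-- The sign `(-1)^x · sgn |σ|`, where `x` is the number of sign changes. -/
noncomputable def hypSgn (σ : Hyp n) : ℤˣ :=
  (∏ i : Fin n, if (σ.1 (i, true)).2 then 1 else -1) * Equiv.Perm.sign (hypAbs σ)

variable {lam : BiPartition n}

namespace BiTableau

/-- The right action of the hyperoctahedral group, through `v · σ = σ⁻¹ v` on entries. -/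
def act (t : BiTableau lam) (σ : Hyp n) : BiTableau lam where
  entry b := (σ⁻¹).1 (t.entry b)
  abs_injective := fun _ _ h => t.abs_injective ((hypAbs_eq_iff σ⁻¹ _ _).1 h)

theorem act_one (t : BiTableau lam) : t.act 1 = t := rfl

theorem act_mul (t : BiTableau lam) (σ τ : Hyp n) : t.act (σ * τ) = (t.act σ).act τ := by
  ext1; funext b; simp [act]

/-- Row permutations: they permute the entries in each row, and may change the signs of the
entries of the second component. -/
def IsRowPerm (t : BiTableau lam) (σ : Hyp n) : Prop :=
  ∀ b : lam.Box, ∃ b' : lam.Box, b'.isLeft = b.isLeft ∧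
    (BiPartition.pos b').1 = (BiPartition.pos b).1 ∧
    (σ.1 (t.entry b) = t.entry b' ∨ b.isRight ∧ σ.1 (t.entry b) = refl (t.entry b'))

/-- Column permutations: they permute the entries in each column, and may change the signs of the
entries of the first component. -/
def IsColPerm (t : BiTableau lam) (σ : Hyp n) : Prop :=
  ∀ b : lam.Box, ∃ b' : lam.Box, b'.isLeft = b.isLeft ∧
    (BiPartition.pos b').2 = (BiPartition.pos b).2 ∧
    (σ.1 (t.entry b) = t.entry b' ∨ b.isLeft ∧ σ.1 (t.entry b) = refl (t.entry b'))

/-- The group of row permutations. -/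
def rowGroup (t : BiTableau lam) : Subgroup (Hyp n) :=
  let S : Submonoid (Hyp n) :=
    { carrier := {σ | t.IsRowPerm σ}
      one_mem' := fun b => ⟨b, rfl, rfl, Or.inl rfl⟩
      mul_mem' := by
        intro σ τ hσ hτ b
        obtain ⟨b', h1, h2, h3⟩ := hτ b
        obtain ⟨b'', k1, k2, k3⟩ := hσ b'
        have hR : b'.isRight = b.isRight := by
          rw [← Sum.bnot_isLeft, ← Sum.bnot_isLeft, h1]
        refine ⟨b'', k1.trans h1, k2.trans h2, ?_⟩
        change σ.1 (τ.1 _) = _ ∨ _ ∧ σ.1 (τ.1 _) = _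
        rcases h3 with h3 | ⟨h3', h3⟩ <;> rcases k3 with k3 | ⟨k3', k3⟩ <;> rw [h3]
        · exact Or.inl k3
        · exact Or.inr ⟨hR ▸ k3', k3⟩
        · exact Or.inr ⟨h3', by rw [hyp_apply_refl, k3]⟩
        · exact Or.inl (by rw [hyp_apply_refl, k3, refl_refl]) }
  { S with
    inv_mem' := by
      intro σ hσ
      have : σ⁻¹ = σ ^ (orderOf σ - 1) := by
        rw [inv_eq_iff_mul_eq_one, ← pow_succ', Nat.sub_add_cancel (orderOf_pos σ),
          pow_orderOf_eq_one]
      rw [this]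
      exact S.pow_mem hσ _ }

theorem mem_rowGroup {t : BiTableau lam} {σ : Hyp n} : σ ∈ t.rowGroup ↔ t.IsRowPerm σ := Iff.rfl

theorem isRowPerm_act {t : BiTableau lam} {ρ : Hyp n} (σ : Hyp n) (h : t.IsRowPerm ρ) :
    (t.act σ).IsRowPerm (σ⁻¹ * ρ * σ) := by
  intro b
  obtain ⟨b', h1, h2, h3⟩ := h b
  refine ⟨b', h1, h2, ?_⟩
  have e : (σ⁻¹ * ρ * σ).1 ((t.act σ).entry b) = (σ⁻¹).1 (ρ.1 (t.entry b)) := by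
    simp [act]
  rw [e]
  rcases h3 with h3 | ⟨h3', h3⟩ <;> rw [h3]
  · exact Or.inl rfl
  · exact Or.inr ⟨h3', hyp_apply_refl _ _⟩

/-- Row equivalence of bitableaux. -/
def rowSetoid (lam : BiPartition n) : Setoid (BiTableau lam) where
  r t₁ t₂ := ∃ σ ∈ t₁.rowGroup, t₂ = t₁.act σ
  iseqv :=
    { refl := fun t => ⟨1, t.rowGroup.one_mem, rfl⟩
      symm := by
        rintro t _ ⟨σ, hσ, rfl⟩
        refine ⟨σ⁻¹, ?_, ?_⟩
        · have := isRowPerm_act σ hσ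
          rw [inv_mul_cancel, one_mul] at this
          exact (t.act σ).rowGroup.inv_mem this
        · rw [← act_mul, mul_inv_cancel, act_one]
      trans := by
        rintro t _ _ ⟨σ, hσ, rfl⟩ ⟨τ, hτ, rfl⟩
        refine ⟨σ * τ, t.rowGroup.mul_mem hσ ?_, (act_mul t σ τ).symm⟩
        have h2 := isRowPerm_act σ⁻¹ hτ
        rw [← act_mul, mul_inv_cancel, act_one] at h2
        have h3 := t.rowGroup.mul_mem (t.rowGroup.mul_mem (t.rowGroup.inv_mem hσ) h2) hσ
        simpa [mul_assoc] using h3 }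

end BiTableau

/-- Bitabloids: row equivalence classes of bitableaux. -/
def BiTabloid (lam : BiPartition n) : Type := Quotient (BiTableau.rowSetoid lam)

/-- The bitabloid of a bitableau. -/
def BiTableau.tabloid (t : BiTableau lam) : BiTabloid lam := Quotient.mk _ t

/-- The right action on bitabloids. -/
def BiTabloid.act (T : BiTabloid lam) (σ : Hyp n) : BiTabloid lam :=
  Quotient.map (fun t => t.act σ) (by
    rintro t _ ⟨ρ, hρ, rfl⟩
    refine ⟨σ⁻¹ * ρ * σ, BiTableau.isRowPerm_act σ hρ, ?_⟩
    rw [← BiTableau.act_mul, ← BiTableau.act_mul, mul_assoc, mul_inv_cancel_left]) T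

theorem BiTabloid.act_one (T : BiTabloid lam) : T.act 1 = T := by
  induction T using Quotient.inductionOn with | _ t
  rfl

theorem BiTabloid.act_mul (T : BiTabloid lam) (σ τ : Hyp n) :
    T.act (σ * τ) = (T.act σ).act τ := by
  induction T using Quotient.inductionOn with | _ t
  exact congrArg (Quotient.mk _) (BiTableau.act_mul t σ τ)

variable (K : Type*) [Field K]

/-- The permutation module of the hyperoctahedral group algebra: the vector space with basis
the bitabloids. -/
def PermModule (lam : BiPartition n) : Type _ := BiTabloid lam →₀ K

namespace PermModule

noncomputable instance (lam : BiPartition n) : AddCommGroup (PermModule K lam) :=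
  inferInstanceAs (AddCommGroup (BiTabloid lam →₀ K))

noncomputable instance (lam : BiPartition n) : Module K (PermModule K lam) :=
  inferInstanceAs (Module K (BiTabloid lam →₀ K))

/-- The basis vector of a bitabloid. -/
noncomputable def ofTabloid (T : BiTabloid lam) : PermModule K lam := Finsupp.single T (1 : K)

/-- The action of a group element: the linear extension of the right action on bitabloids. -/
noncomputable def actHom (lam : BiPartition n) : Hyp n →* (Module.End K (PermModule K lam))ᵐᵒᵖ where
  toFun σ := MulOpposite.op (Finsupp.lmapDomain K K fun T : BiTabloid lam => T.act σ)
  map_one' := by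
    have : (fun T : BiTabloid lam => T.act 1) = id := funext BiTabloid.act_one
    rw [this, Finsupp.lmapDomain_id]
    rfl
  map_mul' σ τ := by
    have : (fun T : BiTabloid lam => T.act (σ * τ)) = (fun T => T.act τ) ∘ (fun T => T.act σ) :=
      funext fun T => T.act_mul σ τ
    rw [this, Finsupp.lmapDomain_comp]
    rfl

/-- The right module structure over the group algebra. -/
noncomputable instance (lam : BiPartition n) : Module (HypAlg K n)ᵐᵒᵖ (PermModule K lam) :=
  Module.compHom _ (((RingEquiv.opOp (Module.End K (PermModule K lam))).symm.toRingHom).comp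
    (RingHom.op ((MonoidAlgebra.lift K _ _ (actHom K lam)) : HypAlg K n →+* _)))

theorem of_smul (σ : Hyp n) (T : BiTabloid lam) :
    MulOpposite.op (MonoidAlgebra.of K (Hyp n) σ) • ofTabloid K T = ofTabloid K (T.act σ) := by
  change (MonoidAlgebra.lift K _ _ (actHom K lam) (MonoidAlgebra.of K (Hyp n) σ)).unop
    (ofTabloid K T) = _
  rw [MonoidAlgebra.lift_of]
  exact Finsupp.mapDomain_single

end PermModule

open Classical in
/-- The alternating column sum. -/
noncomputable def columnSum (t : BiTableau lam) : HypAlg K n :=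
  ∑ σ : Hyp n, if t.IsColPerm σ then ((hypSgn σ : ℤ) : K) • MonoidAlgebra.of K (Hyp n) σ else 0

/-- The polytabloid of a bitableau. -/
noncomputable def polytabloid (t : BiTableau lam) : PermModule K lam :=
  MulOpposite.op (columnSum K t) • PermModule.ofTabloid K t.tabloid

/-- The Specht module: the submodule spanned by the polytabloids. -/
noncomputable def specht (lam : BiPartition n) : Submodule (HypAlg K n)ᵐᵒᵖ (PermModule K lam) :=
  Submodule.span _ (Set.range fun t : BiTableau lam => polytabloid K t)

end Tableaux

section Modules

/-- A module is indecomposable if it is nonzero and not the direct sum of two nonzero submodules. -/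
def Indecomposable (R M : Type*) [Ring R] [AddCommGroup M] [Module R M] : Prop :=
  Nontrivial M ∧ ∀ p q : Submodule R M, IsCompl p q → p = ⊥ ∨ q = ⊥

/-- A submodule is a direct summand if it has a complement. -/
def IsDirectSummand {R M : Type*} [Ring R] [AddCommGroup M] [Module R M] (N : Submodule R M) :
    Prop := ∃ N' : Submodule R M, IsCompl N N'

/-- `M` has a quotient module isomorphic to `Q`. -/
def HasQuotientIso (R M Q : Type*) [Ring R] [AddCommGroup M] [Module R M] [AddCommGroup Q]
    [Module R Q] : Prop := ∃ U : Submodule R M, Nonempty ((M ⧸ U) ≃ₗ[R] Q)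

/-- `Y` is a Young module of the hyperoctahedral group algebra for `lam`: an indecomposable direct
summand of the permutation module that contains the Specht module. -/
def IsYoungModule (K : Type*) [Field K] {n : ℕ} (lam : BiPartition n)
    (Y : Submodule (HypAlg K n)ᵐᵒᵖ (PermModule K lam)) : Prop :=
  IsDirectSummand Y ∧ Indecomposable (HypAlg K n)ᵐᵒᵖ Y ∧ specht K lam ≤ Y

open scoped TensorProduct in
/-- The tensor product `M ⊗_A N` of a right `A`-module `M` and an `A`-`B`-bimodule `N`, as a right
`B`-module: the quotient of the tensor product of abelian groups (written with `N` as the left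
factor) by the relations `m a ⊗ n = m ⊗ a n`. -/
abbrev BalTensor (A B M N : Type*) [Ring A] [Ring B] [AddCommGroup M] [Module Aᵐᵒᵖ M]
    [AddCommGroup N] [Module A N] [Module Bᵐᵒᵖ N] : Type _ :=
  (N ⊗[ℤ] M) ⧸ Submodule.span Bᵐᵒᵖ {x : N ⊗[ℤ] M | ∃ (a : A) (m : M) (n : N),
    x = n ⊗ₜ[ℤ] (MulOpposite.op a • m) - (a • n) ⊗ₜ[ℤ] m}

end Modules

/-! ### Induction functors and permutation modules of the Brauer algebra -/

section Induction

variable (r : ℕ) (K : Type*) [Field K] (δ : K)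

/-- The two-sided ideal `J_m` generated by the diagrams with at least `m` horizontal edges. -/
noncomputable def layerIdeal (m : ℕ) : TwoSidedIdeal (BrauerC r K δ) :=
  TwoSidedIdeal.span {y | ∃ d : Diagram r, m ≤ d.horizontal ∧ y = BrauerC.diag δ d}

/-- The ideal `J_m` as a right submodule. -/
def layerSubmodule (m : ℕ) : Submodule (BrauerC r K δ)ᵐᵒᵖ (BrauerC r K δ) where
  carrier := {x | x ∈ layerIdeal r K δ m}
  add_mem' := fun hx hy => (layerIdeal r K δ m).add_mem hx hy
  zero_mem' := (layerIdeal r K δ m).zero_mem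
  smul_mem' := fun c x hx => (layerIdeal r K δ m).mul_mem_right x c.unop hx

/-- The quotient `B / J_m`, a `B`-`B`-bimodule. -/
abbrev LayerQuotient (m : ℕ) : Type _ := BrauerC r K δ ⧸ layerSubmodule r K δ m

/-- Left multiplication on `B / J_m`. -/
noncomputable def leftMulQuotient (m : ℕ) (b : BrauerC r K δ) :
    LayerQuotient r K δ m →ₗ[(BrauerC r K δ)ᵐᵒᵖ] LayerQuotient r K δ m :=
  (layerSubmodule r K δ m).mapQ (layerSubmodule r K δ m)
    (Module.toModuleEnd (BrauerC r K δ)ᵐᵒᵖ (BrauerC r K δ) b)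
    (fun x hx => (layerIdeal r K δ m).mul_mem_left b x hx)

noncomputable instance (m : ℕ) : SMul (BrauerC r K δ) (LayerQuotient r K δ m) :=
  ⟨fun b x => leftMulQuotient r K δ m b x⟩

theorem smul_mk_layer (m : ℕ) (b x : BrauerC r K δ) :
    b • (Submodule.Quotient.mk x : LayerQuotient r K δ m) = Submodule.Quotient.mk (b * x) := rfl

noncomputable instance (m : ℕ) : Module (BrauerC r K δ) (LayerQuotient r K δ m) where
  one_smul x := by
    induction x using Submodule.Quotient.induction_on with | _ x
    rw [smul_mk_layer, one_mul]
  mul_smul b c x := by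
    induction x using Submodule.Quotient.induction_on with | _ x
    rw [smul_mk_layer, smul_mk_layer, smul_mk_layer, mul_assoc]
  smul_zero b := map_zero (leftMulQuotient r K δ m b)
  smul_add b x y := map_add (leftMulQuotient r K δ m b) x y
  add_smul b c x := by
    induction x using Submodule.Quotient.induction_on with | _ x
    rw [smul_mk_layer, smul_mk_layer, smul_mk_layer, add_mul, Submodule.Quotient.mk_add]
  zero_smul x := by
    induction x using Submodule.Quotient.induction_on with | _ x
    rw [smul_mk_layer, zero_mul, Submodule.Quotient.mk_zero]

instance (m : ℕ) :
    SMulCommClass (BrauerC r K δ) (BrauerC r K δ)ᵐᵒᵖ (LayerQuotient r K δ m) where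
  smul_comm b c x := map_smul (leftMulQuotient r K δ m b) c x

section Corner

variable (l : ℕ) (X : Type*) [AddCommGroup X] [Module (BrauerC r K δ) X]
  [Module (BrauerC r K δ)ᵐᵒᵖ X] [SMulCommClass (BrauerC r K δ) (BrauerC r K δ)ᵐᵒᵖ X]

/-- The right `B`-module `e_l X` for a `B`-`B`-bimodule `X`. -/
noncomputable def corner : Submodule (BrauerC r K δ)ᵐᵒᵖ X :=
  LinearMap.range (Module.toModuleEnd (BrauerC r K δ)ᵐᵒᵖ X (BrauerC.e δ r l))

theorem hat_smul_mem_corner (a : HypAlg K (r - l)) {x : X} (hx : x ∈ corner r K δ l X) :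
    hat r K δ l a • x ∈ corner r K δ l X := by
  obtain ⟨y, rfl⟩ := hx
  refine ⟨hat r K δ l a • y, ?_⟩
  change BrauerC.e δ r l • hat r K δ l a • y = hat r K δ l a • BrauerC.e δ r l • y
  rw [smul_smul, smul_smul, hat_mul_e]

/-- The left action of the group algebra of rank `r - l` on `e_l X`. -/
noncomputable instance : Module (HypAlg K (r - l)) (corner r K δ l X) where
  smul a x := ⟨hat r K δ l a • x.1, hat_smul_mem_corner r K δ l X a x.2⟩
  one_smul x := Subtype.ext (show hat r K δ l 1 • x.1 = x.1 by rw [map_one, one_smul])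
  mul_smul a b x := Subtype.ext (show hat r K δ l (a * b) • x.1 = _ • _ • x.1 by
    rw [map_mul, mul_smul])
  smul_zero a := Subtype.ext (smul_zero _)
  smul_add a x y := Subtype.ext (smul_add _ _ _)
  add_smul a b x := Subtype.ext (show hat r K δ l (a + b) • x.1 = _ • x.1 + _ • x.1 by
    rw [map_add, add_smul])
  zero_smul x := Subtype.ext (show hat r K δ l 0 • x.1 = 0 by rw [map_zero, zero_smul])

end Corner

variable (l : ℕ) (M : Type*) [AddCommGroup M] [Module (HypAlg K (r - l))ᵐᵒᵖ M]

/-- `Ind_l M = M ⊗ e_l B`. -/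
abbrev BigInd : Type _ :=
  BalTensor (HypAlg K (r - l)) (BrauerC r K δ) M (corner r K δ l (BrauerC r K δ))

/-- `ind_l M = M ⊗ e_l (B / J_{l+1})`. -/
abbrev SmallInd : Type _ :=
  BalTensor (HypAlg K (r - l)) (BrauerC r K δ) M (corner r K δ l (LayerQuotient r K δ (l + 1)))

/-- The permutation module `M(l, lam) = Ind_l M(lam)` of the Brauer algebra. -/
abbrev BrauerPermModule (lam : BiPartition (r - l)) : Type _ :=
  BigInd r K δ l (PermModule K lam)

end Induction

/-- `N` is an indecomposable direct summand of `M(l, lam)` with a quotient isomorphic to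
`ind_l Y`. -/
def IsBrauerYoungModule (r : ℕ) (K : Type*) [Field K] (δ : K) (l : ℕ) (lam : BiPartition (r - l))
    (Y : Submodule (HypAlg K (r - l))ᵐᵒᵖ (PermModule K lam))
    (N : Submodule (BrauerC r K δ)ᵐᵒᵖ (BrauerPermModule r K δ l lam)) : Prop :=
  IsDirectSummand N ∧ Indecomposable (BrauerC r K δ)ᵐᵒᵖ N ∧
    HasQuotientIso (BrauerC r K δ)ᵐᵒᵖ N (SmallInd r K δ l Y)

end TypeC

/-!
Write `a` for the column sum of a bitableau of shape `λ`. By James's sorting argument `a` maps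
`M(λ)` onto the line spanned by the polytabloid, and it does not annihilate a summand `Y` of `M(λ)`
that contains the polytabloid. Since `e_l B e_l` is `K W_{r-l}` modulo `J_{l+1}`, the element
`e_l a` of `B` maps `Z = Ind_l M(λ)` into a line modulo `Z J_{l+1}`, but it does not annihilate
`ind_l Y`, which `J_{l+1}` does annihilate. Hence at most one summand of a decomposition of `Z` can
map onto `ind_l Y`. Conversely, if `Z = N ⊕ C`, then the endomorphisms of `Y` that come from the
two projections add up to `1`; as `End Y` is local, one of them is invertible, so `N` or `C` maps
onto `ind_l Y`. Two indecomposable summands mapping onto `ind_l Y` are isomorphic by the exchange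
argument of the Krull–Schmidt theorem.
-/

namespace TypeC

/-! ### Modules of finite length -/

section FiniteLength

variable {R X Q : Type*} [Ring R] [AddCommGroup X] [Module R X] [AddCommGroup Q] [Module R Q]

theorem Indecomposable.isLocalRing_end [IsArtinian R X] [IsNoetherian R X]
    (hX : Indecomposable R X) : IsLocalRing (Module.End R X) := by
  have := hX.1
  refine .of_isUnit_or_isUnit_one_sub_self fun f => ?_
  obtain ⟨n, hn⟩ := Filter.eventually_atTop.1 f.eventually_isCompl_ker_pow_range_pow
  have hcompl := hn (n + 1) n.le_succ
  rcases hX.2 _ _ hcompl with hker | hrange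
  · have hsurj : LinearMap.range (f ^ (n + 1)) = ⊤ := by
      simpa only [hker, bot_sup_eq] using hcompl.sup_eq_top
    exact .inl <| (isUnit_pow_iff n.succ_ne_zero).1 <| (Module.End.isUnit_iff _).2
      ⟨LinearMap.ker_eq_bot.1 hker, LinearMap.range_eq_top.1 hsurj⟩
  · have hnil : IsNilpotent f := ⟨n + 1, LinearMap.range_eq_bot.1 hrange⟩
    exact .inr hnil.isUnit_one_sub

theorem map_subtype_sup_map_subtype {N : Submodule R X} {p q : Submodule R N} (hpq : IsCompl p q) :
    p.map N.subtype ⊔ q.map N.subtype = N := by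
  rw [← Submodule.map_sup, hpq.sup_eq_top, Submodule.map_top, Submodule.range_subtype]

theorem disjoint_map_subtype {N : Submodule R X} {p q : Submodule R N} (hpq : IsCompl p q) :
    Disjoint (p.map N.subtype) (q.map N.subtype) :=
  Submodule.disjoint_map N.injective_subtype hpq.disjoint

theorem IsDirectSummand.map_subtype {N : Submodule R X} (hN : IsDirectSummand N)
    {p q : Submodule R N} (hpq : IsCompl p q) : IsDirectSummand (p.map N.subtype) := by
  obtain ⟨C, hC⟩ := hN
  refine ⟨q.map N.subtype ⊔ C, ?_, ?_⟩
  · refine (disjoint_map_subtype hpq).disjoint_sup_right_of_disjoint_sup_left ?_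
    rw [map_subtype_sup_map_subtype hpq]
    exact hC.disjoint
  · rw [codisjoint_iff, ← sup_assoc, map_subtype_sup_map_subtype hpq, hC.sup_eq_top]

theorem eq_bot_of_map_subtype_eq {N : Submodule R X} {p q : Submodule R N} (hpq : IsCompl p q)
    (hp : p.map N.subtype = N) : q = ⊥ := by
  have hp_top : p = ⊤ :=
    Submodule.map_injective_of_injective N.injective_subtype (by simpa using hp)
  simpa [hp_top] using hpq.inf_eq_bot

theorem exists_indecomposable_isDirectSummand [IsArtinian R X] (P : Submodule R X → Prop)
    (htop : P ⊤) (hbot : ¬ P ⊥) (hsup : ∀ p q, P (p ⊔ q) → P p ∨ P q) :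
    ∃ N, IsDirectSummand N ∧ Indecomposable R N ∧ P N := by
  obtain ⟨N, ⟨hN, hPN⟩, hmin⟩ := (wellFounded_lt (α := Submodule R X)).has_min
    {N | IsDirectSummand N ∧ P N} ⟨⊤, ⟨⊥, isCompl_top_bot⟩, htop⟩
  have eq_bot_of_map : ∀ p q : Submodule R N, IsCompl p q → P (p.map N.subtype) → q = ⊥ :=
    fun p q hpq hp => eq_bot_of_map_subtype_eq hpq <|
      (Submodule.map_subtype_le N p).lt_or_eq.resolve_left <| hmin _ ⟨hN.map_subtype hpq, hp⟩
  refine ⟨N, hN, ⟨?_, fun p q hpq => ?_⟩, hPN⟩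
  · rw [Submodule.nontrivial_iff_ne_bot]
    rintro rfl
    exact hbot hPN
  · rw [← map_subtype_sup_map_subtype hpq] at hPN
    exact (hsup _ _ hPN).symm.imp (eq_bot_of_map q p hpq.symm) (eq_bot_of_map p q hpq)

theorem hasQuotientIso_iff_exists_surjective {N : Type*} [AddCommGroup N] [Module R N] :
    HasQuotientIso R N Q ↔ ∃ f : N →ₗ[R] Q, Function.Surjective f := by
  constructor
  · rintro ⟨U, ⟨φ⟩⟩
    exact ⟨φ.toLinearMap ∘ₗ U.mkQ, φ.surjective.comp U.mkQ_surjective⟩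
  · rintro ⟨f, hf⟩
    exact ⟨LinearMap.ker f, ⟨f.quotKerEquivOfSurjective hf⟩⟩

theorem isCompl_iSup_ne {ι : Type*} [DecidableEq ι] {N : ι → Submodule R X}
    (hN : DirectSum.IsInternal N) (i : ι) : IsCompl (N i) (⨆ j ≠ i, N j) := by
  refine ⟨hN.submodule_iSupIndep i, ?_⟩
  rw [codisjoint_iff, ← iSup_split_single, hN.submodule_iSup_eq_top]

/-- The ring element `s` detects the submodule `N` modulo `T`: it moves some element of `N` out of
`T`. -/
def Detects (s : R) (T N : Submodule R X) : Prop := ∃ x ∈ N, s • x ∉ T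

theorem not_detects_bot (s : R) (T : Submodule R X) : ¬ Detects s T ⊥ := by
  simp [Detects]

theorem Detects.mono {s : R} {T N N' : Submodule R X} (h : Detects s T N) (hN : N ≤ N') :
    Detects s T N' :=
  h.imp fun _ hx => ⟨hN hx.1, hx.2⟩

theorem Detects.exists_of_iSup {s : R} {T : Submodule R X} {ι : Sort*} {N : ι → Submodule R X}
    (h : Detects s T (⨆ i, N i)) : ∃ i, Detects s T (N i) := by
  obtain ⟨x, hx, hsx⟩ := h
  by_contra hcon
  simp only [Detects, not_exists, not_and, not_not] at hcon
  refine hsx (Submodule.iSup_induction N (motive := fun x => s • x ∈ T) hx hcon ?_ ?_)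
  · simp only [smul_zero, T.zero_mem]
  · intro y z hy hz
    rw [smul_add]
    exact T.add_mem hy hz

theorem Detects.or_of_sup {s : R} {T p q : Submodule R X} (h : Detects s T (p ⊔ q)) :
    Detects s T p ∨ Detects s T q := by
  rw [sup_eq_iSup] at h
  obtain ⟨_ | _, hi⟩ := h.exists_of_iSup
  exacts [.inr hi, .inl hi]

/-- A test for the direct summands of `X` that map onto `Q`: the ring element `s` acts on `X` with
rank at most one modulo a submodule `T` which is invariant under endomorphisms and invisible to
homomorphisms to `Q`, but `s` does not act as zero on `Q`. Moreover, of any two complementary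
summands of `X` one maps onto `Q`. -/
structure RankOneTest (s : R) (T : Submodule R X) (Q : Type*) [AddCommGroup Q] [Module R Q] :
    Prop where
  map_mem : ∀ f : X →ₗ[R] X, ∀ x ∈ T, f x ∈ T
  map_eq_zero : ∀ f : X →ₗ[R] Q, ∀ x ∈ T, f x = 0
  exists_smul_sub_smul_mem : ∀ x y : X, s • x ∉ T → ∃ c : R, s • y - c • s • x ∈ T
  exists_smul_ne_zero : ∃ z : Q, s • z ≠ 0
  hasQuotientIso_or : ∀ N C : Submodule R X, IsCompl N C →
    HasQuotientIso R N Q ∨ HasQuotientIso R C Q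

namespace RankOneTest

variable {s : R} {T N C N' C' : Submodule R X}

theorem detects_of_hasQuotientIso (h : RankOneTest s T Q) (hN : IsCompl N C)
    (hQ : HasQuotientIso R N Q) : Detects s T N := by
  obtain ⟨f, hf⟩ := hasQuotientIso_iff_exists_surjective.1 hQ
  obtain ⟨z, hz⟩ := h.exists_smul_ne_zero
  obtain ⟨x, rfl⟩ := hf z
  refine ⟨x, x.2, fun hx => hz ?_⟩
  have hfx := h.map_eq_zero (f ∘ₗ N.projectionOnto C hN) _ hx
  rwa [map_smul, LinearMap.comp_apply, Submodule.projectionOnto_apply_left] at hfx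

theorem not_detects_of_isCompl (h : RankOneTest s T Q) (hN : IsCompl N C) (hdN : Detects s T N) :
    ¬ Detects s T C := by
  rintro ⟨y, hy, hsy⟩
  obtain ⟨x, hx, hsx⟩ := hdN
  obtain ⟨c, hc⟩ := h.exists_smul_sub_smul_mem x y hsx
  have hproj := h.map_mem (C.projection N hN.symm) _ hc
  rw [map_sub, map_smul, map_smul, map_smul, Submodule.projection_apply_of_mem_left _ hy,
    Submodule.projection_apply_of_mem_right _ hx, smul_zero, smul_zero, sub_zero] at hproj
  exact hsy hproj

theorem hasQuotientIso_iff_detects (h : RankOneTest s T Q) (hN : IsCompl N C) :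
    HasQuotientIso R N Q ↔ Detects s T N :=
  ⟨h.detects_of_hasQuotientIso hN, fun hd => (h.hasQuotientIso_or N C hN).resolve_right fun hC =>
    h.not_detects_of_isCompl hN hd (h.detects_of_hasQuotientIso hN.symm hC)⟩

theorem detects_top (h : RankOneTest s T Q) : Detects s T ⊤ := by
  rcases h.hasQuotientIso_or ⊤ ⊥ isCompl_top_bot with hQ | hQ
  · exact h.detects_of_hasQuotientIso isCompl_top_bot hQ
  · exact (h.detects_of_hasQuotientIso isCompl_bot_top hQ).mono bot_le

theorem exists_summand [IsArtinian R X] (h : RankOneTest s T Q) :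
    ∃ N : Submodule R X, IsDirectSummand N ∧ Indecomposable R N ∧ HasQuotientIso R N Q := by
  obtain ⟨N, ⟨C, hC⟩, hind, hdet⟩ := exists_indecomposable_isDirectSummand (Detects s T)
    h.detects_top (not_detects_bot s T) fun _ _ => Detects.or_of_sup
  exact ⟨N, ⟨C, hC⟩, hind, (h.hasQuotientIso_iff_detects hC).2 hdet⟩

theorem bijective_comp [IsArtinian R X] [IsNoetherian R X] (h : RankOneTest s T Q)
    (hN : IsCompl N C) (hN' : IsCompl N' C') (hi : Indecomposable R N) (hQ : HasQuotientIso R N Q)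
    (hQ' : HasQuotientIso R N' Q) :
    Function.Bijective ((N.projectionOnto C hN ∘ₗ N'.subtype) ∘ₗ
      (N'.projectionOnto C' hN' ∘ₗ N.subtype)) := by
  have hsum : ((N.projectionOnto C hN ∘ₗ N'.subtype) ∘ₗ (N'.projectionOnto C' hN' ∘ₗ N.subtype)) +
      ((N.projectionOnto C hN ∘ₗ C'.subtype) ∘ₗ
        (C'.projectionOnto N' hN'.symm ∘ₗ N.subtype)) = (1 : Module.End R N) := by
    ext1 x
    have hx := congrArg (N.projectionOnto C hN)
      (Submodule.projection_add_projection_eq_self hN' x.1)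
    rwa [map_add, Submodule.projectionOnto_apply_left] at hx
  have := hi.isLocalRing_end
  refine (Module.End.isUnit_iff _).1 <|
    (IsLocalRing.isUnit_or_isUnit_of_add_one hsum).resolve_right fun hunit => ?_
  have hsurj : Function.Surjective (N.projectionOnto C hN ∘ₗ C'.subtype) :=
    .of_comp (g := C'.projectionOnto N' hN'.symm ∘ₗ N.subtype)
      ((Module.End.isUnit_iff _).1 hunit).2
  obtain ⟨f, hf⟩ := hasQuotientIso_iff_exists_surjective.1 hQ
  exact h.not_detects_of_isCompl hN' (h.detects_of_hasQuotientIso hN' hQ') <|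
    h.detects_of_hasQuotientIso hN'.symm <| hasQuotientIso_iff_exists_surjective.2
      ⟨f ∘ₗ N.projectionOnto C hN ∘ₗ C'.subtype, hf.comp hsurj⟩

theorem nonempty_linearEquiv [IsArtinian R X] [IsNoetherian R X] (h : RankOneTest s T Q)
    (hN : IsDirectSummand N) (hN' : IsDirectSummand N') (hi : Indecomposable R N)
    (hi' : Indecomposable R N') (hQ : HasQuotientIso R N Q) (hQ' : HasQuotientIso R N' Q) :
    Nonempty (N' ≃ₗ[R] N) := by
  obtain ⟨C, hC⟩ := hN
  obtain ⟨C', hC'⟩ := hN'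
  refine ⟨LinearEquiv.ofBijective (N.projectionOnto C hC ∘ₗ N'.subtype) ⟨?_, ?_⟩⟩
  · exact .of_comp (f := N'.projectionOnto C' hC' ∘ₗ N.subtype)
      (h.bijective_comp hC' hC hi' hQ' hQ).1
  · exact .of_comp (g := N'.projectionOnto C' hC' ∘ₗ N.subtype)
      (h.bijective_comp hC hC' hi hQ hQ').2

theorem existsUnique_of_isInternal (h : RankOneTest s T Q) {ι : Type*} [DecidableEq ι]
    {N : ι → Submodule R X} (hN : DirectSum.IsInternal N) :
    ∃! i, HasQuotientIso R (N i) Q := by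
  have hcompl := isCompl_iSup_ne hN
  obtain ⟨i, hi⟩ : ∃ i, Detects s T (N i) :=
    Detects.exists_of_iSup (hN.submodule_iSup_eq_top ▸ h.detects_top)
  refine ⟨i, (h.hasQuotientIso_iff_detects (hcompl i)).2 hi, fun j hj => ?_⟩
  by_contra hne
  exact h.not_detects_of_isCompl (hcompl i) hi <|
    (h.detects_of_hasQuotientIso (hcompl j) hj).mono (le_iSup₂_of_le j hne le_rfl)

end RankOneTest

end FiniteLength

/-! ### Column sums and Young modules of the group algebra -/

section Signs

variable {n : ℕ}

theorem fst_eq_iff (v w : Vertex n) : v.1 = w.1 ↔ v = w ∨ v = refl w := by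
  obtain ⟨i, s⟩ := v
  obtain ⟨k, t⟩ := w
  cases s <;> cases t <;> simp [refl]

theorem hypAbs_apply (σ : Hyp n) (v : Vertex n) : hypAbs σ v.1 = (σ.1 v).1 :=
  (hypAbs_eq_iff σ _ _).2 rfl

theorem hypAbs_mul (σ τ : Hyp n) : hypAbs (σ * τ) = hypAbs σ * hypAbs τ :=
  Equiv.ext fun i => (hypAbs_apply σ (τ.1 (i, true))).symm

theorem signFactor_apply (σ : Hyp n) (v : Vertex n) : (if (σ.1 v).2 then (1 : ℤˣ) else -1) =
    (if (σ.1 (v.1, true)).2 then 1 else -1) * (if v.2 then 1 else -1) := by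
  obtain ⟨i, _ | _⟩ := v
  · have : σ.1 (i, false) = refl (σ.1 (i, true)) := hyp_apply_refl σ (i, true)
    rw [this]
    cases h : (σ.1 (i, true)).2 <;> simp [refl, h]
  · simp

theorem hypSgn_mul (σ τ : Hyp n) : hypSgn (σ * τ) = hypSgn σ * hypSgn τ := by
  have hprod : (∏ i : Fin n, if ((σ * τ).1 (i, true)).2 then (1 : ℤˣ) else -1) =
      (∏ i : Fin n, if (σ.1 (i, true)).2 then 1 else -1) *
        ∏ i : Fin n, if (τ.1 (i, true)).2 then 1 else -1 := by
    rw [← Equiv.prod_comp (hypAbs τ) (fun i => if (σ.1 (i, true)).2 then (1 : ℤˣ) else -1),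
      ← Finset.prod_mul_distrib]
    exact Finset.prod_congr rfl fun i _ => signFactor_apply σ (τ.1 (i, true))
  rw [hypSgn, hypAbs_mul, map_mul, hprod, hypSgn, hypSgn]
  exact mul_mul_mul_comm _ _ _ _

theorem hypSgn_one : hypSgn (1 : Hyp n) = 1 :=
  mul_eq_left.1 ((hypSgn_mul (1 : Hyp n) 1).symm.trans (by rw [one_mul]))

/-- The signed permutation that moves absolute values by `π` and changes the signs of the vertices
`±i` with `ε i = true`. -/
def signedPerm (π : Equiv.Perm (Fin n)) (ε : Fin n → Bool) : Hyp n :=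
  ⟨{ toFun v := (π v.1, v.2 ^^ ε v.1)
     invFun v := (π.symm v.1, v.2 ^^ ε (π.symm v.1))
     left_inv v := by simp
     right_inv v := by simp }, fun v => by simp [refl]⟩

theorem signedPerm_apply (π : Equiv.Perm (Fin n)) (ε : Fin n → Bool) (v : Vertex n) :
    (signedPerm π ε).1 v = (π v.1, v.2 ^^ ε v.1) := rfl

theorem hypSgn_signedPerm (π : Equiv.Perm (Fin n)) (ε : Fin n → Bool) :
    hypSgn (signedPerm π ε) = (∏ i, if ε i then -1 else 1) * Equiv.Perm.sign π := by
  have habs : hypAbs (signedPerm π ε) = π := Equiv.ext fun _ => rfl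
  rw [hypSgn, habs]
  congr 1
  exact Finset.prod_congr rfl fun i _ => by cases h : ε i <;> simp [signedPerm_apply, h]

theorem signedPerm_mul_self {π : Equiv.Perm (Fin n)} {ε : Fin n → Bool} (hπ : π * π = 1)
    (hε : ∀ i, ε (π i) = ε i) : signedPerm π ε * signedPerm π ε = 1 :=
  Subtype.ext <| Equiv.ext fun v => Prod.ext (Equiv.congr_fun hπ v.1) <| by
    change ((v.2 ^^ ε v.1) ^^ ε (π v.1)) = v.2
    simp [hε]

/-- The exchange of `i` and `-i`. -/
def signChange (i : Fin n) : Hyp n := signedPerm 1 fun k => k = i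

theorem signChange_apply_of_eq {i : Fin n} {v : Vertex n} (hv : v.1 = i) :
    (signChange i).1 v = refl v := by
  simp [signChange, signedPerm_apply, refl, hv]

theorem signChange_apply_of_ne {i : Fin n} {v : Vertex n} (hv : v.1 ≠ i) :
    (signChange i).1 v = v := by
  simp [signChange, signedPerm_apply, hv]

theorem signChange_mul_self (i : Fin n) : signChange i * signChange i = 1 :=
  signedPerm_mul_self (one_mul 1) fun _ => rfl

theorem hypSgn_signChange (i : Fin n) : hypSgn (signChange i) = -1 := by
  simp [signChange, hypSgn_signedPerm]

/-- The exchange of `v` and `w` together with that of `-v` and `-w`. -/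
def signedSwap (v w : Vertex n) : Hyp n :=
  signedPerm (Equiv.swap v.1 w.1) fun k => if k = v.1 ∨ k = w.1 then v.2 ^^ w.2 else false

theorem signedSwap_comm (v w : Vertex n) : signedSwap v w = signedSwap w v := by
  simp only [signedSwap, Equiv.swap_comm, Bool.xor_comm, or_comm]

theorem signedSwap_apply_left (v w : Vertex n) : (signedSwap v w).1 v = w := by
  simp [signedSwap, signedPerm_apply]

theorem signedSwap_apply_of_ne {v w u : Vertex n} (hv : u.1 ≠ v.1) (hw : u.1 ≠ w.1) :
    (signedSwap v w).1 u = u := by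
  simp [signedSwap, signedPerm_apply, hv, hw, Equiv.swap_apply_of_ne_of_ne hv hw]

theorem signedSwap_mul_self (v w : Vertex n) : signedSwap v w * signedSwap v w = 1 := by
  refine signedPerm_mul_self (Equiv.swap_mul_self _ _) fun i => ?_
  rcases eq_or_ne i v.1 with rfl | hv
  · simp
  rcases eq_or_ne i w.1 with rfl | hw
  · simp
  rw [Equiv.swap_apply_of_ne_of_ne hv hw]

theorem hypSgn_signedSwap {v w : Vertex n} (h : v.1 ≠ w.1) : hypSgn (signedSwap v w) = -1 := by
  rw [signedSwap, hypSgn_signedPerm, Equiv.Perm.sign_swap h,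
    Finset.prod_eq_mul v.1 w.1 h (fun k _ hk => by simp [hk.1, hk.2]) (by simp) (by simp)]
  cases v.2 <;> cases w.2 <;> simp

end Signs

section ColumnSort

open Finset

variable {μ : YoungDiagram} (w : μ.cells → ℕ)

/-- The number of cells in the column of `b` that have smaller weight than `b`: the row to which `b`
moves when the columns are sorted by weight. -/
def columnRank (b : μ.cells) : ℕ := #{b' : μ.cells | b'.1.2 = b.1.2 ∧ w b' < w b}

variable {w}

theorem columnRank_le (hinj : ∀ b b' : μ.cells, b.1.2 = b'.1.2 → w b = w b' → b = b')
    (b : μ.cells) : columnRank w b ≤ w b := by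
  refine (card_le_card_of_injOn w (t := range (w b)) ?_ ?_).trans_eq (card_range _)
  · intro x hx
    simpa using (mem_filter.1 hx).2.2
  · intro x hx y hy
    exact hinj x y ((mem_filter.1 hx).2.1.trans (mem_filter.1 hy).2.1.symm)

theorem columnRank_mem_cells (b : μ.cells) : (columnRank w b, b.1.2) ∈ μ.cells := by
  rw [YoungDiagram.mem_cells, YoungDiagram.mem_iff_lt_colLen, YoungDiagram.colLen_eq_card,
    columnRank, ← card_map (Function.Embedding.subtype _)]
  refine card_lt_card ⟨fun x hx => ?_, fun hsub => ?_⟩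
  · obtain ⟨b', hb', rfl⟩ := mem_map.1 hx
    exact YoungDiagram.mem_col_iff.2 ⟨b'.2, (mem_filter.1 hb').2.1⟩
  · obtain ⟨b', hb', heq⟩ := mem_map.1 (hsub (YoungDiagram.mem_col_iff.2 ⟨b.2, rfl⟩))
    rw [← Subtype.ext heq] at hb'
    exact lt_irrefl _ (mem_filter.1 hb').2.2

theorem columnRank_lt_columnRank {b b' : μ.cells} (hcol : b.1.2 = b'.1.2) (hw : w b < w b') :
    columnRank w b < columnRank w b' := by
  refine card_lt_card ⟨fun x hx => ?_, fun hsub => ?_⟩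
  · obtain ⟨-, hx, hxw⟩ := mem_filter.1 hx
    exact mem_filter.2 ⟨mem_univ _, hx.trans hcol, hxw.trans hw⟩
  · have hb := hsub (mem_filter.2 ⟨mem_univ b, hcol, hw⟩)
    exact lt_irrefl _ (mem_filter.1 hb).2.2

theorem eq_of_columnRank_eq (hinj : ∀ b b' : μ.cells, b.1.2 = b'.1.2 → w b = w b' → b = b')
    {b b' : μ.cells} (hcol : b.1.2 = b'.1.2) (hrank : columnRank w b = columnRank w b') :
    b = b' := by
  rcases lt_trichotomy (w b) (w b') with h | h | h
  · exact absurd hrank (columnRank_lt_columnRank hcol h).ne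
  · exact hinj b b' hcol h
  · exact absurd hrank (columnRank_lt_columnRank hcol.symm h).ne'

theorem exists_perm_row_eq (hinj : ∀ b b' : μ.cells, b.1.2 = b'.1.2 → w b = w b' → b = b')
    (hsum : ∑ b, w b = ∑ b : μ.cells, b.1.1) :
    ∃ φ : Equiv.Perm μ.cells, ∀ b, (φ b).1.2 = b.1.2 ∧ (φ b).1.1 = w b := by
  let sort : μ.cells → μ.cells := fun b => ⟨_, columnRank_mem_cells (w := w) b⟩
  have hsort : Function.Injective sort := fun b b' h => by
    obtain ⟨hrank, hcol⟩ := Prod.ext_iff.1 (Subtype.ext_iff.1 h)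
    exact eq_of_columnRank_eq hinj hcol hrank
  let φ : Equiv.Perm μ.cells := .ofBijective sort (Finite.injective_iff_bijective.1 hsort)
  -- The ranks are bounded by the weights, and both have the same sum.
  have hsum_rank : ∑ b, columnRank w b = ∑ b, w b :=
    (Equiv.sum_comp φ fun b : μ.cells => b.1.1).trans hsum.symm
  exact ⟨φ, fun b => ⟨rfl, (sum_eq_sum_iff_of_le fun b _ => columnRank_le hinj b).1 hsum_rank b
    (mem_univ b)⟩⟩

end ColumnSort

namespace BiTableau

variable {n : ℕ} {lam : BiPartition n}

/-- The boxes of a bitableau correspond to the absolute values of its entries. -/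
noncomputable def absEquiv (t : BiTableau lam) : lam.Box ≃ Fin n :=
  Equiv.ofBijective (fun b => (t.entry b).1) <|
    (Fintype.bijective_iff_injective_and_card _).2 ⟨t.abs_injective, by
      simpa [YoungDiagram.card] using lam.card_add_card⟩

theorem absEquiv_apply (t : BiTableau lam) (b : lam.Box) : t.absEquiv b = (t.entry b).1 := rfl

theorem absEquiv_symm_fst_entry (t : BiTableau lam) (b : lam.Box) :
    t.absEquiv.symm (t.entry b).1 = b :=
  t.absEquiv.symm_apply_apply b

theorem exists_entry (t : BiTableau lam) (v : Vertex n) :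
    ∃ b, v = t.entry b ∨ v = refl (t.entry b) := by
  refine ⟨t.absEquiv.symm v.1, (fst_eq_iff _ _).1 ?_⟩
  rw [← absEquiv_apply, Equiv.apply_symm_apply]

theorem hyp_ext (t : BiTableau lam) {σ ρ : Hyp n} (h : ∀ b, σ.1 (t.entry b) = ρ.1 (t.entry b)) :
    σ = ρ := by
  refine Subtype.ext (Equiv.ext fun v => ?_)
  obtain ⟨b, rfl | rfl⟩ := t.exists_entry v
  · exact h b
  · rw [hyp_apply_refl, hyp_apply_refl, h]

theorem act_injective (t : BiTableau lam) : Function.Injective t.act := fun _ _ h =>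
  inv_injective <| t.hyp_ext fun b => congrFun (congrArg entry h) b

/-- The signed permutation that carries the entries of `t` to those of `s`. -/
noncomputable def transport (t s : BiTableau lam) : Hyp n :=
  signedPerm (t.absEquiv.symm.trans s.absEquiv) fun i =>
    (t.entry (t.absEquiv.symm i)).2 ^^ (s.entry (t.absEquiv.symm i)).2

theorem transport_apply (t s : BiTableau lam) (b : lam.Box) :
    (t.transport s).1 (t.entry b) = s.entry b := by
  rw [transport, signedPerm_apply, Equiv.trans_apply, absEquiv_symm_fst_entry, absEquiv_apply,
    ← Bool.xor_assoc, Bool.xor_self, Bool.false_xor]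

theorem transport_inv_apply (t s : BiTableau lam) (b : lam.Box) :
    (t.transport s)⁻¹.1 (s.entry b) = t.entry b := by
  rw [InvMemClass.coe_inv, Equiv.Perm.inv_eq_iff_eq, transport_apply]

theorem act_transport (t s : BiTableau lam) : t.act (s.transport t) = s :=
  BiTableau.ext <| funext fun b => transport_inv_apply s t b

/-- The common form of row and column permutations: `σ` permutes the entries of `t` within the lines
of constant `coord`, and changes signs only in the component whose boxes have `isLeft = side`. -/
def IsLinePerm (t : BiTableau lam) (coord : ℕ × ℕ → ℕ) (side : Bool) (σ : Hyp n) : Prop :=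
  ∀ b : lam.Box, ∃ b' : lam.Box, b'.isLeft = b.isLeft ∧
    coord (BiPartition.pos b') = coord (BiPartition.pos b) ∧
    (σ.1 (t.entry b)).1 = (t.entry b').1 ∧ (b.isLeft ≠ side → σ.1 (t.entry b) = t.entry b')

theorem eq_or_and_eq_refl_iff {v w : Vertex n} {p : Prop} :
    (v = w ∨ p ∧ v = refl w) ↔ v.1 = w.1 ∧ (¬ p → v = w) := by
  rw [fst_eq_iff]
  tauto

theorem isColPerm_iff_isLinePerm {t : BiTableau lam} {σ : Hyp n} :
    t.IsColPerm σ ↔ t.IsLinePerm Prod.snd true σ := by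
  simp only [IsColPerm, IsLinePerm, eq_or_and_eq_refl_iff, ne_eq]

theorem isRowPerm_iff_isLinePerm {t : BiTableau lam} {σ : Hyp n} :
    t.IsRowPerm σ ↔ t.IsLinePerm Prod.fst false σ := by
  simp only [IsRowPerm, IsLinePerm, eq_or_and_eq_refl_iff, ne_eq, Bool.not_eq_false,
    Sum.not_isRight]

theorem isLinePerm_signChange (t : BiTableau lam) (coord : ℕ × ℕ → ℕ) (b : lam.Box) :
    t.IsLinePerm coord b.isLeft (signChange (t.entry b).1) := by
  refine fun c => ⟨c, rfl, rfl, ?_⟩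
  rcases eq_or_ne c b with rfl | hcb
  · exact ⟨by rw [signChange_apply_of_eq rfl]; rfl, fun h => absurd rfl h⟩
  · have := signChange_apply_of_ne (t.abs_injective.ne hcb)
    exact ⟨by rw [this], fun _ => this⟩

theorem isLinePerm_signedSwap {t : BiTableau lam} {coord : ℕ × ℕ → ℕ} {side : Bool}
    {b b' : lam.Box} {v w : Vertex n} (hcomp : b.isLeft = b'.isLeft)
    (hcoord : coord (BiPartition.pos b) = coord (BiPartition.pos b'))
    (hv : v.1 = (t.entry b).1) (hw : w.1 = (t.entry b').1)
    (hv' : b.isLeft ≠ side → v = t.entry b) (hw' : b'.isLeft ≠ side → w = t.entry b') :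
    t.IsLinePerm coord side (signedSwap v w) := by
  intro c
  rcases eq_or_ne c b with rfl | hcb
  · refine ⟨b', hcomp.symm, hcoord.symm, ?_, fun hs => ?_⟩
    · rw [← hypAbs_apply, ← hv, hypAbs_apply, signedSwap_apply_left, hw]
    · rw [← hv' hs, signedSwap_apply_left, hw' (hcomp ▸ hs)]
  rcases eq_or_ne c b' with rfl | hcb'
  · rw [signedSwap_comm]
    refine ⟨b, hcomp, hcoord, ?_, fun hs => ?_⟩
    · rw [← hypAbs_apply, ← hw, hypAbs_apply, signedSwap_apply_left, hv]
    · rw [← hw' hs, signedSwap_apply_left, hv' (hcomp ▸ hs)]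
  · have := signedSwap_apply_of_ne (hv ▸ t.abs_injective.ne hcb) (hw ▸ t.abs_injective.ne hcb')
    exact ⟨c, rfl, rfl, by rw [this], fun _ => this⟩

theorem box_ext {b b' : lam.Box} (h1 : b.isLeft = b'.isLeft)
    (h2 : BiPartition.pos b = BiPartition.pos b') : b = b' := by
  rcases b with b | b <;> rcases b' with b' | b'
  · exact congrArg Sum.inl (Subtype.ext h2)
  · simp at h1
  · simp at h1
  · exact congrArg Sum.inr (Subtype.ext h2)

theorem eq_one_of_isRowPerm_of_isColPerm {t : BiTableau lam} {σ : Hyp n} (hr : t.IsRowPerm σ)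
    (hc : t.IsColPerm σ) : σ = 1 := by
  refine t.hyp_ext fun b => ?_
  obtain ⟨b₁, hcomp, hrow, habs₁, hright⟩ := isRowPerm_iff_isLinePerm.1 hr b
  obtain ⟨b₂, -, hcol, habs₂, hleft⟩ := isColPerm_iff_isLinePerm.1 hc b
  obtain rfl : b₁ = b₂ := t.abs_injective (habs₁.symm.trans habs₂)
  obtain rfl : b₁ = b := box_ext hcomp (Prod.ext hrow hcol)
  cases hb : b₁.isLeft
  · exact hleft (by simp [hb])
  · exact hright (by simp [hb])

/-- The group of column permutations. -/
def colGroup (t : BiTableau lam) : Subgroup (Hyp n) :=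
  let S : Submonoid (Hyp n) :=
    { carrier := {σ | t.IsColPerm σ}
      one_mem' := fun b => ⟨b, rfl, rfl, .inl rfl⟩
      mul_mem' := by
        intro σ τ hσ hτ
        simp only [Set.mem_ofPred_eq, isColPerm_iff_isLinePerm] at hσ hτ ⊢
        intro b
        obtain ⟨b', hcomp, hcol, habs, hright⟩ := hτ b
        obtain ⟨b'', hcomp', hcol', habs', hright'⟩ := hσ b'
        refine ⟨b'', hcomp'.trans hcomp, hcol'.trans hcol, ?_, fun hb => ?_⟩
        · rw [← habs', ← hypAbs_apply, ← hypAbs_apply, hypAbs_mul, ← habs, ← hypAbs_apply]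
          rfl
        · rw [← hright' (hcomp ▸ hb), ← hright hb]
          rfl }
  { S with
    inv_mem' := fun {σ} hσ => by
      have hinv : σ⁻¹ = σ ^ (orderOf σ - 1) := by
        rw [inv_eq_iff_mul_eq_one, ← pow_succ', Nat.sub_add_cancel (orderOf_pos σ),
          pow_orderOf_eq_one]
      exact hinv ▸ S.pow_mem hσ _ }

/-- The permutation of the boxes that matches a box of `t` with the box of `s` whose entry has the
same absolute value. -/
noncomputable def matchBox (t s : BiTableau lam) : Equiv.Perm lam.Box :=
  t.absEquiv.trans s.absEquiv.symm

theorem fst_entry_matchBox (t s : BiTableau lam) (b : lam.Box) :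
    (s.entry (t.matchBox s b)).1 = (t.entry b).1 :=
  s.absEquiv.apply_symm_apply (t.absEquiv b)

/-- The bitableau with the absolute values of `t`, and the signs of `s` in the first and of `t` in
the second component. The bitableaux `t` and `s` are allowed to absorb the changes of sign by their
column and row permutations, respectively. -/
noncomputable def mixSigns (t s : BiTableau lam) : BiTableau lam where
  entry b := if b.isLeft then s.entry (t.matchBox s b) else t.entry b
  abs_injective b b' h := t.abs_injective <| by
    simpa only [apply_ite Prod.fst, fst_entry_matchBox, ite_self] using h

theorem mixSigns_entry_of_left (t s : BiTableau lam) {b : lam.Box} (hb : b.isLeft = true) :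
    (t.mixSigns s).entry b = s.entry (t.matchBox s b) :=
  if_pos hb

theorem mixSigns_entry_of_right (t s : BiTableau lam) {b : lam.Box} (hb : b.isLeft = false) :
    (t.mixSigns s).entry b = t.entry b :=
  if_neg (by simp [hb])

theorem fst_mixSigns_entry (t s : BiTableau lam) (b : lam.Box) :
    ((t.mixSigns s).entry b).1 = (t.entry b).1 := by
  simp only [mixSigns, apply_ite Prod.fst, fst_entry_matchBox, ite_self]

/-- Some odd involution is a column permutation of `t` and a row permutation of `s`. -/
def HaveOddInvolution (t s : BiTableau lam) : Prop :=
  ∃ τ : Hyp n, t.IsColPerm τ ∧ s.IsRowPerm τ ∧ τ * τ = 1 ∧ hypSgn τ = -1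

theorem isLeft_matchBox_of_isLeft {t s : BiTableau lam} (h : ¬ t.HaveOddInvolution s)
    {b : lam.Box} (hb : b.isLeft = true) : (t.matchBox s b).isLeft = true := by
  by_contra hb'
  refine h ⟨signChange (t.entry b).1, isColPerm_iff_isLinePerm.2 ?_, isRowPerm_iff_isLinePerm.2 ?_,
    signChange_mul_self _, hypSgn_signChange _⟩
  · simpa only [hb] using t.isLinePerm_signChange Prod.snd b
  · simpa only [Bool.not_eq_true _ ▸ hb', fst_entry_matchBox] using
      s.isLinePerm_signChange Prod.fst (t.matchBox s b)

theorem exists_matchBox_eq_sumCongr {t s : BiTableau lam} (h : ¬ t.HaveOddInvolution s) :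
    ∃ β₁ β₂, t.matchBox s = Equiv.Perm.sumCongr β₁ β₂ := by
  obtain ⟨⟨β₁, β₂⟩, hβ⟩ := Equiv.Perm.mem_sumCongrHom_range_of_perm_mapsTo_inl
    (σ := t.matchBox s) <| by
      rintro _ ⟨b, rfl⟩
      obtain ⟨c, hc⟩ := Sum.isLeft_iff.1 (isLeft_matchBox_of_isLeft h (b := .inl b) rfl)
      exact ⟨c, hc.symm⟩
  exact ⟨β₁, β₂, hβ.symm⟩

theorem isLeft_matchBox {t s : BiTableau lam} (h : ¬ t.HaveOddInvolution s) (b : lam.Box) :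
    (t.matchBox s b).isLeft = b.isLeft := by
  obtain ⟨β₁, β₂, hβ⟩ := exists_matchBox_eq_sumCongr h
  rw [hβ]
  cases b <;> rfl

theorem eq_of_row_matchBox_eq {t s : BiTableau lam} (h : ¬ t.HaveOddInvolution s)
    {b b' : lam.Box} (hcomp : b.isLeft = b'.isLeft)
    (hcol : (BiPartition.pos b).2 = (BiPartition.pos b').2)
    (hrow : (BiPartition.pos (t.matchBox s b)).1 = (BiPartition.pos (t.matchBox s b')).1) :
    b = b' := by
  by_contra hne
  refine h ⟨signedSwap ((t.mixSigns s).entry b) ((t.mixSigns s).entry b'),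
    isColPerm_iff_isLinePerm.2 ?_, isRowPerm_iff_isLinePerm.2 ?_, signedSwap_mul_self _ _,
    hypSgn_signedSwap ((t.mixSigns s).abs_injective.ne hne)⟩
  · have entry_eq : ∀ c : lam.Box, c.isLeft ≠ true → (t.mixSigns s).entry c = t.entry c :=
      fun c hc => mixSigns_entry_of_right t s (Bool.eq_false_of_not_eq_true hc)
    exact isLinePerm_signedSwap hcomp hcol (fst_mixSigns_entry t s b) (fst_mixSigns_entry t s b')
      (entry_eq b) (entry_eq b')
  · have abs_eq : ∀ c, ((t.mixSigns s).entry c).1 = (s.entry (t.matchBox s c)).1 := fun c =>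
      (fst_mixSigns_entry t s c).trans (fst_entry_matchBox t s c).symm
    have entry_eq : ∀ c, (t.matchBox s c).isLeft ≠ false →
        (t.mixSigns s).entry c = s.entry (t.matchBox s c) := fun c hc =>
      mixSigns_entry_of_left t s (by simpa [isLeft_matchBox h] using hc)
    exact isLinePerm_signedSwap (by simp only [isLeft_matchBox h, hcomp]) hrow (abs_eq b)
      (abs_eq b') (entry_eq b) (entry_eq b')

theorem exists_boxPerm {t s : BiTableau lam} (h : ¬ t.HaveOddInvolution s) :
    ∃ φ : Equiv.Perm lam.Box, ∀ b, (φ b).isLeft = b.isLeft ∧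
      (BiPartition.pos (φ b)).2 = (BiPartition.pos b).2 ∧
      (BiPartition.pos (φ b)).1 = (BiPartition.pos (t.matchBox s b)).1 := by
  have hinj := fun b b' => eq_of_row_matchBox_eq h (b := b) (b' := b')
  obtain ⟨β₁, β₂, hβ⟩ := exists_matchBox_eq_sumCongr h
  rw [hβ] at hinj ⊢
  obtain ⟨φ₁, hφ₁⟩ := exists_perm_row_eq (w := fun b => (β₁ b).1.1)
    (fun b b' hcol hrow => Sum.inl_injective (hinj (.inl b) (.inl b') rfl hcol hrow))
    (Equiv.sum_comp β₁ fun b => b.1.1)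
  obtain ⟨φ₂, hφ₂⟩ := exists_perm_row_eq (w := fun b => (β₂ b).1.1)
    (fun b b' hcol hrow => Sum.inr_injective (hinj (.inr b) (.inr b') rfl hcol hrow))
    (Equiv.sum_comp β₂ fun b => b.1.1)
  refine ⟨Equiv.Perm.sumCongr φ₁ φ₂, ?_⟩
  rintro (b | b)
  · exact ⟨rfl, hφ₁ b⟩
  · exact ⟨rfl, hφ₂ b⟩

/-- The bitableau `t` with its boxes permuted by `φ`. -/
def reindex (t : BiTableau lam) (φ : Equiv.Perm lam.Box) : BiTableau lam where
  entry b := t.entry (φ b)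
  abs_injective := t.abs_injective.comp φ.injective

theorem haveOddInvolution_or_exists_isColPerm (t s : BiTableau lam) :
    t.HaveOddInvolution s ∨ ∃ σ : Hyp n, t.IsColPerm σ ∧ (t.act σ).tabloid = s.tabloid := by
  refine or_iff_not_imp_left.2 fun h => ?_
  obtain ⟨φ, hφ⟩ := exists_boxPerm h
  let u := t.mixSigns s
  let σ := u.transport (t.reindex φ)
  have hσ : ∀ b, σ.1 (u.entry b) = t.entry (φ b) := transport_apply u (t.reindex φ)
  have hact : ∀ b, (t.act σ).entry (φ b) = u.entry b := transport_inv_apply u (t.reindex φ)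
  let ρ := s.transport (t.act σ)
  have hρ : ∀ b, ρ.1 (s.entry b) = (t.act σ).entry b := transport_apply s (t.act σ)
  refine ⟨σ, isColPerm_iff_isLinePerm.2 fun b => ⟨φ b, (hφ b).1, (hφ b).2.1, ?_, fun hb => ?_⟩,
    Quotient.sound ⟨ρ, isRowPerm_iff_isLinePerm.2 fun c => ?_, (act_transport _ _).symm⟩⟩
  · rw [← hσ, ← hypAbs_apply, ← hypAbs_apply, fst_mixSigns_entry]
  · rw [← hσ, mixSigns_entry_of_right t s (Bool.eq_false_of_not_eq_true hb)]
  · obtain ⟨b, rfl⟩ := φ.surjective c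
    refine ⟨t.matchBox s b, by rw [isLeft_matchBox h, (hφ b).1], (hφ b).2.2.symm, ?_, fun hb => ?_⟩
    · rw [hact, ← hρ, ← hypAbs_apply, ← hypAbs_apply, fst_mixSigns_entry, fst_entry_matchBox]
    · rw [hact, ← hρ, mixSigns_entry_of_left]
      simpa [(hφ b).1] using hb

end BiTableau

section PermModules

open MulOpposite MonoidAlgebra

variable {n : ℕ} {lam : BiPartition n} (K : Type*) [Field K]

instance : Finite (BiTableau lam) :=
  Finite.of_injective BiTableau.entry fun _ _ => BiTableau.ext

instance : Finite (BiTabloid lam) := inferInstanceAs (Finite (Quotient _))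

instance : Nonempty (BiTableau lam) := by
  have hcard : Fintype.card lam.Box = Fintype.card (Fin n) := by
    simpa [YoungDiagram.card] using lam.card_add_card
  obtain ⟨f⟩ := Fintype.card_eq.1 hcard
  exact ⟨⟨fun b => (f b, true), f.injective⟩⟩

instance : Module.Finite K (PermModule K lam) :=
  inferInstanceAs (Module.Finite K (BiTabloid lam →₀ K))

namespace PermModule

instance : IsScalarTower K (HypAlg K n)ᵐᵒᵖ (PermModule K lam) where
  smul_assoc c a m := by
    change (lift K _ _ (actHom K lam) (c • a.unop)).unop m =
      c • (lift K _ _ (actHom K lam) a.unop).unop m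
    rw [map_smul, unop_smul]
    rfl

instance : IsNoetherian (HypAlg K n)ᵐᵒᵖ (PermModule K lam) := isNoetherian_of_tower K inferInstance

instance : IsArtinian (HypAlg K n)ᵐᵒᵖ (PermModule K lam) := isArtinian_of_tower K inferInstance

variable {K}

theorem induction {P : PermModule K lam → Prop} (m : PermModule K lam) (zero : P 0)
    (add : ∀ x y, P x → P y → P (x + y))
    (smul_ofTabloid : ∀ (c : K) (t : BiTableau lam), P (c • ofTabloid K t.tabloid)) : P m := by
  refine Finsupp.induction_linear (motive := P) m zero add fun T c => ?_
  induction T using Quotient.inductionOn with | _ t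
  have hsingle : (Finsupp.single t.tabloid c : BiTabloid lam →₀ K) =
      c • Finsupp.single t.tabloid (1 : K) := by
    rw [Finsupp.smul_single, smul_eq_mul, mul_one]
  exact hsingle ▸ smul_ofTabloid c t

end PermModule

theorem tabloid_act (t : BiTableau lam) (σ : Hyp n) : t.tabloid.act σ = (t.act σ).tabloid := rfl

theorem tabloid_act_eq_self_iff {t : BiTableau lam} {σ : Hyp n} :
    t.tabloid.act σ = t.tabloid ↔ t.IsRowPerm σ := by
  rw [eq_comm]
  refine ⟨fun h => ?_, fun h => Quotient.sound ⟨σ, h, rfl⟩⟩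
  obtain ⟨ρ, hρ, hact⟩ := Quotient.exact h
  exact t.act_injective hact ▸ hρ

open Classical in
theorem columnSum_smul_ofTabloid (t : BiTableau lam) (T : BiTabloid lam) :
    op (columnSum K t) • PermModule.ofTabloid K T =
      ∑ σ : Hyp n, if t.IsColPerm σ then
        ((hypSgn σ : ℤ) : K) • PermModule.ofTabloid K (T.act σ) else 0 := by
  have hop : op (columnSum K t) = ∑ σ : Hyp n, op (if t.IsColPerm σ then
      ((hypSgn σ : ℤ) : K) • of K (Hyp n) σ else 0) :=
    map_sum opAddEquiv _ _
  rw [hop, Finset.sum_smul]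
  refine Finset.sum_congr rfl fun σ _ => ?_
  split_ifs
  · rw [op_smul, smul_assoc, PermModule.of_smul]
  · rw [op_zero, zero_smul]

theorem of_mul_columnSum {t : BiTableau lam} {σ : Hyp n} (hσ : t.IsColPerm σ) :
    of K (Hyp n) σ * columnSum K t = ((hypSgn σ : ℤ) : K) • columnSum K t := by
  classical
  have hsgn : ((hypSgn σ : ℤ) : K) * ((hypSgn σ : ℤ) : K) = 1 := by
    rw [← Int.cast_mul, ← Units.val_mul, Int.units_mul_self, Units.val_one, Int.cast_one]
  rw [columnSum, Finset.mul_sum, Finset.smul_sum, ← Equiv.sum_comp (Equiv.mulLeft σ)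
    fun τ => ((hypSgn σ : ℤ) : K) • (if t.IsColPerm τ then
      ((hypSgn τ : ℤ) : K) • of K (Hyp n) τ else 0)]
  refine Finset.sum_congr rfl fun τ _ => ?_
  have hiff : t.IsColPerm (σ * τ) ↔ t.IsColPerm τ := t.colGroup.mul_mem_cancel_left hσ
  simp only [Equiv.coe_mulLeft, hiff]
  split_ifs
  · rw [smul_smul, hypSgn_mul, mul_smul_comm, map_mul, Units.val_mul, Int.cast_mul, ← mul_assoc,
      hsgn, one_mul]
  · rw [mul_zero, smul_zero]

theorem isColPerm_act_iff (t : BiTableau lam) (σ ρ : Hyp n) :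
    (t.act σ).IsColPerm (σ⁻¹ * ρ * σ) ↔ t.IsColPerm ρ := by
  refine forall_congr' fun b => exists_congr fun b' => and_congr_right fun _ =>
    and_congr_right fun _ => ?_
  have hentry : (σ⁻¹ * ρ * σ).1 ((t.act σ).entry b) = (σ⁻¹).1 (ρ.1 (t.entry b)) := by
    simp [BiTableau.act]
  have hentry' : (t.act σ).entry b' = (σ⁻¹).1 (t.entry b') := rfl
  rw [hentry, hentry', ← hyp_apply_refl, EmbeddingLike.apply_eq_iff_eq,
    EmbeddingLike.apply_eq_iff_eq]

theorem hypSgn_conj (σ ρ : Hyp n) : hypSgn (σ⁻¹ * ρ * σ) = hypSgn ρ := by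
  rw [hypSgn_mul, hypSgn_mul, mul_right_comm, ← hypSgn_mul, inv_mul_cancel, hypSgn_one, one_mul]

theorem columnSum_act (t : BiTableau lam) (σ : Hyp n) :
    columnSum K (t.act σ) = of K (Hyp n) σ⁻¹ * columnSum K t * of K (Hyp n) σ := by
  classical
  rw [columnSum, columnSum, Finset.mul_sum, Finset.sum_mul,
    ← Equiv.sum_comp ((Equiv.mulLeft σ⁻¹).trans (Equiv.mulRight σ))]
  refine Finset.sum_congr rfl fun ρ _ => ?_
  simp only [Equiv.trans_apply, Equiv.coe_mulLeft, Equiv.coe_mulRight, isColPerm_act_iff,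
    hypSgn_conj]
  split_ifs
  · rw [mul_smul_comm, smul_mul_assoc, map_mul, map_mul]
  · rw [mul_zero, zero_mul]

theorem polytabloid_act (t : BiTableau lam) (σ : Hyp n) :
    polytabloid K (t.act σ) = op (of K (Hyp n) σ) • polytabloid K t := by
  rw [polytabloid, polytabloid, columnSum_act, ← tabloid_act, ← PermModule.of_smul, smul_smul,
    smul_smul, ← op_mul, ← op_mul, mul_assoc, ← mul_assoc, ← map_mul, mul_inv_cancel, map_one,
    one_mul]

theorem columnSum_smul_ofTabloid_eq_zero {t s : BiTableau lam} (h : t.HaveOddInvolution s) :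
    op (columnSum K t) • PermModule.ofTabloid K s.tabloid = 0 := by
  classical
  obtain ⟨τ, hcol, hrow, hsq, hodd⟩ := h
  have hone : τ ≠ 1 := by
    rintro rfl
    rw [hypSgn_one] at hodd
    exact absurd hodd (by decide)
  have hiff (σ : Hyp n) : t.IsColPerm (τ * σ) ↔ t.IsColPerm σ := t.colGroup.mul_mem_cancel_left hcol
  rw [columnSum_smul_ofTabloid]
  refine Finset.sum_involution (fun σ _ => τ * σ) (fun σ _ => ?_) (fun σ _ _ h => ?_)
    (fun _ _ => Finset.mem_univ _) fun σ _ => ?_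
  · simp only [hiff, hypSgn_mul, hodd, BiTabloid.act_mul, tabloid_act_eq_self_iff.2 hrow]
    split_ifs
    · simp
    · rw [add_zero]
  · exact hone (mul_eq_right.1 h)
  · rw [← mul_assoc, hsq, one_mul]

theorem columnSum_smul_ofTabloid_act {t : BiTableau lam} {σ : Hyp n} (hσ : t.IsColPerm σ) :
    op (columnSum K t) • PermModule.ofTabloid K (t.act σ).tabloid =
      ((hypSgn σ : ℤ) : K) • polytabloid K t := by
  rw [← tabloid_act, ← PermModule.of_smul, smul_smul, ← op_mul, of_mul_columnSum K hσ, op_smul,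
    smul_assoc, polytabloid]

theorem exists_columnSum_smul_eq (t : BiTableau lam) (m : PermModule K lam) :
    ∃ c : K, c • polytabloid K t = op (columnSum K t) • m := by
  rw [← Submodule.mem_span_singleton]
  induction m using PermModule.induction with
  | zero => rw [smul_zero]; exact zero_mem _
  | add x y hx hy => rw [smul_add]; exact add_mem hx hy
  | smul_ofTabloid a s =>
    rw [smul_comm]
    refine Submodule.smul_mem _ a ?_
    rcases t.haveOddInvolution_or_exists_isColPerm s with hodd | ⟨σ, hσ, hs⟩
    · rw [columnSum_smul_ofTabloid_eq_zero K hodd]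
      exact zero_mem _
    · rw [← hs, columnSum_smul_ofTabloid_act K hσ]
      exact Submodule.mem_span_singleton.2 ⟨_, rfl⟩

theorem polytabloid_ne_zero (t : BiTableau lam) : polytabloid K t ≠ 0 := by
  classical
  intro h
  let coeff : PermModule K lam →+ K := Finsupp.applyAddHom t.tabloid
  have hcoeff (T : BiTabloid lam) (c : K) :
      coeff (c • PermModule.ofTabloid K T) = if T = t.tabloid then c else 0 := by
    change (c • Finsupp.single T (1 : K)) t.tabloid = _
    rw [Finsupp.smul_single, smul_eq_mul, mul_one, Finsupp.single_apply]
  have hone : coeff (polytabloid K t) = 1 := by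
    rw [polytabloid, columnSum_smul_ofTabloid, map_sum, Finset.sum_eq_single 1]
    · rw [if_pos (show t.IsColPerm 1 from t.colGroup.one_mem), hcoeff,
        if_pos (BiTabloid.act_one _), hypSgn_one, Units.val_one, Int.cast_one]
    · intro σ _ hσ
      split_ifs with hcol
      · rw [hcoeff, if_neg fun h => hσ <|
          BiTableau.eq_one_of_isRowPerm_of_isColPerm (tabloid_act_eq_self_iff.1 h) hcol]
      · exact map_zero coeff
    · simp
  rw [h, map_zero] at hone
  exact zero_ne_one hone

theorem specht_le_of_detects {Y : Submodule (HypAlg K n)ᵐᵒᵖ (PermModule K lam)} {t : BiTableau lam}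
    (h : Detects (op (columnSum K t)) ⊥ Y) : specht K lam ≤ Y := by
  obtain ⟨y, hy, hne⟩ := h
  obtain ⟨c, hc⟩ := exists_columnSum_smul_eq K t y
  have hc0 : c ≠ 0 := by
    rintro rfl
    exact hne (by rw [← hc, zero_smul, Submodule.mem_bot])
  have ht : polytabloid K t ∈ Y := by
    have hmem := Y.smul_mem (algebraMap K _ c⁻¹) (Y.smul_mem (op (columnSum K t)) hy)
    rwa [← hc, algebraMap_smul, smul_smul, inv_mul_cancel₀ hc0, one_smul] at hmem
  refine Submodule.span_le.2 ?_
  rintro _ ⟨s, rfl⟩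
  change polytabloid K s ∈ Y
  rw [← t.act_transport s, polytabloid_act]
  exact Y.smul_mem _ ht

theorem exists_isYoungModule (lam : BiPartition n) : ∃ Y, IsYoungModule K lam Y := by
  obtain ⟨t⟩ := (inferInstance : Nonempty (BiTableau lam))
  obtain ⟨Y, hsummand, hind, hdet⟩ := exists_indecomposable_isDirectSummand
    (Detects (op (columnSum K t)) (⊥ : Submodule (HypAlg K n)ᵐᵒᵖ (PermModule K lam)))
    ⟨PermModule.ofTabloid K t.tabloid, trivial, polytabloid_ne_zero K t⟩
    (not_detects_bot _ _) fun _ _ => Detects.or_of_sup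
  exact ⟨Y, hsummand, hind, specht_le_of_detects K hdet⟩

theorem IsYoungModule.exists_columnSum_smul_ne
    {Y : Submodule (HypAlg K n)ᵐᵒᵖ (PermModule K lam)} (hY : IsYoungModule K lam Y)
    (t : BiTableau lam) : ∃ y : Y, op (columnSum K t) • y ≠ 0 := by
  obtain ⟨⟨C, hC⟩, -, hS⟩ := hY
  refine ⟨Y.projectionOnto C hC (PermModule.ofTabloid K t.tabloid), fun h => ?_⟩
  rw [← map_smul] at h
  change Y.projectionOnto C hC (polytabloid K t) = 0 at h
  rw [Submodule.projectionOnto_apply_of_mem_left hC (hS (Submodule.subset_span ⟨t, rfl⟩))] at h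
  exact polytabloid_ne_zero K t (congrArg Subtype.val h)

end PermModules

/-! ### Products of diagrams -/

theorem refl_ne {r : ℕ} (x : Vertex r) : refl x ≠ x := fun h => by
  simpa [refl] using congrArg Prod.snd h

namespace Diagram

variable {r : ℕ}

theorem rel_unique (d : Diagram r) {u v w : Vertex r ⊕ Vertex r} (hv : d.rel u v) (hw : d.rel u w)
    (hvu : v ≠ u) (hwu : w ≠ u) : v = w :=
  (d.matching u).unique ⟨hvu, hv⟩ ⟨hwu, hw⟩

theorem eq_of_rel_inl_inr {d : Diagram r} {x y z : Vertex r} (hx : d.rel (.inl x) (.inr z))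
    (hy : d.rel (.inl y) (.inr z)) : x = y :=
  Sum.inl_injective <| d.rel_unique (d.rel.symm' hx) (d.rel.symm' hy) Sum.inl_ne_inr Sum.inl_ne_inr

theorem eq_of_rel_inl_inl {d : Diagram r} {x y z : Vertex r} (hz : d.rel (.inl x) (.inr z))
    (hy : d.rel (.inl x) (.inl y)) : y = x := by
  by_contra hne
  exact Sum.inr_ne_inl (d.rel_unique hz hy Sum.inr_ne_inl (Sum.inl_injective.ne hne))

theorem eq_of_rel_inr_inr {d : Diagram r} {x y z : Vertex r} (hz : d.rel (.inl z) (.inr x))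
    (hy : d.rel (.inr x) (.inr y)) : y = x := by
  by_contra hne
  exact Sum.inl_ne_inr <|
    d.rel_unique (d.rel.symm' hz) hy Sum.inl_ne_inr (Sum.inr_injective.ne hne)

theorem ext_of_common {d d' : Diagram r} (h : ∀ u, ∃ v, v ≠ u ∧ d.rel u v ∧ d'.rel u v) :
    d = d' := by
  refine Diagram.ext (Setoid.ext fun u v => ?_)
  obtain ⟨w, hwu, hw, hw'⟩ := h u
  rcases eq_or_ne v u with rfl | hvu
  · exact iff_of_true (d.rel.refl' _) (d'.rel.refl' _)
  · exact ⟨fun hv => d.rel_unique hv hw hvu hwu ▸ hw', fun hv => d'.rel_unique hv hw' hvu hwu ▸ hw⟩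

theorem comp_rel_inl {a : Diagram r} (b : Diagram r) {x y : Vertex r}
    (h : a.rel (.inl x) (.inl y)) : (a.comp b).rel (.inl x) (.inl y) :=
  Relation.EqvGen.rel _ _ (Or.inl ⟨_, _, h, rfl, rfl⟩)

theorem comp_rel_inr (a : Diagram r) {b : Diagram r} {x y : Vertex r}
    (h : b.rel (.inr x) (.inr y)) : (a.comp b).rel (.inr x) (.inr y) :=
  Relation.EqvGen.rel _ _ (Or.inr ⟨_, _, h, rfl, rfl⟩)

theorem comp_rel_through {a b : Diagram r} {x y z : Vertex r} (h : a.rel (.inl x) (.inr y))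
    (h' : b.rel (.inl y) (.inr z)) : (a.comp b).rel (.inl x) (.inr z) :=
  Relation.EqvGen.trans _ _ _ (Relation.EqvGen.rel _ _ (Or.inl ⟨_, _, h, rfl, rfl⟩))
    (Relation.EqvGen.rel _ _ (Or.inr ⟨_, _, h', rfl, rfl⟩))

/-- The top vertices on horizontal edges. -/
def topHorizontal (d : Diagram r) : Set (Vertex r) := {x | ∃ y, y ≠ x ∧ d.rel (.inl x) (.inl y)}

/-- The top vertices on edges that run to the bottom row. -/
def topThrough (d : Diagram r) : Set (Vertex r) := {x | ∃ z, d.rel (.inl x) (.inr z)}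

theorem compl_topHorizontal (d : Diagram r) : d.topHorizontalᶜ = d.topThrough := by
  ext x
  constructor
  · intro hx
    obtain ⟨y | z, ⟨hne, h⟩, -⟩ := d.matching (.inl x)
    · exact absurd ⟨y, fun hyx => hne (by rw [hyx]), h⟩ hx
    · exact ⟨z, h⟩
  · rintro ⟨z, hz⟩ ⟨y, hne, h⟩
    exact hne (eq_of_rel_inl_inl hz h)

theorem ncard_topHorizontal_add_ncard_topThrough (d : Diagram r) :
    d.topHorizontal.ncard + d.topThrough.ncard = Nat.card (Vertex r) := by
  rw [← compl_topHorizontal]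
  exact Set.ncard_add_ncard_compl _

theorem horizontal_le_comp_left (a b : Diagram r) : a.horizontal ≤ (a.comp b).horizontal :=
  Nat.div_le_div_right <| Set.ncard_le_ncard
    (fun _ ⟨y, hne, h⟩ => ⟨y, hne, comp_rel_inl b h⟩) (Set.toFinite _)

theorem ncard_topThrough_comp_le (a b : Diagram r) :
    (a.comp b).topThrough.ncard ≤ b.topThrough.ncard := by
  have exists_common_end : ∀ x ∈ (a.comp b).topThrough,
      ∃ w z, (a.comp b).rel (.inl x) (.inr z) ∧ b.rel (.inl w) (.inr z) := by
    rintro x ⟨z, hz⟩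
    obtain ⟨w | z', ⟨hne, h⟩, -⟩ := b.matching (.inr z)
    · exact ⟨w, z, hz, b.rel.symm' h⟩
    · exact absurd (congrArg Sum.inr (eq_of_rel_inr_inr hz (comp_rel_inr a h))) hne
  choose! w z hz hw using exists_common_end
  refine Set.ncard_le_ncard_of_injOn w (fun x hx => ⟨z x, hw x hx⟩) (fun x hx y hy hxy => ?_)
    (Set.toFinite _)
  have hzz : z x = z y := Sum.inr_injective <|
    b.rel_unique (hw x hx) (hxy ▸ hw y hy) Sum.inr_ne_inl Sum.inr_ne_inl
  exact eq_of_rel_inl_inr (hz x hx) (hzz ▸ hz y hy)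

theorem horizontal_le_comp_right (a b : Diagram r) : b.horizontal ≤ (a.comp b).horizontal := by
  refine Nat.div_le_div_right (c := 2) (?_ : b.topHorizontal.ncard ≤ (a.comp b).topHorizontal.ncard)
  have hle := ncard_topThrough_comp_le a b
  have hb := b.ncard_topHorizontal_add_ncard_topThrough
  have hab := (a.comp b).ncard_topHorizontal_add_ncard_topThrough
  omega

theorem horizontal_ofPerm_comp_le (σ : Hyp r) (d : Diagram r) :
    ((ofPerm σ).comp d).horizontal ≤ d.horizontal := by
  have hle := horizontal_le_comp_right (ofPerm σ⁻¹) ((ofPerm σ).comp d)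
  rwa [← comp_assoc, ← ofPerm_mul, inv_mul_cancel, one_comp] at hle

section CapCup

variable {l : ℕ}

theorem capCup_rel_iff {u v : Vertex r ⊕ Vertex r} :
    (capCup r l).rel u v ↔ capLabel l u = capLabel l v := Iff.rfl

theorem capCup_rel_inl {x : Vertex r} (hx : x.1.1 < l) :
    (capCup r l).rel (.inl x) (.inl (refl x)) := by
  simp [capCup_rel_iff, capLabel, hx, refl]

theorem capCup_rel_inr {x : Vertex r} (hx : x.1.1 < l) :
    (capCup r l).rel (.inr x) (.inr (refl x)) := by
  simp [capCup_rel_iff, capLabel, hx, refl]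

theorem capCup_rel_through {x : Vertex r} (hx : ¬ x.1.1 < l) :
    (capCup r l).rel (.inl x) (.inr x) := by
  simp [capCup_rel_iff, capLabel, hx]

theorem ncard_inner (hl : l ≤ r) : {x : Vertex r | x.1.1 < l}.ncard = 2 * l := by
  have hprod : {x : Vertex r | x.1.1 < l} =
      (((Finset.univ.filter fun i : Fin r => i.1 < l) ×ˢ (Finset.univ : Finset Bool) :
        Finset (Vertex r)) : Set (Vertex r)) := by
    ext x; simp
  rw [hprod, Set.ncard_coe_finset, Finset.card_product, Fin.card_filter_val_lt]
  simp [hl, mul_comm]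

theorem topHorizontal_capCup_subset : (capCup r l).topHorizontal ⊆ {x | x.1.1 < l} := by
  rintro x ⟨y, hne, h⟩
  by_contra hx
  exact hne (eq_of_rel_inl_inl (capCup_rel_through hx) h)

theorem horizontal_capCup_le (hl : l ≤ r) : (capCup r l).horizontal ≤ l := by
  have hle := Set.ncard_le_ncard (topHorizontal_capCup_subset (r := r) (l := l)) (Set.toFinite _)
  rw [ncard_inner hl] at hle
  exact (Nat.div_le_div_right hle).trans_eq (Nat.mul_div_cancel_left l two_pos)

theorem capCup_comp_capCup : (capCup r l).comp (capCup r l) = capCup r l := by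
  refine ext_of_common fun u => ?_
  rcases u with x | x <;> by_cases hx : x.1.1 < l
  · exact ⟨.inl (refl x), Sum.inl_injective.ne (refl_ne x), comp_rel_inl _ (capCup_rel_inl hx),
      capCup_rel_inl hx⟩
  · exact ⟨.inr x, Sum.inr_ne_inl, comp_rel_through (capCup_rel_through hx) (capCup_rel_through hx),
      capCup_rel_through hx⟩
  · exact ⟨.inr (refl x), Sum.inr_injective.ne (refl_ne x), comp_rel_inr _ (capCup_rel_inr hx),
      capCup_rel_inr hx⟩
  · exact ⟨.inl x, Sum.inl_ne_inr, Setoid.symm' _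
      (comp_rel_through (capCup_rel_through hx) (capCup_rel_through hx)),
      Setoid.symm' _ (capCup_rel_through hx)⟩

/-- An invariant of the components of `capCup l` stacked on itself: it is `some i` on the loop
through `±i` in the middle row and `none` on the components that meet the outer rows. -/
def loopLabel (l : ℕ) : Vertex r ⊕ (Vertex r ⊕ Vertex r) → Option (Fin r) :=
  Sum.elim (fun _ => none)
    (Sum.elim (fun x => if x.1.1 < l then some x.1 else none) fun _ => none)

theorem loopLabel_eq_of_stack {u v : Vertex r ⊕ (Vertex r ⊕ Vertex r)}
    (h : stack (capCup r l).rel (capCup r l).rel u v) : loopLabel l u = loopLabel l v := by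
  refine Setoid.eqvGen_le (s := Setoid.ker (loopLabel l)) (fun x y hxy => ?_) h
  rw [Setoid.ker_def]
  rcases hxy with ⟨p, q, hpq, rfl, rfl⟩ | ⟨p, q, hpq, rfl, rfl⟩ <;>
    rw [capCup_rel_iff] at hpq <;> rcases p with p | p <;> rcases q with q | q <;>
    by_cases hp : p.1.1 < l <;> by_cases hq : q.1.1 < l <;> simp_all [loopLabel, capLabel]

theorem loopLabel_outer (p : Vertex r ⊕ Vertex r) : loopLabel l (outer p) = none := by
  rcases p with p | p <;> rfl

theorem loopLabel_mid (hl : l ≤ r) (i : Fin l) :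
    loopLabel l (.inr (.inl (Fin.castLE hl i, true))) = some (Fin.castLE hl i) :=
  if_pos i.2

/-- The closed loops of `capCup l` stacked on itself. -/
def capCupLoop (hl : l ≤ r) (i : Fin l) :
    Avoid (stack (capCup r l).rel (capCup r l).rel) (Set.range outer) :=
  ⟨Quotient.mk _ (.inr (.inl (Fin.castLE hl i, true))), by
    rintro _ ⟨p, rfl⟩ h
    have hlabel := loopLabel_eq_of_stack (Quotient.exact h)
    rw [loopLabel_mid, loopLabel_outer] at hlabel
    cases hlabel⟩

theorem capCupLoop_bijective (hl : l ≤ r) : Function.Bijective (capCupLoop hl) := by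
  constructor
  · intro i j h
    have hlabel := loopLabel_eq_of_stack (Quotient.exact (congrArg Subtype.val h))
    rw [loopLabel_mid, loopLabel_mid] at hlabel
    exact Fin.castLE_injective hl (Option.some_injective _ hlabel)
  · rintro ⟨c, hc⟩
    induction c using Quotient.inductionOn with | _ u
    rcases u with x | x | x
    · exact absurd rfl (hc _ ⟨.inl x, rfl⟩)
    · by_cases hx : x.1.1 < l
      · refine ⟨⟨x.1.1, hx⟩, Subtype.ext <| Quotient.sound <|
          Relation.EqvGen.rel _ _ (Or.inl ⟨.inr (x.1, true), .inr x, ?_, rfl, rfl⟩)⟩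
        simp [capCup_rel_iff, capLabel, hx]
      · refine absurd (Quotient.sound ?_) (hc _ ⟨.inl x, rfl⟩)
        exact Relation.EqvGen.rel _ _ (Or.inl ⟨.inl x, .inr x, capCup_rel_through hx, rfl, rfl⟩)
    · exact absurd rfl (hc _ ⟨.inr x, rfl⟩)

theorem loops_capCup (hl : l ≤ r) : loops (capCup r l).rel (capCup r l).rel = l :=
  (Nat.card_congr (Equiv.ofBijective _ (capCupLoop_bijective hl))).symm.trans (Nat.card_fin l)

theorem hypEmbedding_apply_outer (σ : Hyp (r - l)) (w : Vertex (r - l)) :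
    (hypEmbedding r l σ).1 (outerVertex r l w) = outerVertex r l (σ.1 w) :=
  Equiv.Perm.viaEmbedding_apply _ _ _

theorem hypEmbedding_apply_inner (σ : Hyp (r - l)) {v : Vertex r} (hv : v.1.1 < l) :
    (hypEmbedding r l σ).1 v = v :=
  Equiv.Perm.viaEmbedding_apply_of_notMem _ _ _ (by rwa [mem_range_outerVertex, not_le])

theorem not_outerVertex_lt (w : Vertex (r - l)) : ¬ (outerVertex r l w).1.1 < l :=
  not_lt.2 ((mem_range_outerVertex r l _).1 ⟨w, rfl⟩)

theorem exists_outerVertex {v : Vertex r} (hv : ¬ v.1.1 < l) : ∃ w, outerVertex r l w = v :=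
  (mem_range_outerVertex r l v).2 (not_lt.1 hv)

theorem ofPerm_comp_rel_inl {σ : Hyp r} {d : Diagram r} {x y : Vertex r}
    (h : d.rel (.inl x) (.inl y)) : ((ofPerm σ).comp d).rel (.inl (σ.1 x)) (.inl (σ.1 y)) := by
  change compRel (permRel σ.1) d.rel _ _
  rw [compRel_permRel_left, Setoid.comap_rel]
  simpa using h

theorem ofPerm_comp_rel_through {σ : Hyp r} {d : Diagram r} {x y : Vertex r}
    (h : d.rel (.inl x) (.inr y)) : ((ofPerm σ).comp d).rel (.inl (σ.1 x)) (.inr y) := by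
  change compRel (permRel σ.1) d.rel _ _
  rw [compRel_permRel_left, Setoid.comap_rel]
  simpa using h

/-- The diagram `capCup l` with its outer vertical edges permuted by `σ`. -/
noncomputable def permCap (σ : Hyp (r - l)) : Diagram r :=
  (ofPerm (hypEmbedding r l σ)).comp (capCup r l)

theorem permCap_rel_inl (σ : Hyp (r - l)) {x : Vertex r} (hx : x.1.1 < l) :
    (permCap σ).rel (.inl x) (.inl (refl x)) := by
  have h := ofPerm_comp_rel_inl (σ := hypEmbedding r l σ) (capCup_rel_inl hx)
  rwa [hypEmbedding_apply_inner σ hx, hypEmbedding_apply_inner σ (v := refl x) hx] at h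

theorem permCap_rel_inr (σ : Hyp (r - l)) {x : Vertex r} (hx : x.1.1 < l) :
    (permCap σ).rel (.inr x) (.inr (refl x)) :=
  comp_rel_inr _ (capCup_rel_inr hx)

theorem permCap_rel_through (σ : Hyp (r - l)) (w : Vertex (r - l)) :
    (permCap σ).rel (.inl (outerVertex r l (σ.1 w))) (.inr (outerVertex r l w)) := by
  rw [← hypEmbedding_apply_outer]
  exact ofPerm_comp_rel_through (capCup_rel_through (not_outerVertex_lt w))

theorem permCap_injective : Function.Injective (permCap (r := r) (l := l)) := fun σ τ h =>
  Subtype.ext <| Equiv.ext fun w => (outerVertex r l).injective <|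
    eq_of_rel_inl_inr (h ▸ permCap_rel_through σ w) (permCap_rel_through τ w)

theorem ofPerm_comp_permCap (σ τ : Hyp (r - l)) :
    (ofPerm (hypEmbedding r l σ)).comp (permCap τ) = permCap (σ * τ) := by
  rw [permCap, permCap, ← comp_assoc, ← ofPerm_mul, map_mul]

theorem horizontal_permCap_le (hl : l ≤ r) (σ : Hyp (r - l)) : (permCap σ).horizontal ≤ l :=
  (horizontal_ofPerm_comp_le _ _).trans (horizontal_capCup_le hl)

theorem lt_horizontal_of_rel_inl (hl : l ≤ r) {d : Diagram r}
    (htop : ∀ x : Vertex r, x.1.1 < l → d.rel (.inl x) (.inl (refl x))) {x y : Vertex r}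
    (hx : ¬ x.1.1 < l) (hyx : y ≠ x) (hxy : d.rel (.inl x) (.inl y)) : l < d.horizontal := by
  have hy : ¬ y.1.1 < l := by
    intro hy
    obtain rfl : x = refl y := Sum.inl_injective <| d.rel_unique (d.rel.symm' hxy) (htop y hy)
      (Sum.inl_injective.ne hyx.symm) (Sum.inl_injective.ne (refl_ne y))
    exact hx hy
  have hsub : insert x (insert y {x : Vertex r | x.1.1 < l}) ⊆ d.topHorizontal := by
    rintro z (rfl | rfl | hz)
    · exact ⟨y, hyx, hxy⟩
    · exact ⟨x, hyx.symm, d.rel.symm' hxy⟩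
    · exact ⟨refl z, refl_ne z, htop z hz⟩
  have hle := Set.ncard_le_ncard hsub (Set.toFinite _)
  rw [Set.ncard_insert_of_notMem (by simp [hyx.symm, hx]) (Set.toFinite _),
    Set.ncard_insert_of_notMem (by simpa using hy) (Set.toFinite _), ncard_inner hl] at hle
  have : (l + 1) * 2 ≤ d.topHorizontal.ncard := by omega
  exact (Nat.le_div_iff_mul_le two_pos).2 this

theorem exists_hyp_rel_through {d : Diagram r}
    (hbot : ∀ x : Vertex r, x.1.1 < l → d.rel (.inr x) (.inr (refl x)))
    (hthrough : ∀ x : Vertex r, ¬ x.1.1 < l → x ∈ d.topThrough) :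
    ∃ σ : Hyp (r - l), ∀ w,
      d.rel (.inl (outerVertex r l (σ.1 w))) (.inr (outerVertex r l w)) := by
  have exists_outer (w : Vertex (r - l)) :
      ∃ w', d.rel (.inl (outerVertex r l w)) (.inr (outerVertex r l w')) := by
    obtain ⟨z, hz⟩ := hthrough _ (not_outerVertex_lt w)
    obtain ⟨w', rfl⟩ := exists_outerVertex fun hlt =>
      refl_ne z (eq_of_rel_inr_inr hz (hbot z hlt))
    exact ⟨w', hz⟩
  choose g hg using exists_outer
  have hg_inj : Function.Injective g := fun w w' h =>
    (outerVertex r l).injective (eq_of_rel_inl_inr (hg w) (h ▸ hg w'))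
  have hg_refl (w : Vertex (r - l)) : g (refl w) = refl (g w) :=
    (outerVertex r l).injective <| Sum.inr_injective <|
      d.rel_unique (hg (refl w)) (d.symm _ _ (hg w)) Sum.inr_ne_inl Sum.inr_ne_inl
  let γ : Hyp (r - l) :=
    ⟨Equiv.ofBijective g (Finite.injective_iff_bijective.1 hg_inj), hg_refl⟩
  refine ⟨γ⁻¹, fun w => ?_⟩
  have hw := hg (γ⁻¹.1 w)
  rwa [show g (γ⁻¹.1 w) = w from γ.1.apply_symm_apply w] at hw

theorem eq_permCap {d : Diagram r} {σ : Hyp (r - l)}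
    (htop : ∀ x : Vertex r, x.1.1 < l → d.rel (.inl x) (.inl (refl x)))
    (hbot : ∀ x : Vertex r, x.1.1 < l → d.rel (.inr x) (.inr (refl x)))
    (hσ : ∀ w, d.rel (.inl (outerVertex r l (σ.1 w))) (.inr (outerVertex r l w))) :
    d = permCap σ := by
  refine ext_of_common fun u => ?_
  rcases u with x | x <;> by_cases hx : x.1.1 < l
  · exact ⟨.inl (refl x), Sum.inl_injective.ne (refl_ne x), htop x hx, permCap_rel_inl σ hx⟩
  · obtain ⟨w, rfl⟩ := exists_outerVertex hx
    obtain ⟨w, rfl⟩ := σ.1.surjective w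
    exact ⟨_, Sum.inr_ne_inl, hσ w, permCap_rel_through σ w⟩
  · exact ⟨.inr (refl x), Sum.inr_injective.ne (refl_ne x), hbot x hx, permCap_rel_inr σ hx⟩
  · obtain ⟨w, rfl⟩ := exists_outerVertex hx
    exact ⟨_, Sum.inl_ne_inr, d.rel.symm' (hσ w), Setoid.symm' _ (permCap_rel_through σ w)⟩

theorem lt_horizontal_or_eq_permCap (hl : l ≤ r) {d : Diagram r}
    (htop : ∀ x : Vertex r, x.1.1 < l → d.rel (.inl x) (.inl (refl x)))
    (hbot : ∀ x : Vertex r, x.1.1 < l → d.rel (.inr x) (.inr (refl x))) :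
    l < d.horizontal ∨ ∃ σ : Hyp (r - l), d = permCap σ := by
  by_cases h : ∀ x : Vertex r, ¬ x.1.1 < l → x ∈ d.topThrough
  · obtain ⟨σ, hσ⟩ := exists_hyp_rel_through hbot h
    exact .inr ⟨σ, eq_permCap htop hbot hσ⟩
  · push Not at h
    obtain ⟨x, hx, hxd⟩ := h
    rw [← compl_topHorizontal, Set.notMem_compl_iff] at hxd
    obtain ⟨y, hyx, hxy⟩ := hxd
    exact .inl (lt_horizontal_of_rel_inl hl htop (not_lt.2 hx) hyx hxy)

end CapCup

end Diagram

/-! ### The corner algebra modulo the next layer -/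

section CornerAlgebra

variable {r : ℕ} {K : Type*} [Field K] {δ : K} {l : ℕ}

instance : Finite (Diagram r) :=
  have : Finite (Setoid (Vertex r ⊕ Vertex r)) :=
    Finite.of_injective (fun s : Setoid (Vertex r ⊕ Vertex r) => s.r)
      fun _ _ h => Setoid.ext fun a b => iff_of_eq (congrFun₂ h a b)
  Finite.of_injective Diagram.rel fun _ _ h => Diagram.ext h

instance : Module.Finite K (BrauerC r K δ) := Module.Finite.of_basis (BrauerC.basis δ)

theorem ofPerm_mul_diag (σ : Hyp r) (d : Diagram r) :
    BrauerC.ofGroup δ σ * BrauerC.diag δ d = BrauerC.diag δ ((Diagram.ofPerm σ).comp d) := by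
  have hloops : loops (Diagram.ofPerm σ).rel d.rel = 0 := loops_permRel_left σ.1 d.rel
  have hmul := BrauerC.diag_mul_diag (δ := δ) (.ofPerm σ) d
  rwa [hloops, pow_zero, one_smul] at hmul

theorem hat_of (σ : Hyp (r - l)) :
    hat r K δ l (MonoidAlgebra.of K _ σ) = BrauerC.ofGroup δ (hypEmbedding r l σ) := by
  simp [hat]

theorem diag_permCap (σ : Hyp (r - l)) : BrauerC.diag δ (Diagram.permCap σ) =
    hat r K δ l (MonoidAlgebra.of K _ σ) * BrauerC.diag δ (.capCup r l) := by
  rw [hat_of, ofPerm_mul_diag, Diagram.permCap]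

theorem diag_capCup (hδ : δ ≠ 0) :
    BrauerC.diag δ (.capCup r l) = δ ^ l • BrauerC.e δ r l := by
  rw [BrauerC.e, smul_inv_smul₀ (pow_ne_zero l hδ)]

theorem e_mul_e (hδ : δ ≠ 0) (hl : l ≤ r) :
    BrauerC.e δ r l * BrauerC.e δ r l = BrauerC.e δ r l := by
  rw [BrauerC.e, smul_mul_smul_comm, BrauerC.diag_mul_diag, Diagram.loops_capCup hl,
    Diagram.capCup_comp_capCup, smul_smul, mul_assoc, inv_mul_cancel₀ (pow_ne_zero l hδ), mul_one]

/-- The `K`-linear span of the diagrams with at least `m` horizontal edges. It coincides with the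
two-sided ideal `layerIdeal` generated by them, and serves to compute linear maps on that ideal. -/
noncomputable def layerSpan (r : ℕ) {K : Type*} [Field K] (δ : K) (m : ℕ) :
    Submodule K (BrauerC r K δ) :=
  Submodule.span K {y | ∃ d : Diagram r, m ≤ d.horizontal ∧ y = BrauerC.diag δ d}

theorem mul_mem_layerSpan {m : ℕ} (x : BrauerC r K δ) {y : BrauerC r K δ}
    (hy : y ∈ layerSpan r δ m) : x * y ∈ layerSpan r δ m := by
  have hle : ⊤ * layerSpan r δ m ≤ layerSpan r δ m := by
    rw [← (BrauerC.basis δ).span_eq, layerSpan, Submodule.span_mul_span, Submodule.span_le]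
    rintro _ ⟨_, ⟨a, rfl⟩, _, ⟨d, hd, rfl⟩, rfl⟩
    change BrauerC.diag δ a * BrauerC.diag δ d ∈ _
    rw [BrauerC.diag_mul_diag]
    exact Submodule.smul_mem _ _
      (Submodule.subset_span ⟨_, hd.trans (Diagram.horizontal_le_comp_right a d), rfl⟩)
  exact hle (Submodule.mul_mem_mul Submodule.mem_top hy)

theorem mem_layerSpan_mul {m : ℕ} (x : BrauerC r K δ) {y : BrauerC r K δ}
    (hy : y ∈ layerSpan r δ m) : y * x ∈ layerSpan r δ m := by
  have hle : layerSpan r δ m * ⊤ ≤ layerSpan r δ m := by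
    rw [← (BrauerC.basis δ).span_eq, layerSpan, Submodule.span_mul_span, Submodule.span_le]
    rintro _ ⟨_, ⟨d, hd, rfl⟩, _, ⟨a, rfl⟩, rfl⟩
    change BrauerC.diag δ d * BrauerC.diag δ a ∈ _
    rw [BrauerC.diag_mul_diag]
    exact Submodule.smul_mem _ _
      (Submodule.subset_span ⟨_, hd.trans (Diagram.horizontal_le_comp_left d a), rfl⟩)
  exact hle (Submodule.mul_mem_mul hy Submodule.mem_top)

theorem mem_layerSpan_of_mem_layerIdeal {m : ℕ} {x : BrauerC r K δ}
    (hx : x ∈ layerIdeal r K δ m) : x ∈ layerSpan r δ m := by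
  let I : TwoSidedIdeal (BrauerC r K δ) := .mk' (layerSpan r δ m : Set _)
    (zero_mem _) add_mem neg_mem (mul_mem_layerSpan _) (mem_layerSpan_mul _)
  have hI (y) : y ∈ I ↔ y ∈ layerSpan r δ m := TwoSidedIdeal.mem_mk' _ _ _ _ _ _ y
  exact (hI x).1 <| TwoSidedIdeal.mem_span_iff.1 hx I fun y hy =>
    (hI y).2 (Submodule.subset_span hy)

theorem smul_mem_layerIdeal {m : ℕ} (c : K) {x : BrauerC r K δ} (hx : x ∈ layerIdeal r K δ m) :
    c • x ∈ layerIdeal r K δ m := by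
  rw [← one_mul x, ← smul_mul_assoc]
  exact (layerIdeal r K δ m).mul_mem_left _ _ hx

theorem exists_diag_sub_mem (hδ : δ ≠ 0) (hl : l ≤ r) {d : Diagram r}
    (htop : ∀ x : Vertex r, x.1.1 < l → d.rel (.inl x) (.inl (refl x)))
    (hbot : ∀ x : Vertex r, x.1.1 < l → d.rel (.inr x) (.inr (refl x))) :
    ∃ a : HypAlg K (r - l), BrauerC.diag δ d - BrauerC.e δ r l * hat r K δ l a ∈
      layerIdeal r K δ (l + 1) := by
  rcases Diagram.lt_horizontal_or_eq_permCap hl htop hbot with hd | ⟨σ, rfl⟩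
  · refine ⟨0, ?_⟩
    rw [map_zero, mul_zero, sub_zero]
    exact TwoSidedIdeal.subset_span ⟨d, hd, rfl⟩
  · refine ⟨δ ^ l • MonoidAlgebra.of K _ σ, ?_⟩
    rw [diag_permCap, diag_capCup hδ, map_smul, mul_smul_comm, mul_smul_comm, hat_mul_e, sub_self]
    exact TwoSidedIdeal.zero_mem _

theorem exists_e_mul_e_sub_mem (hδ : δ ≠ 0) (hl : l ≤ r) (b : BrauerC r K δ) :
    ∃ a : HypAlg K (r - l), BrauerC.e δ r l * b * BrauerC.e δ r l -
      BrauerC.e δ r l * hat r K δ l a ∈ layerIdeal r K δ (l + 1) := by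
  induction (BrauerC.basis δ).mem_span b using Submodule.span_induction with
  | zero => exact ⟨0, by simp⟩
  | add x y _ _ hx hy =>
    obtain ⟨a, ha⟩ := hx
    obtain ⟨b, hb⟩ := hy
    refine ⟨a + b, ?_⟩
    have := (layerIdeal r K δ (l + 1)).add_mem ha hb
    rwa [← add_sub_add_comm, ← mul_add, ← map_add, ← add_mul, ← mul_add] at this
  | smul c x _ hx =>
    obtain ⟨a, ha⟩ := hx
    refine ⟨c • a, ?_⟩
    rw [map_smul, mul_smul_comm, mul_smul_comm, smul_mul_assoc, ← smul_sub]
    exact smul_mem_layerIdeal c ha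
  | mem x hx =>
    obtain ⟨d, rfl⟩ := hx
    obtain ⟨k, hk⟩ : ∃ k : K, BrauerC.e δ r l * BrauerC.diag δ d * BrauerC.e δ r l =
        k • BrauerC.diag δ (((Diagram.capCup r l).comp d).comp (.capCup r l)) := by
      rw [BrauerC.e, smul_mul_assoc, BrauerC.diag_mul_diag, smul_smul, smul_mul_smul_comm,
        BrauerC.diag_mul_diag, smul_smul]
      exact ⟨_, rfl⟩
    obtain ⟨a, ha⟩ := exists_diag_sub_mem hδ hl
      (fun _ hx => Diagram.comp_rel_inl (.capCup r l) <|
        Diagram.comp_rel_inl d (Diagram.capCup_rel_inl hx))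
      (fun _ hx => Diagram.comp_rel_inr ((Diagram.capCup r l).comp d) (Diagram.capCup_rel_inr hx))
    refine ⟨k • a, ?_⟩
    change BrauerC.e δ r l * BrauerC.diag δ d * BrauerC.e δ r l - _ ∈ _
    rw [hk, map_smul, mul_smul_comm, ← smul_sub]
    exact smul_mem_layerIdeal k ha

/-- The coefficients of an element of the Brauer algebra at the diagrams `permCap σ`, assembled to
an element of the group algebra. They are scaled so that `e_l` is sent to `1`. -/
noncomputable def capCoeff (r : ℕ) {K : Type*} [Field K] (δ : K) (l : ℕ) :
    BrauerC r K δ →ₗ[K] HypAlg K (r - l) :=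
  (BrauerC.basis δ).constr K <|
    Function.extend Diagram.permCap (fun σ => δ ^ l • MonoidAlgebra.of K _ σ) 0

theorem capCoeff_permCap (σ : Hyp (r - l)) :
    capCoeff r δ l (BrauerC.diag δ (Diagram.permCap σ)) = δ ^ l • MonoidAlgebra.of K _ σ := by
  rw [capCoeff, BrauerC.diag, Module.Basis.constr_basis, Diagram.permCap_injective.extend_apply]

theorem capCoeff_of_forall_ne {d : Diagram r} (h : ∀ σ : Hyp (r - l), Diagram.permCap σ ≠ d) :
    capCoeff r δ l (BrauerC.diag δ d) = 0 := by
  rw [capCoeff, BrauerC.diag, Module.Basis.constr_basis,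
    Function.extend_apply' _ _ _ (not_exists.2 h), Pi.zero_apply]

theorem capCoeff_of_mem_layerIdeal (hl : l ≤ r) {x : BrauerC r K δ}
    (hx : x ∈ layerIdeal r K δ (l + 1)) : capCoeff r δ l x = 0 := by
  suffices layerSpan r δ (l + 1) ≤ LinearMap.ker (capCoeff r δ l) from
    this (mem_layerSpan_of_mem_layerIdeal hx)
  refine Submodule.span_le.2 ?_
  rintro _ ⟨d, hd, rfl⟩
  refine capCoeff_of_forall_ne ?_
  rintro σ rfl
  exact (Diagram.horizontal_permCap_le hl σ).not_gt hd

theorem capCoeff_ofPerm_comp (σ : Hyp (r - l)) (d : Diagram r) :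
    capCoeff r δ l (BrauerC.diag δ ((Diagram.ofPerm (hypEmbedding r l σ)).comp d)) =
      MonoidAlgebra.of K _ σ * capCoeff r δ l (BrauerC.diag δ d) := by
  by_cases h : ∃ τ : Hyp (r - l), Diagram.permCap τ = d
  · obtain ⟨τ, rfl⟩ := h
    rw [Diagram.ofPerm_comp_permCap, capCoeff_permCap, capCoeff_permCap, map_mul, mul_smul_comm]
  · rw [not_exists] at h
    rw [capCoeff_of_forall_ne h, mul_zero, capCoeff_of_forall_ne]
    intro τ hτ
    refine h (σ⁻¹ * τ) ?_
    rw [← Diagram.ofPerm_comp_permCap, hτ, ← Diagram.comp_assoc, ← Diagram.ofPerm_mul,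
      ← map_mul, inv_mul_cancel, map_one, Diagram.one_comp]

theorem capCoeff_hat_mul (a : HypAlg K (r - l)) (x : BrauerC r K δ) :
    capCoeff r δ l (hat r K δ l a * x) = a * capCoeff r δ l x := by
  induction a using MonoidAlgebra.induction_on with
  | add a b ha hb => rw [map_add, add_mul, map_add, ha, hb, add_mul]
  | smul c a ha => rw [map_smul, smul_mul_assoc, map_smul, ha, smul_mul_assoc]
  | of σ =>
    suffices capCoeff r δ l ∘ₗ LinearMap.mulLeft K (hat r K δ l (MonoidAlgebra.of K _ σ)) =
        LinearMap.mulLeft K (MonoidAlgebra.of K _ σ) ∘ₗ capCoeff r δ l from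
      LinearMap.congr_fun this x
    refine (BrauerC.basis δ).ext fun d => ?_
    change capCoeff r δ l (_ * BrauerC.diag δ d) = _ * capCoeff r δ l (BrauerC.diag δ d)
    rw [hat_of, ofPerm_mul_diag, capCoeff_ofPerm_comp]

theorem capCoeff_e (hδ : δ ≠ 0) : capCoeff r δ l (BrauerC.e δ r l) = 1 := by
  have h := diag_permCap (r := r) (δ := δ) (l := l) 1
  rw [map_one, map_one, one_mul] at h
  rw [BrauerC.e, map_smul, ← h, capCoeff_permCap, inv_smul_smul₀ (pow_ne_zero l hδ), map_one]

end CornerAlgebra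

/-! ### Induced modules -/

open MulOpposite
open scoped TensorProduct

section Induced

variable (r : ℕ) (K : Type*) [Field K] (δ : K)

/-- The submodule `Z J_m` of a right module `Z` over the Brauer algebra. -/
noncomputable def layerSMul (m : ℕ) (Z : Type*) [AddCommGroup Z] [Module (BrauerC r K δ)ᵐᵒᵖ Z] :
    Submodule (BrauerC r K δ)ᵐᵒᵖ Z :=
  Submodule.span _ {x | ∃ j ∈ layerIdeal r K δ m, ∃ z : Z, x = op j • z}

variable {r K δ}

theorem map_mem_layerSMul {m : ℕ} {Z Z' : Type*} [AddCommGroup Z] [Module (BrauerC r K δ)ᵐᵒᵖ Z]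
    [AddCommGroup Z'] [Module (BrauerC r K δ)ᵐᵒᵖ Z'] (f : Z →ₗ[(BrauerC r K δ)ᵐᵒᵖ] Z') {z : Z}
    (hz : z ∈ layerSMul r K δ m Z) : f z ∈ layerSMul r K δ m Z' := by
  suffices layerSMul r K δ m Z ≤ (layerSMul r K δ m Z').comap f from this hz
  refine Submodule.span_le.2 ?_
  rintro _ ⟨j, hj, z, rfl⟩
  exact Submodule.subset_span ⟨j, hj, f z, map_smul f _ _⟩

variable (r K δ) (l : ℕ) {X : Type*} [AddCommGroup X] [Module (BrauerC r K δ) X]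
  [Module (BrauerC r K δ)ᵐᵒᵖ X] [SMulCommClass (BrauerC r K δ) (BrauerC r K δ)ᵐᵒᵖ X]
  {M : Type*} [AddCommGroup M] [Module (HypAlg K (r - l))ᵐᵒᵖ M]

/-- The element `e_l x` of `e_l X`. -/
noncomputable def cornerMk (x : X) : corner r K δ l X :=
  ⟨BrauerC.e δ r l • x, LinearMap.mem_range_self _ x⟩

/-- The pure tensor `m ⊗ n`; recall that `BalTensor` is a quotient of the tensor product with the
factors in the opposite order. -/
noncomputable def balMk (m : M) (n : corner r K δ l X) :
    BalTensor (HypAlg K (r - l)) (BrauerC r K δ) M (corner r K δ l X) :=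
  Submodule.Quotient.mk (n ⊗ₜ[ℤ] m)

/-- The additive map `m ↦ m ⊗ e_l ξ`. -/
noncomputable def indGen (ξ : X) :
    M →+ BalTensor (HypAlg K (r - l)) (BrauerC r K δ) M (corner r K δ l X) :=
  AddMonoidHom.mk' (fun m => balMk r K δ l m (cornerMk r K δ l ξ)) fun _ _ =>
    congrArg Submodule.Quotient.mk (TensorProduct.tmul_add _ _ _)

variable {r K δ l}

theorem indGen_apply (ξ : X) (m : M) :
    indGen r K δ l ξ m = balMk r K δ l m (cornerMk r K δ l ξ) := rfl

theorem exists_cornerMk_eq (n : corner r K δ l X) : ∃ x, cornerMk r K δ l x = n := by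
  obtain ⟨x, hx⟩ := n.2
  exact ⟨x, Subtype.ext hx⟩

theorem op_smul_cornerMk (b : BrauerC r K δ) (x : X) :
    op b • cornerMk r K δ l x = cornerMk r K δ l (op b • x) :=
  Subtype.ext (smul_comm (BrauerC.e δ r l) (op b) x).symm

theorem smul_cornerMk (a : HypAlg K (r - l)) (x : X) :
    a • cornerMk r K δ l x = cornerMk r K δ l (hat r K δ l a • x) := by
  refine Subtype.ext ?_
  change hat r K δ l a • (BrauerC.e δ r l • x) = BrauerC.e δ r l • (hat r K δ l a • x)
  rw [smul_smul, smul_smul, hat_mul_e]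

theorem cornerMk_e_smul (hδ : δ ≠ 0) (hl : l ≤ r) (x : X) :
    cornerMk r K δ l (BrauerC.e δ r l • x) = cornerMk r K δ l x := by
  refine Subtype.ext ?_
  change BrauerC.e δ r l • (BrauerC.e δ r l • x) = BrauerC.e δ r l • x
  rw [smul_smul, e_mul_e hδ hl]

theorem op_smul_balMk (b : BrauerC r K δ) (m : M) (n : corner r K δ l X) :
    op b • balMk r K δ l m n = balMk r K δ l m (op b • n) := rfl

theorem balMk_op_smul (a : HypAlg K (r - l)) (m : M) (n : corner r K δ l X) :
    balMk r K δ l (op a • m) n = balMk r K δ l m (a • n) :=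
  (Submodule.Quotient.eq _).2 (Submodule.subset_span ⟨a, m, n, rfl⟩)

theorem op_smul_indGen (b : BrauerC r K δ) (ξ : X) (m : M) :
    op b • indGen r K δ l ξ m = indGen r K δ l (op b • ξ) m := by
  rw [indGen_apply, op_smul_balMk, op_smul_cornerMk, indGen_apply]

variable (r K δ) in
/-- An element generating a bimodule over the Brauer algebra on which the left and the right action
agree. The unit of `B` and its class in `B / J_m` are of this kind, so that `Ind_l` and `ind_l` can
be treated together. -/
structure IsCentralGenerator (ξ : X) : Prop where
  exists_smul : ∀ x : X, ∃ b : BrauerC r K δ, x = b • ξ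
  smul_eq : ∀ b : BrauerC r K δ, b • ξ = op b • ξ

namespace IsCentralGenerator

variable {ξ : X}

theorem indGen_op_smul (hξ : IsCentralGenerator r K δ ξ) (a : HypAlg K (r - l)) (m : M) :
    indGen r K δ l ξ (op a • m) = op (hat r K δ l a) • indGen r K δ l ξ m := by
  rw [op_smul_indGen, ← hξ.smul_eq, indGen_apply, indGen_apply, balMk_op_smul, smul_cornerMk]

theorem op_e_smul_indGen (hξ : IsCentralGenerator r K δ ξ) (hδ : δ ≠ 0) (hl : l ≤ r)
    (m : M) :
    op (BrauerC.e δ r l) • indGen r K δ l ξ m = indGen r K δ l ξ m := by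
  rw [op_smul_indGen, ← hξ.smul_eq, indGen_apply, indGen_apply, cornerMk_e_smul hδ hl]

theorem span_range_indGen (hξ : IsCentralGenerator r K δ ξ) :
    Submodule.span (BrauerC r K δ)ᵐᵒᵖ (Set.range (indGen r K δ l (M := M) ξ)) = ⊤ := by
  refine Submodule.eq_top_iff'.2 fun z => ?_
  induction z using Submodule.Quotient.induction_on with | _ z
  induction z using TensorProduct.induction_on with
  | zero => exact zero_mem _
  | add x y hx hy => exact add_mem hx hy
  | tmul n m =>
    obtain ⟨x, rfl⟩ := exists_cornerMk_eq n
    obtain ⟨b, rfl⟩ := hξ.exists_smul x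
    have hmk := op_smul_indGen (l := l) b ξ m
    rw [← hξ.smul_eq] at hmk
    change indGen r K δ l (b • ξ) m ∈ _
    rw [← hmk]
    exact Submodule.smul_mem _ _ (Submodule.subset_span ⟨m, rfl⟩)

theorem exists_op_e_smul_sub_mem (hξ : IsCentralGenerator r K δ ξ) (hδ : δ ≠ 0)
    (hl : l ≤ r) (z : BalTensor (HypAlg K (r - l)) (BrauerC r K δ) M (corner r K δ l X)) :
    ∃ m : M, op (BrauerC.e δ r l) • z - indGen r K δ l ξ m ∈ layerSMul r K δ (l + 1) _ := by
  induction hξ.span_range_indGen.ge (Submodule.mem_top (x := z))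
    using Submodule.closure_induction with
  | zero => exact ⟨0, by simp⟩
  | add x y _ _ hx hy =>
    obtain ⟨m, hm⟩ := hx
    obtain ⟨m', hm'⟩ := hy
    refine ⟨m + m', ?_⟩
    rw [smul_add, map_add, add_sub_add_comm]
    exact add_mem hm hm'
  | smul_mem b x hx =>
    obtain ⟨m, rfl⟩ := hx
    obtain ⟨a, ha⟩ := exists_e_mul_e_sub_mem hδ hl b.unop
    refine ⟨op a • m, Submodule.subset_span ⟨_, ha, indGen r K δ l ξ m, ?_⟩⟩
    rw [op_sub, sub_smul, hξ.indGen_op_smul, op_mul, op_mul, op_mul, op_unop, mul_smul, mul_smul,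
      mul_smul, hξ.op_e_smul_indGen hδ hl]

theorem finite_balTensor [Module.Finite (HypAlg K (r - l))ᵐᵒᵖ M]
    (hξ : IsCentralGenerator r K δ ξ) :
    Module.Finite (BrauerC r K δ)ᵐᵒᵖ
      (BalTensor (HypAlg K (r - l)) (BrauerC r K δ) M (corner r K δ l X)) := by
  classical
  obtain ⟨S, hS⟩ := Module.Finite.fg_top (R := (HypAlg K (r - l))ᵐᵒᵖ) (M := M)
  refine ⟨⟨S.image (indGen r K δ l ξ), ?_⟩⟩
  rw [eq_top_iff, ← hξ.span_range_indGen, Submodule.span_le]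
  rintro _ ⟨m, rfl⟩
  induction hS.ge (Submodule.mem_top (x := m)) using Submodule.span_induction with
  | mem x hx => exact Submodule.subset_span (Finset.mem_coe.2 (Finset.mem_image_of_mem _ hx))
  | zero => rw [map_zero]; exact zero_mem _
  | add x y _ _ hx hy => rw [map_add]; exact add_mem hx hy
  | smul a x _ hx =>
    rw [← op_unop a, hξ.indGen_op_smul]
    exact Submodule.smul_mem _ _ hx

end IsCentralGenerator

end Induced

section Functors

variable {r : ℕ} {K : Type*} [Field K] {δ : K} {l : ℕ}

theorem isCentralGenerator_one : IsCentralGenerator r K δ (1 : BrauerC r K δ) where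
  exists_smul x := ⟨x, (mul_one x).symm⟩
  smul_eq b := (mul_one b).trans (one_mul b).symm

theorem isCentralGenerator_mk_one (m : ℕ) :
    IsCentralGenerator r K δ (Submodule.Quotient.mk 1 : LayerQuotient r K δ m) where
  exists_smul x := by
    induction x using Submodule.Quotient.induction_on with | _ x
    exact ⟨x, by rw [smul_mk_layer, mul_one]⟩
  smul_eq b := by
    rw [smul_mk_layer, ← Submodule.Quotient.mk_smul]
    exact congrArg Submodule.Quotient.mk ((mul_one b).trans (one_mul b).symm)

instance : Module.Finite K (BrauerC r K δ)ᵐᵒᵖ := Module.Finite.equiv (opLinearEquiv K)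

instance : IsNoetherianRing (BrauerC r K δ)ᵐᵒᵖ := isNoetherian_of_tower K inferInstance

instance : IsArtinianRing (BrauerC r K δ)ᵐᵒᵖ := isArtinian_of_tower K inferInstance

instance (lam : BiPartition (r - l)) :
    Module.Finite (BrauerC r K δ)ᵐᵒᵖ (BrauerPermModule r K δ l lam) :=
  isCentralGenerator_one.finite_balTensor

variable {M Y : Type*} [AddCommGroup M] [Module (HypAlg K (r - l))ᵐᵒᵖ M]
  [AddCommGroup Y] [Module (HypAlg K (r - l))ᵐᵒᵖ Y]

variable (r K δ l) in
/-- The map `m ↦ m ⊗ e_l` from `M` to `Ind_l M`. -/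
noncomputable abbrev bigGen : M →+ BigInd r K δ l M := indGen r K δ l 1

variable (r K δ l) in
/-- The map `y ↦ y ⊗ e_l` from `Y` to `ind_l Y`. -/
noncomputable abbrev smallGen : Y →+ SmallInd r K δ l Y :=
  indGen r K δ l (Submodule.Quotient.mk 1)

theorem op_smul_smallGen_eq_zero {j : BrauerC r K δ} (hj : j ∈ layerIdeal r K δ (l + 1)) (y : Y) :
    op j • smallGen r K δ l y = 0 := by
  have hmk : op j • (Submodule.Quotient.mk 1 : LayerQuotient r K δ (l + 1)) = 0 :=
    (Submodule.Quotient.mk_eq_zero (layerSubmodule r K δ (l + 1))).2 (by simpa [layerSubmodule])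
  have hcorner : cornerMk r K δ l (0 : LayerQuotient r K δ (l + 1)) = 0 :=
    Subtype.ext (smul_zero _)
  rw [op_smul_indGen, hmk, indGen_apply, hcorner]
  exact congrArg Submodule.Quotient.mk (TensorProduct.zero_tmul _ _)

theorem op_smul_smallInd_eq_zero {j : BrauerC r K δ} (hj : j ∈ layerIdeal r K δ (l + 1))
    (z : SmallInd r K δ l Y) : op j • z = 0 := by
  induction (isCentralGenerator_mk_one (l + 1)).span_range_indGen.ge (Submodule.mem_top (x := z))
    using Submodule.closure_induction with
  | zero => exact smul_zero _
  | add x y _ _ hx hy => rw [smul_add, hx, hy, add_zero]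
  | smul_mem b x hx =>
    obtain ⟨y, rfl⟩ := hx
    rw [smul_smul, ← op_unop b, ← op_mul]
    exact op_smul_smallGen_eq_zero ((layerIdeal r K δ (l + 1)).mul_mem_left _ j hj) y

theorem eq_zero_of_mem_layerSMul_smallInd {z : SmallInd r K δ l Y}
    (hz : z ∈ layerSMul r K δ (l + 1) _) : z = 0 := by
  suffices layerSMul r K δ (l + 1) (SmallInd r K δ l Y) = ⊥ from (Submodule.mem_bot _).1 (this ▸ hz)
  rw [layerSMul, Submodule.span_eq_bot]
  rintro _ ⟨j, hj, z, rfl⟩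
  exact op_smul_smallInd_eq_zero hj z

/-- The additive map `[x] ↦ capCoeff (x e_l)` on `B / J_{l+1}`. -/
noncomputable def layerCoeff (r : ℕ) (K : Type*) [Field K] (δ : K) (l : ℕ) (hl : l ≤ r) :
    LayerQuotient r K δ (l + 1) →+ HypAlg K (r - l) :=
  QuotientAddGroup.lift (layerSubmodule r K δ (l + 1)).toAddSubgroup
    ((capCoeff r δ l).toAddMonoidHom.comp (AddMonoidHom.mulRight (BrauerC.e δ r l))) fun _ hx =>
    capCoeff_of_mem_layerIdeal hl ((layerIdeal r K δ (l + 1)).mul_mem_right _ _ hx)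

theorem layerCoeff_mk (hl : l ≤ r) (x : BrauerC r K δ) :
    layerCoeff r K δ l hl (Submodule.Quotient.mk x) = capCoeff r δ l (x * BrauerC.e δ r l) := rfl

theorem layerCoeff_hat_smul (hl : l ≤ r) (a : HypAlg K (r - l)) (x : LayerQuotient r K δ (l + 1)) :
    layerCoeff r K δ l hl (hat r K δ l a • x) = a * layerCoeff r K δ l hl x := by
  induction x using Submodule.Quotient.induction_on with | _ x
  rw [smul_mk_layer, layerCoeff_mk, layerCoeff_mk, mul_assoc, capCoeff_hat_mul]

theorem layerCoeff_cornerMk_mk_one (hδ : δ ≠ 0) (hl : l ≤ r) : layerCoeff r K δ l hl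
    (cornerMk r K δ l (Submodule.Quotient.mk 1 : LayerQuotient r K δ (l + 1))).1 = 1 := by
  change capCoeff r δ l (BrauerC.e δ r l * 1 * BrauerC.e δ r l) = 1
  rw [mul_one, e_mul_e hδ hl, capCoeff_e hδ]

/-- The additive map `y ⊗ n ↦ y · layerCoeff n` before passing to the quotient `ind_l Y`. -/
noncomputable def tensorCoeff (hl : l ≤ r) (Y : Type*) [AddCommGroup Y]
    [Module (HypAlg K (r - l))ᵐᵒᵖ Y] :
    corner r K δ l (LayerQuotient r K δ (l + 1)) ⊗[ℤ] Y →+ Y :=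
  TensorProduct.liftAddHom
    ((Module.toAddMonoidEnd (HypAlg K (r - l))ᵐᵒᵖ Y).toAddMonoidHom.comp <|
      opAddEquiv.toAddMonoidHom.comp <|
        (layerCoeff r K δ l hl).comp (Submodule.subtype _).toAddMonoidHom)
    fun c n y => by
      change op (layerCoeff r K δ l hl (c • n.1)) • y =
        op (layerCoeff r K δ l hl n.1) • (c • y)
      rw [map_zsmul, op_smul, smul_assoc, smul_comm]

theorem tensorCoeff_tmul (hl : l ≤ r) (n : corner r K δ l (LayerQuotient r K δ (l + 1))) (y : Y) :
    tensorCoeff hl Y (n ⊗ₜ y) = op (layerCoeff r K δ l hl n.1) • y := rfl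

theorem tensorCoeff_eq_zero (hl : l ≤ r)
    {x : corner r K δ l (LayerQuotient r K δ (l + 1)) ⊗[ℤ] Y}
    (hx : x ∈ Submodule.span (BrauerC r K δ)ᵐᵒᵖ
      {x | ∃ (a : HypAlg K (r - l)) (y : Y) (n : corner r K δ l (LayerQuotient r K δ (l + 1))),
        x = n ⊗ₜ[ℤ] (op a • y) - (a • n) ⊗ₜ[ℤ] y}) :
    tensorCoeff hl Y x = 0 := by
  induction hx using Submodule.closure_induction with
  | zero => exact map_zero _
  | add x y _ _ hx hy => rw [map_add, hx, hy, add_zero]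
  | smul_mem c x hx =>
    obtain ⟨a, y, n, rfl⟩ := hx
    rw [smul_sub, TensorProduct.smul_tmul', TensorProduct.smul_tmul', map_sub, tensorCoeff_tmul,
      tensorCoeff_tmul, sub_eq_zero, smul_smul, ← op_mul, ← layerCoeff_hat_smul]
    exact congrArg (fun x => op (layerCoeff r K δ l hl x) • y) (smul_comm (hat r K δ l a) c n.1)

theorem smallGen_injective (hδ : δ ≠ 0) (hl : l ≤ r) :
    Function.Injective (smallGen r K δ l : Y → _) := by
  refine (injective_iff_map_eq_zero _).2 fun y hy => ?_
  have h := tensorCoeff_eq_zero hl ((Submodule.Quotient.mk_eq_zero _).1 hy)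
  rwa [tensorCoeff_tmul, layerCoeff_cornerMk_mk_one hδ, op_one, one_smul] at h

variable (r K δ l) in
/-- The projection `e_l B → e_l (B / J_{l+1})`. -/
noncomputable def cornerProj : corner r K δ l (BrauerC r K δ) →ₗ[(BrauerC r K δ)ᵐᵒᵖ]
    corner r K δ l (LayerQuotient r K δ (l + 1)) :=
  (layerSubmodule r K δ (l + 1)).mkQ.restrict (by
    rintro _ ⟨x, rfl⟩
    exact ⟨Submodule.Quotient.mk x, rfl⟩)

variable (δ) in
/-- The map `Ind_l M → ind_l Y` induced by a homomorphism `M → Y`. -/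
noncomputable def bigToSmall (f : M →ₗ[(HypAlg K (r - l))ᵐᵒᵖ] Y) :
    BigInd r K δ l M →ₗ[(BrauerC r K δ)ᵐᵒᵖ] SmallInd r K δ l Y :=
  Submodule.mapQ _ _ (TensorProduct.AlgebraTensorModule.map (cornerProj r K δ l)
    f.toAddMonoidHom.toIntLinearMap) <| by
    refine Submodule.span_le.2 ?_
    rintro _ ⟨a, m, n, rfl⟩
    refine Submodule.subset_span ⟨a, f m, cornerProj r K δ l n, ?_⟩
    rw [map_sub, TensorProduct.AlgebraTensorModule.map_tmul,
      TensorProduct.AlgebraTensorModule.map_tmul, ← map_smul]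
    rfl

theorem bigToSmall_bigGen (f : M →ₗ[(HypAlg K (r - l))ᵐᵒᵖ] Y) (m : M) :
    bigToSmall δ f (bigGen r K δ l m) = smallGen r K δ l (f m) := rfl

theorem exists_smallGen_eq_op_e_smul (hδ : δ ≠ 0) (hl : l ≤ r) (z : SmallInd r K δ l Y) :
    ∃ y : Y, smallGen r K δ l y = op (BrauerC.e δ r l) • z := by
  obtain ⟨y, hy⟩ := (isCentralGenerator_mk_one (l + 1)).exists_op_e_smul_sub_mem hδ hl z
  exact ⟨y, (sub_eq_zero.1 (eq_zero_of_mem_layerSMul_smallInd hy)).symm⟩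

theorem exists_smallGen_eq_op_e_smul_map (hδ : δ ≠ 0) (hl : l ≤ r)
    (k : BigInd r K δ l M →ₗ[(BrauerC r K δ)ᵐᵒᵖ] SmallInd r K δ l Y) :
    ∃ φ : M →ₗ[(HypAlg K (r - l))ᵐᵒᵖ] Y, ∀ m,
      smallGen r K δ l (φ m) = op (BrauerC.e δ r l) • k (bigGen r K δ l m) := by
  choose φ hφ using fun m => exists_smallGen_eq_op_e_smul hδ hl (k (bigGen r K δ l m))
  refine ⟨{ toFun := φ, map_add' := fun m m' => ?_, map_smul' := fun a m => ?_ }, hφ⟩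
  · apply smallGen_injective hδ hl
    rw [hφ, map_add, map_add, map_add, smul_add, hφ, hφ]
  · apply smallGen_injective hδ hl
    obtain ⟨a, rfl⟩ := op_surjective a
    rw [hφ, isCentralGenerator_one.indGen_op_smul, RingHom.id_apply,
      (isCentralGenerator_mk_one (l + 1)).indGen_op_smul, hφ, map_smul, smul_smul, smul_smul,
      ← op_mul, ← op_mul, hat_mul_e]

/-- The restriction of a homomorphism `k : Ind_l M → ind_l Y` to the parts `M ⊗ e_l` and `Y ⊗ e_l`:
it sends `m` to the element `y` for which `y ⊗ e_l` is `k (m ⊗ e_l) e_l`. -/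
noncomputable def restrictHom (hδ : δ ≠ 0) (hl : l ≤ r)
    (k : BigInd r K δ l M →ₗ[(BrauerC r K δ)ᵐᵒᵖ] SmallInd r K δ l Y) :
    M →ₗ[(HypAlg K (r - l))ᵐᵒᵖ] Y :=
  (exists_smallGen_eq_op_e_smul_map hδ hl k).choose

theorem smallGen_restrictHom (hδ : δ ≠ 0) (hl : l ≤ r)
    (k : BigInd r K δ l M →ₗ[(BrauerC r K δ)ᵐᵒᵖ] SmallInd r K δ l Y) (m : M) :
    smallGen r K δ l (restrictHom hδ hl k m) =
      op (BrauerC.e δ r l) • k (bigGen r K δ l m) :=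
  (exists_smallGen_eq_op_e_smul_map hδ hl k).choose_spec m

theorem restrictHom_add (hδ : δ ≠ 0) (hl : l ≤ r)
    (k k' : BigInd r K δ l M →ₗ[(BrauerC r K δ)ᵐᵒᵖ] SmallInd r K δ l Y) :
    restrictHom hδ hl (k + k') = restrictHom hδ hl k + restrictHom hδ hl k' := by
  refine LinearMap.ext fun m => smallGen_injective hδ hl ?_
  rw [LinearMap.add_apply, map_add, smallGen_restrictHom, smallGen_restrictHom,
    smallGen_restrictHom, LinearMap.add_apply, smul_add]

theorem restrictHom_bigToSmall (hδ : δ ≠ 0) (hl : l ≤ r)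
    (f : M →ₗ[(HypAlg K (r - l))ᵐᵒᵖ] Y) : restrictHom hδ hl (bigToSmall δ f) = f := by
  refine LinearMap.ext fun m => smallGen_injective hδ hl ?_
  rw [smallGen_restrictHom, bigToSmall_bigGen,
    (isCentralGenerator_mk_one (l + 1)).op_e_smul_indGen hδ hl]

theorem surjective_of_restrictHom_surjective (hδ : δ ≠ 0) (hl : l ≤ r)
    {k : BigInd r K δ l M →ₗ[(BrauerC r K δ)ᵐᵒᵖ] SmallInd r K δ l Y}
    (hk : Function.Surjective (restrictHom hδ hl k)) : Function.Surjective k := by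
  rw [← LinearMap.range_eq_top, eq_top_iff,
    ← (isCentralGenerator_mk_one (l + 1)).span_range_indGen, Submodule.span_le]
  rintro _ ⟨y, rfl⟩
  obtain ⟨m, rfl⟩ := hk y
  change smallGen r K δ l _ ∈ _
  rw [smallGen_restrictHom, ← map_smul]
  exact LinearMap.mem_range_self _ _

end Functors

/-! ### Young modules of the Brauer algebra -/

section BrauerYoung

variable {r : ℕ} {K : Type*} [Field K] {δ : K} {l : ℕ}

theorem hasQuotientIso_or_of_isCompl (hδ : δ ≠ 0) (hl : l ≤ r)
    {M : Type*} [AddCommGroup M] [Module (HypAlg K (r - l))ᵐᵒᵖ M]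
    [IsArtinian (HypAlg K (r - l))ᵐᵒᵖ M] [IsNoetherian (HypAlg K (r - l))ᵐᵒᵖ M]
    {Y Y' : Submodule (HypAlg K (r - l))ᵐᵒᵖ M} (hYY' : IsCompl Y Y')
    (hY : Indecomposable (HypAlg K (r - l))ᵐᵒᵖ Y)
    {N C : Submodule (BrauerC r K δ)ᵐᵒᵖ (BigInd r K δ l M)} (hNC : IsCompl N C) :
    HasQuotientIso (BrauerC r K δ)ᵐᵒᵖ N (SmallInd r K δ l Y) ∨
      HasQuotientIso (BrauerC r K δ)ᵐᵒᵖ C (SmallInd r K δ l Y) := by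
  let p := bigToSmall δ (Y.projectionOnto Y' hYY')
  have hsum : restrictHom hδ hl (p ∘ₗ N.projection C hNC) ∘ₗ Y.subtype +
      restrictHom hδ hl (p ∘ₗ C.projection N hNC.symm) ∘ₗ Y.subtype =
        (1 : Module.End (HypAlg K (r - l))ᵐᵒᵖ Y) := by
    have hproj : N.projection C hNC + C.projection N hNC.symm = LinearMap.id :=
      LinearMap.ext (Submodule.projection_add_projection_eq_self hNC)
    rw [← LinearMap.add_comp, ← restrictHom_add, ← LinearMap.comp_add, hproj, LinearMap.comp_id,
      restrictHom_bigToSmall]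
    exact LinearMap.ext (Submodule.projectionOnto_apply_left hYY')
  have hquot {N C : Submodule (BrauerC r K δ)ᵐᵒᵖ (BigInd r K δ l M)} (hNC : IsCompl N C)
      (hunit : IsUnit (M := Module.End (HypAlg K (r - l))ᵐᵒᵖ Y)
        (restrictHom hδ hl (p ∘ₗ N.projection C hNC) ∘ₗ Y.subtype)) :
      HasQuotientIso (BrauerC r K δ)ᵐᵒᵖ N (SmallInd r K δ l Y) := by
    have hsurj : Function.Surjective (restrictHom hδ hl (p ∘ₗ N.projection C hNC)) :=
      .of_comp (g := Y.subtype) ((Module.End.isUnit_iff _).1 hunit).2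
    exact hasQuotientIso_iff_exists_surjective.2 ⟨p ∘ₗ N.subtype,
      .of_comp (g := N.projectionOnto C hNC) (surjective_of_restrictHom_surjective hδ hl hsurj)⟩
  have := hY.isLocalRing_end
  exact (IsLocalRing.isUnit_or_isUnit_of_add_one hsum).imp (hquot hNC) (hquot hNC.symm)

variable {lam : BiPartition (r - l)}

theorem exists_e_mul_columnSum_smul_sub_mem (hδ : δ ≠ 0) (hl : l ≤ r) (t : BiTableau lam)
    (x : BrauerPermModule r K δ l lam) : ∃ c : K,
      op (BrauerC.e δ r l * hat r K δ l (columnSum K t)) • x -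
        algebraMap K (BrauerC r K δ)ᵐᵒᵖ c • bigGen r K δ l (polytabloid K t) ∈
          layerSMul r K δ (l + 1) (BrauerPermModule r K δ l lam) := by
  have hgen : IsCentralGenerator r K δ (1 : BrauerC r K δ) := isCentralGenerator_one
  obtain ⟨m, hm⟩ := hgen.exists_op_e_smul_sub_mem hδ hl x
  obtain ⟨c, hc⟩ := exists_columnSum_smul_eq K t m
  refine ⟨c, ?_⟩
  have hmem := Submodule.smul_mem _ (op (hat r K δ l (columnSum K t))) hm
  rwa [smul_sub, smul_smul, ← op_mul, ← hgen.indGen_op_smul, ← hc,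
    ← algebraMap_smul (HypAlg K (r - l))ᵐᵒᵖ c, MulOpposite.algebraMap_apply, hgen.indGen_op_smul,
    AlgHom.commutes] at hmem

theorem exists_sub_smul_mem_of_sub_algebraMap_smul_mem {A Z : Type*} [Ring A] [Algebra K A]
    [AddCommGroup Z] [Module A Z] {T : Submodule A Z} {v x y : Z} {c d : K}
    (hc : x - algebraMap K A c • v ∈ T) (hd : y - algebraMap K A d • v ∈ T) (hx : x ∉ T) :
    ∃ a : A, y - a • x ∈ T := by
  have hc0 : c ≠ 0 := by
    rintro rfl
    rw [map_zero, zero_smul, sub_zero] at hc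
    exact hx hc
  refine ⟨algebraMap K A (d * c⁻¹), ?_⟩
  have hsub := sub_mem hd (T.smul_mem (algebraMap K A (d * c⁻¹)) hc)
  rwa [smul_sub, smul_smul, ← map_mul, inv_mul_cancel_right₀ hc0, sub_sub_sub_cancel_right] at hsub

theorem exists_e_mul_columnSum_smul_ne_zero (hδ : δ ≠ 0) (hl : l ≤ r)
    {Y : Submodule (HypAlg K (r - l))ᵐᵒᵖ (PermModule K lam)} (hY : IsYoungModule K lam Y)
    (t : BiTableau lam) : ∃ z : SmallInd r K δ l Y,
      op (BrauerC.e δ r l * hat r K δ l (columnSum K t)) • z ≠ 0 := by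
  obtain ⟨y, hy⟩ := IsYoungModule.exists_columnSum_smul_ne K hY t
  have hgen := isCentralGenerator_mk_one (r := r) (K := K) (δ := δ) (l + 1)
  refine ⟨smallGen r K δ l y, fun h => hy ?_⟩
  rw [op_mul, mul_smul, hgen.op_e_smul_indGen hδ hl, ← hgen.indGen_op_smul] at h
  exact (map_eq_zero_iff _ (smallGen_injective hδ hl)).1 h

theorem IsYoungModule.rankOneTest (hδ : δ ≠ 0) (hl : l ≤ r)
    {Y : Submodule (HypAlg K (r - l))ᵐᵒᵖ (PermModule K lam)} (hY : IsYoungModule K lam Y)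
    (t : BiTableau lam) :
    RankOneTest (X := BrauerPermModule r K δ l lam)
      (op (BrauerC.e δ r l * hat r K δ l (columnSum K t))) (layerSMul r K δ (l + 1) _)
      (SmallInd r K δ l Y) where
  map_mem f _ hx := map_mem_layerSMul f hx
  map_eq_zero f _ hx := eq_zero_of_mem_layerSMul_smallInd (map_mem_layerSMul f hx)
  exists_smul_sub_smul_mem x y hx := by
    obtain ⟨c, hc⟩ := exists_e_mul_columnSum_smul_sub_mem hδ hl t x
    obtain ⟨d, hd⟩ := exists_e_mul_columnSum_smul_sub_mem hδ hl t y
    exact exists_sub_smul_mem_of_sub_algebraMap_smul_mem hc hd hx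
  exists_smul_ne_zero := exists_e_mul_columnSum_smul_ne_zero hδ hl hY t
  hasQuotientIso_or N C hNC := by
    obtain ⟨⟨Y', hYY'⟩, hind, -⟩ := hY
    exact hasQuotientIso_or_of_isCompl hδ hl hYY' hind hNC

end BrauerYoung

end TypeC

theorem mainTheorem9_general (K : Type*) [Field K] (δ : K) (hδ : δ ≠ 0) (r l : ℕ) (hl : l ≤ r)
    (lam : TypeC.BiPartition (r - l)) :
    (∃ Y, TypeC.IsYoungModule K lam Y) ∧
    ∀ Y, TypeC.IsYoungModule K lam Y →
      (∃ N, TypeC.IsBrauerYoungModule r K δ l lam Y N ∧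
        ∀ N', TypeC.IsBrauerYoungModule r K δ l lam Y N' →
          Nonempty (N' ≃ₗ[(TypeC.BrauerC r K δ)ᵐᵒᵖ] N)) ∧
      ∀ {ι : Type*} [DecidableEq ι] (N : ι → Submodule (TypeC.BrauerC r K δ)ᵐᵒᵖ
          (TypeC.BrauerPermModule r K δ l lam)),
        DirectSum.IsInternal N →
        ∃! i, TypeC.HasQuotientIso (TypeC.BrauerC r K δ)ᵐᵒᵖ (N i)
          (TypeC.SmallInd r K δ l Y) := by
  refine ⟨TypeC.exists_isYoungModule K lam, fun Y hY => ?_⟩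
  obtain ⟨t⟩ := (inferInstance : Nonempty (TypeC.BiTableau lam))
  have htest := hY.rankOneTest hδ hl t
  obtain ⟨N, hsummand, hindec, hquot⟩ := htest.exists_summand
  exact ⟨⟨N, ⟨hsummand, hindec, hquot⟩, fun N' ⟨hsummand', hindec', hquot'⟩ =>
    htest.nonempty_linearEquiv hsummand hsummand' hindec hindec' hquot hquot'⟩,
    fun _ hN => htest.existsUnique_of_isInternal hN⟩

theorem mainTheorem9 (K : Type*) [Field K] (δ : K) (hδ : δ ≠ 0) (r l : ℕ) (hl : l ≤ r)
    (lam : TypeC.BiPartition (r - l)) :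
    (∃ Y, TypeC.IsYoungModule K lam Y) ∧
    ∀ Y, TypeC.IsYoungModule K lam Y →
      (∃ N, TypeC.IsBrauerYoungModule r K δ l lam Y N ∧
        ∀ N', TypeC.IsBrauerYoungModule r K δ l lam Y N' →
          Nonempty (N' ≃ₗ[(TypeC.BrauerC r K δ)ᵐᵒᵖ] N)) ∧
      ∀ (k : ℕ) (N : Fin k → Submodule (TypeC.BrauerC r K δ)ᵐᵒᵖ
          (TypeC.BrauerPermModule r K δ l lam)),
        DirectSum.IsInternal N →
        (∀ i, TypeC.Indecomposable (TypeC.BrauerC r K δ)ᵐᵒᵖ (N i)) →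
        ∃! i, TypeC.HasQuotientIso (TypeC.BrauerC r K δ)ᵐᵒᵖ (N i)
          (TypeC.SmallInd r K δ l Y) := by
  obtain ⟨hexists, h⟩ := mainTheorem9_general K δ hδ r l hl lam
  exact ⟨hexists, fun Y hY => ⟨(h Y hY).1, fun _ N hN _ => (h Y hY).2 N hN⟩⟩
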